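/- Let $p$ be a prime, $d\ge 1$ an integer, and let $\psi:(\mathbb{Q}_p,+)\to\mathbb{C}_p^\times$ be a non-trivial smooth character (a homomorphism with open kernel). Let $\mathcal{H}$ be the Heisenberg group, with underlying set $(\mathbb{Q}_p^d\oplus\mathbb{Q}_p^d)\times\mathbb{Q}_p$ and product $[w_1,t_1][w_2,t_2]=[w_1+w_2,\,t_1+t_2+\tfrac12\omega(w_1,w_2)]$, where $\omega((x_1,y_1),(x_2,y_2))=x_1\cdot y_2-y_1\cdot x_2$. It acts on the space $\mathcal{S}$ of locally constant, compactly supported functions $\mathbb{Q}_p^d\to\mathbb{C}_p$ by the Schrödinger representation $$(\rho_\psi([(a,b),t])f)(x)=\psi\big(t+\tfrac12 a\cdot b+b\cdot x\big)\,f(x+a).$$ The group $\mathrm{Sp}_{2d}(\mathbb{Q}_p)$ acts on row vectors $w\in\mathbb{Q}_p^{2d}$ by $w\mapsto wg$. For $g\in\mathrm{Sp}_{2d}(\mathbb{Q}_p)$ let $T_g$ be an invertible linear operator on $\mathcal{S}$, unique up to a scalar, with $\rho_\psi([w,t])\circ T_g=T_g\circ\rho_\psi([wg,t])$ for all $[w,t]\in\mathcal{H}$.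 Let $P\subset \mathrm{Sp}_{2d}(\mathbb{Q}_p)$ be the Siegel parabolic subgroup of the matrices whose lower left $d\times d$ block vanishes, and let $\mathrm{Gr}=P\backslash \mathrm{Sp}_{2d}(\mathbb{Q}_p)$. For $\alpha=Pg\in \mathrm{Gr}$ let $\|\cdot\|_\alpha$ be the positive multiple of the norm $f\mapsto\sup_{x}|T_g(f)(x)|_p$ on $\mathcal{S}$ that takes the value $1$ at the characteristic function of $\mathbb{Z}_p^d$. Norms and seminorms on a $\mathbb{C}_p$-vector space are understood to satisfy the strong triangle inequality. A seminorm $q_1$ is dominated by $q_2$ if $q_1\le D\,q_2$ for some constant $D>0$; two norms are equivalent if each dominates the other. Two (semi)norms are independent if no non-zero seminorm is dominated by both. Norms $\|\cdot\|_1,\dots,\|\cdot\|_n$ are independent if for every $i$ the norm $\|\cdot\|_i$ and $\max_{j\ne i}\|\cdot\|_j$ are independent (the maximum of the empty family being $0$). An $\mathcal{H}$-invariant norm $\|\cdot\|$ on $\mathcal{S}$ is locally maximal at a vector $w\neq 0$ if $\|w\|=1$ and every $\mathcal{H}$-invariant norm $\|\cdot\|'$ on $\mathcal{S}$ that is dominated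 by $\|\cdot\|$ and satisfies $\|w\|'=1$ satisfies $\|\cdot\|'\le\|\cdot\|$. Let $I\subset \mathrm{Gr}$ be a finite subset. Then: 1. the norms $\|\cdot\|_\alpha$, $\alpha\in I$, are independent; 2. equivalently, the diagonal map $\mathcal{S}\to\bigoplus_{\alpha\in I}\widehat{\mathcal{S}}_{\|\cdot\|_\alpha}$ into the direct sum of the completions (with the maximum norm) has dense image; 3. consequently, if $I$ is non-empty, the norm $\|\cdot\|_I=\max_{\alpha\in I}\|\cdot\|_\alpha$ on $\mathcal{S}$ is equivalent to an $\mathcal{H}$-invariant norm on $\mathcal{S}$ that is locally maximal at some non-zero vector of $\mathcal{S}$. -/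

import Mathlib

open Matrix

noncomputable section

namespace PadicSchrodinger

section Norms

variable (p : ℕ) [Fact p.Prime] (V : Type*) [AddCommGroup V] [Module ℂ_[p] V]

/-- A (non-archimedean) norm on a `ℂ_[p]`-vector space: a definite seminorm satisfying the
strong triangle inequality. -/
structure UltraNorm extends Seminorm ℂ_[p] V where
  ultra' : ∀ v w : V, toFun (v + w) ≤ max (toFun v) (toFun w)
  definite' : ∀ v : V, toFun v = 0 → v = 0

variable {p V}

instance : CoeFun (UltraNorm p V) (fun _ => V → ℝ) := ⟨fun N => N.toSeminorm⟩

/-- `q₁` is dominated by `q₂`. -/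
def Dominated (q₁ q₂ : Seminorm ℂ_[p] V) : Prop :=
  ∃ D : ℝ, 0 < D ∧ ∀ v, q₁ v ≤ D * q₂ v

/-- Two (semi)norms are equivalent if each dominates the other. -/
def Equivalent (q₁ q₂ : Seminorm ℂ_[p] V) : Prop :=
  Dominated q₁ q₂ ∧ Dominated q₂ q₁

/-- The pointwise maximum `max_{i ∈ s} N i` (the zero seminorm if `s` is empty). -/
def maxNorm {ι : Type*} (s : Finset ι) (N : ι → UltraNorm p V) : Seminorm ℂ_[p] V :=
  s.sup fun i => (N i).toSeminorm

/-- Two (semi)norms are independent: no non-zero non-archimedean seminorm is dominated by both. -/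
def IndependentPair (q₁ q₂ : Seminorm ℂ_[p] V) : Prop :=
  ∀ q : Seminorm ℂ_[p] V, (∀ v w, q (v + w) ≤ max (q v) (q w)) →
    Dominated q q₁ → Dominated q q₂ → q = 0

open Classical in
/-- The norms `N i`, `i ∈ s`, are independent: each `N i` is independent of the maximum of the
others. -/
def IndependentNorms {ι : Type*} (s : Finset ι) (N : ι → UltraNorm p V) : Prop :=
  ∀ i ∈ s, IndependentPair (N i).toSeminorm (maxNorm (s.erase i) N)

/-- The vector space `V`, viewed as a normed space with the norm `N`. -/
def WithNorm (_N : UltraNorm p V) : Type _ := V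

instance (N : UltraNorm p V) : AddCommGroup (WithNorm N) := inferInstanceAs (AddCommGroup V)

instance (N : UltraNorm p V) : Module ℂ_[p] (WithNorm N) := inferInstanceAs (Module ℂ_[p] V)

instance (N : UltraNorm p V) : NormedAddCommGroup (WithNorm N) :=
  AddGroupNorm.toNormedAddCommGroup
    (E := V) { N.toSeminorm.toAddGroupSeminorm with
      eq_zero_of_map_eq_zero' := N.definite' }

/-- The completion of `V` with respect to the norm `N`. -/
abbrev Compl (N : UltraNorm p V) : Type _ := UniformSpace.Completion (WithNorm N)

/-- The diagonal map from `V` to the direct sum of its completions with respect to the norms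
`N i`, `i ∈ s`.  As `s` is finite, the direct sum is the product, whose topology is that of the
maximum of the norms of the components. -/
def diagonalMap {ι : Type*} (s : Finset ι) (N : ι → UltraNorm p V) (v : V) :
    (i : s) → Compl (N i) :=
  fun i => ((show WithNorm (N i) from v : WithNorm (N i)) : Compl (N i))

/-- A norm is invariant under the representation `ρ`. -/
def IsInvariant {G : Type*} [Group G] (ρ : Representation ℂ_[p] G V) (N : UltraNorm p V) : Prop :=
  ∀ g v, N (ρ g v) = N v

/-- `N` is an invariant norm which is normalized and locally maximal at the non-zero vector `w`:
every invariant norm which is normalized at `w` and dominated by `N` is `≤ N`. -/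
def IsLocallyMaximalAt {G : Type*} [Group G] (ρ : Representation ℂ_[p] G V)
    (N : UltraNorm p V) (w : V) : Prop :=
  w ≠ 0 ∧ IsInvariant ρ N ∧ N w = 1 ∧
    ∀ N' : UltraNorm p V, IsInvariant ρ N' → N' w = 1 →
      Dominated N'.toSeminorm N.toSeminorm → ∀ v, N' v ≤ N v

end Norms

variable (p : ℕ) [Fact p.Prime] (d : ℕ)

/-- The Heisenberg group of dimension `2d+1` over `ℚ_[p]`.  An element is written `[w, t]`, with
`w = (a, b)` a row vector in `ℚ_[p]^d ⊕ ℚ_[p]^d`. -/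
@[ext]
structure Heisenberg where
  w : Fin d ⊕ Fin d → ℚ_[p]
  t : ℚ_[p]

variable {p d}

/-- The symplectic form `ω((a₁, b₁), (a₂, b₂)) = a₁ ⬝ b₂ - b₁ ⬝ a₂`. -/
def omega (w₁ w₂ : Fin d ⊕ Fin d → ℚ_[p]) : ℚ_[p] :=
  (w₁ ∘ Sum.inl) ⬝ᵥ (w₂ ∘ Sum.inr) - (w₁ ∘ Sum.inr) ⬝ᵥ (w₂ ∘ Sum.inl)

lemma comp_add_inl (w₁ w₂ : Fin d ⊕ Fin d → ℚ_[p]) :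
    (w₁ + w₂) ∘ Sum.inl = w₁ ∘ Sum.inl + w₂ ∘ Sum.inl := rfl

lemma comp_add_inr (w₁ w₂ : Fin d ⊕ Fin d → ℚ_[p]) :
    (w₁ + w₂) ∘ Sum.inr = w₁ ∘ Sum.inr + w₂ ∘ Sum.inr := rfl

lemma omega_add_left (w₁ w₂ w₃ : Fin d ⊕ Fin d → ℚ_[p]) :
    omega (w₁ + w₂) w₃ = omega w₁ w₃ + omega w₂ w₃ := by
  simp only [omega, comp_add_inl, comp_add_inr, add_dotProduct]; ring

lemma omega_add_right (w₁ w₂ w₃ : Fin d ⊕ Fin d → ℚ_[p]) :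
    omega w₁ (w₂ + w₃) = omega w₁ w₂ + omega w₁ w₃ := by
  simp only [omega, comp_add_inl, comp_add_inr, dotProduct_add]; ring

lemma omega_self (w : Fin d ⊕ Fin d → ℚ_[p]) : omega w w = 0 := by
  simp only [omega]; rw [dotProduct_comm]; ring

lemma omega_zero_left (w : Fin d ⊕ Fin d → ℚ_[p]) : omega 0 w = 0 := by
  have := omega_add_left 0 0 w
  simpa using this

lemma omega_zero_right (w : Fin d ⊕ Fin d → ℚ_[p]) : omega w 0 = 0 := by
  have := omega_add_right w 0 0
  simpa using this

lemma omega_neg_left (w : Fin d ⊕ Fin d → ℚ_[p]) : omega (-w) w = 0 := by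
  have := omega_add_left (-w) w w
  rw [neg_add_cancel, omega_zero_left, omega_self, add_zero] at this
  exact this.symm

/-- `[w₁, t₁] * [w₂, t₂] = [w₁ + w₂, t₁ + t₂ + ω(w₁, w₂) / 2]`. -/
instance : Mul (Heisenberg p d) :=
  ⟨fun g h => ⟨g.w + h.w, g.t + h.t + (1 / 2) * omega g.w h.w⟩⟩

instance : One (Heisenberg p d) := ⟨⟨0, 0⟩⟩

instance : Inv (Heisenberg p d) := ⟨fun g => ⟨-g.w, -g.t⟩⟩

lemma mul_def (g h : Heisenberg p d) :
    g * h = ⟨g.w + h.w, g.t + h.t + (1 / 2) * omega g.w h.w⟩ := rfl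

lemma one_def : (1 : Heisenberg p d) = ⟨0, 0⟩ := rfl

lemma inv_def (g : Heisenberg p d) : g⁻¹ = ⟨-g.w, -g.t⟩ := rfl

instance : Group (Heisenberg p d) :=
  Group.ofLeftAxioms
    (fun a b c => by
      simp only [mul_def, omega_add_left, omega_add_right, Heisenberg.mk.injEq]
      exact ⟨add_assoc _ _ _, by ring⟩)
    (fun a => by simp [mul_def, one_def, omega_zero_left])
    (fun a => by simp [mul_def, one_def, inv_def, omega_neg_left])

/-- The right action of the symplectic group on the Heisenberg group: `[w, t] ⬝ g = [w g, t]`. -/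
def Heisenberg.act (h : Heisenberg p d) (g : symplecticGroup (Fin d) ℚ_[p]) : Heisenberg p d :=
  ⟨h.w ᵥ* (g : Matrix (Fin d ⊕ Fin d) (Fin d ⊕ Fin d) ℚ_[p]), h.t⟩

variable (p d)

/-- The space of locally constant compactly supported functions `ℚ_[p]^d → ℂ_[p]`. -/
def schwartz : Submodule ℂ_[p] ((Fin d → ℚ_[p]) → ℂ_[p]) where
  carrier := {f | IsLocallyConstant f ∧ HasCompactSupport f}
  add_mem' := fun hf hg => ⟨hf.1.add hg.1, hf.2.add hg.2⟩
  zero_mem' := ⟨IsLocallyConstant.const 0, HasCompactSupport.zero⟩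
  smul_mem' := by
    intro c f hf
    refine ⟨hf.1.comp (fun z => c * z), ?_⟩
    exact HasCompactSupport.mul_left (f := fun _ => c) hf.2

/-- The characteristic function of `ℤ_[p]^d`. -/
def charZp : schwartz p d :=
  ⟨Set.indicator (Metric.closedBall (0 : Fin d → ℚ_[p]) 1) 1, by
    have hcl : IsClopen (Metric.closedBall (0 : Fin d → ℚ_[p]) 1) :=
      IsUltrametricDist.isClopen_closedBall _ one_ne_zero
    refine ⟨?_, ?_⟩
    · rw [← LocallyConstant.coe_charFn ℂ_[p] hcl]
      exact LocallyConstant.isLocallyConstant _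
    · exact HasCompactSupport.intro (isCompact_closedBall (0 : Fin d → ℚ_[p]) 1)
        (fun x hx => Set.indicator_of_notMem hx _)⟩

variable {p d}

lemma charZp_ne_zero : charZp p d ≠ 0 := by
  intro h
  have h0 : (charZp p d : (Fin d → ℚ_[p]) → ℂ_[p]) 0 = 0 := by rw [h]; rfl
  simp [charZp] at h0

lemma bddAbove_norm (f : schwartz p d) :
    BddAbove (Set.range fun x => ‖(f : (Fin d → ℚ_[p]) → ℂ_[p]) x‖) := by
  obtain ⟨C, hC⟩ := f.2.2.exists_bound_of_continuous f.2.1.continuous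
  exact ⟨C, by rintro _ ⟨x, rfl⟩; exact hC x⟩

/-- The sup norm on Schwartz functions. -/
def supNorm : UltraNorm p (schwartz p d) where
  toFun f := ⨆ x, ‖(f : (Fin d → ℚ_[p]) → ℂ_[p]) x‖
  map_zero' := by simp
  neg' f := by simp
  add_le' f g := ciSup_le fun x => (norm_add_le _ _).trans
    (add_le_add (le_ciSup (bddAbove_norm f) x) (le_ciSup (bddAbove_norm g) x))
  smul' c f := by
    simp only [Submodule.coe_smul, Pi.smul_apply, norm_smul]
    exact (Real.mul_iSup_of_nonneg (norm_nonneg c) _).symm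
  ultra' f g := ciSup_le fun x => (IsUltrametricDist.norm_add_le_max _ _).trans
    (max_le_max (le_ciSup (bddAbove_norm f) x) (le_ciSup (bddAbove_norm g) x))
  definite' f hf := by
    ext x
    have h : ‖(f : (Fin d → ℚ_[p]) → ℂ_[p]) x‖ ≤ 0 := (le_ciSup (bddAbove_norm f) x).trans hf.le
    exact norm_le_zero_iff.mp h

lemma isLocallyConstant_addChar {ψ : AddChar ℚ_[p] ℂ_[p]} (hψ : IsOpen {x | ψ x = 1}) :
    IsLocallyConstant ψ := by
  rw [IsLocallyConstant.iff_eventually_eq]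
  intro x
  have h1 : {z | ψ z = 1} ∈ nhds (x - x) := hψ.mem_nhds (by simp)
  have h2 : ContinuousAt (fun y => y - x) x := by fun_prop
  filter_upwards [h2 h1] with y hy
  have hy' : ψ (y - x) = 1 := hy
  rw [← sub_add_cancel y x, AddChar.map_add_eq_mul, hy', one_mul]

/-- The operator `ρ_ψ([w, t])`, where `w = (a, b)`:
`(ρ_ψ([w, t]) f)(x) = ψ(t + (a ⬝ b) / 2 + b ⬝ x) f(x + a)`. -/
def schrodingerFun (ψ : AddChar ℚ_[p] ℂ_[p]) (h : Heisenberg p d)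
    (f : (Fin d → ℚ_[p]) → ℂ_[p]) : (Fin d → ℚ_[p]) → ℂ_[p] := fun x =>
  ψ (h.t + (1 / 2) * ((h.w ∘ Sum.inl) ⬝ᵥ (h.w ∘ Sum.inr)) + (h.w ∘ Sum.inr) ⬝ᵥ x) *
    f (x + h.w ∘ Sum.inl)

lemma schrodingerFun_mem {ψ : AddChar ℚ_[p] ℂ_[p]} (hψ : IsOpen {x | ψ x = 1})
    (h : Heisenberg p d) {f : (Fin d → ℚ_[p]) → ℂ_[p]} (hf : f ∈ schwartz p d) :
    schrodingerFun ψ h f ∈ schwartz p d := by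
  have hc : Continuous fun x : Fin d → ℚ_[p] =>
      h.t + (1 / 2) * ((h.w ∘ Sum.inl) ⬝ᵥ (h.w ∘ Sum.inr)) + (h.w ∘ Sum.inr) ⬝ᵥ x := by
    unfold dotProduct; fun_prop
  refine ⟨?_, ?_⟩
  · exact ((isLocallyConstant_addChar hψ).comp_continuous hc).mul
      (hf.1.comp_continuous (continuous_id.add continuous_const))
  · exact HasCompactSupport.mul_left
      (hf.2.comp_homeomorph (Homeomorph.addRight (h.w ∘ Sum.inl)))

/-- The Schrödinger representation of the Heisenberg group attached to the character `ψ`. -/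
def schrodinger (ψ : AddChar ℚ_[p] ℂ_[p]) (hψ : IsOpen {x | ψ x = 1}) :
    Representation ℂ_[p] (Heisenberg p d) (schwartz p d) where
  toFun h :=
    { toFun := fun f => ⟨schrodingerFun ψ h f, schrodingerFun_mem hψ h f.2⟩
      map_add' := fun f g => by ext x; simp [schrodingerFun, mul_add]
      map_smul' := fun c f => by ext x; simp [schrodingerFun, mul_left_comm] }
  map_one' := by
    ext f x
    simp [schrodingerFun, one_def, show (0 : Fin d ⊕ Fin d → ℚ_[p]) ∘ Sum.inl = 0 from rfl,
      show (0 : Fin d ⊕ Fin d → ℚ_[p]) ∘ Sum.inr = 0 from rfl]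
  map_mul' g h := by
    ext f x
    simp only [schrodingerFun, mul_def, LinearMap.coe_mk, AddHom.coe_mk, Module.End.mul_apply,
      ← mul_assoc, ← AddChar.map_add_eq_mul, comp_add_inl, comp_add_inr, omega,
      add_dotProduct, dotProduct_add]
    rw [dotProduct_comm (g.w ∘ Sum.inr) (h.w ∘ Sum.inl),
      dotProduct_comm (h.w ∘ Sum.inr) (g.w ∘ Sum.inl), add_assoc x]
    congr 2
    ring

/-- `T` is an intertwining operator attached to the symplectic matrix `g`:
`ρ_ψ([w, t]) ∘ T = T ∘ ρ_ψ([w g, t])`. -/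
def IsIntertwining (ψ : AddChar ℚ_[p] ℂ_[p]) (hψ : IsOpen {x | ψ x = 1})
    (g : symplecticGroup (Fin d) ℚ_[p]) (T : schwartz p d ≃ₗ[ℂ_[p]] schwartz p d) : Prop :=
  ∀ h f, schrodinger ψ hψ h (T f) = T (schrodinger ψ hψ (h.act g) f)

/-- An intertwining operator `T_g` attached to `g`.  For non-trivial `ψ` it exists, and is unique
up to a scalar, by the Stone-von Neumann theorem and Schur's lemma. -/
def weilOperator (ψ : AddChar ℚ_[p] ℂ_[p]) (hψ : IsOpen {x | ψ x = 1})
    (g : symplecticGroup (Fin d) ℚ_[p]) : schwartz p d ≃ₗ[ℂ_[p]] schwartz p d :=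
  @Classical.epsilon _ ⟨LinearEquiv.refl _ _⟩ (IsIntertwining ψ hψ g)

variable (p d)

/-- The Siegel parabolic: symplectic matrices whose lower left block vanishes. -/
def siegel : Subgroup (symplecticGroup (Fin d) ℚ_[p]) where
  carrier := {g | (g : Matrix (Fin d ⊕ Fin d) (Fin d ⊕ Fin d) ℚ_[p]).toBlocks₂₁ = 0}
  one_mem' := by ext i j; simp [toBlocks₂₁]
  mul_mem' := by
    intro g h hg hh
    ext i j
    have hg' : ∀ i j, (g : Matrix (Fin d ⊕ Fin d) (Fin d ⊕ Fin d) ℚ_[p])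
      (Sum.inr i) (Sum.inl j) = 0 := fun i j => congrFun (congrFun hg i) j
    have hh' : ∀ i j, (h : Matrix (Fin d ⊕ Fin d) (Fin d ⊕ Fin d) ℚ_[p])
      (Sum.inr i) (Sum.inl j) = 0 := fun i j => congrFun (congrFun hh i) j
    simp [toBlocks₂₁, Matrix.mul_apply, hg', hh']
  inv_mem' := by
    intro g hg
    ext i j
    have hg' : ∀ i j, (g : Matrix (Fin d ⊕ Fin d) (Fin d ⊕ Fin d) ℚ_[p])
      (Sum.inr i) (Sum.inl j) = 0 := fun i j => congrFun (congrFun hg i) j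
    simp [toBlocks₂₁, SymplecticGroup.coe_inv, Matrix.mul_apply, J, Matrix.fromBlocks, hg',
      Matrix.one_apply]

/-- The Grassmannian `P \ Sp_{2d}(ℚ_[p])` of right cosets `P g` of the Siegel parabolic. -/
abbrev Grassmannian : Type := Quotient (QuotientGroup.rightRel (siegel p d))

variable {p d}

/-- The norm `‖·‖_α`: for `α = P g`, the multiple of `f ↦ ‖T_g f‖_sup` which is normalized at the
characteristic function of `ℤ_[p]^d`. -/
def grassmannNorm (ψ : AddChar ℚ_[p] ℂ_[p]) (hψ : IsOpen {x | ψ x = 1})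
    (α : Grassmannian p d) : UltraNorm p (schwartz p d) where
  toFun f := supNorm (weilOperator ψ hψ α.out f) / supNorm (weilOperator ψ hψ α.out (charZp p d))
  map_zero' := by simp
  neg' f := by simp [map_neg_eq_map]
  add_le' f g := by
    rw [map_add, ← add_div]
    exact div_le_div_of_nonneg_right (map_add_le_add _ _ _) (apply_nonneg _ _)
  smul' c f := by rw [map_smul, map_smul_eq_mul, mul_div_assoc]
  ultra' f g := by
    rw [map_add, max_div_div_right (apply_nonneg _ _)]
    exact div_le_div_of_nonneg_right (supNorm.ultra' _ _) (apply_nonneg _ _)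
  definite' f hf := by
    rcases div_eq_zero_iff.mp hf with h | h
    · exact (map_eq_zero_iff _ (weilOperator ψ hψ α.out).injective).mp (supNorm.definite' _ h)
    · exact absurd ((map_eq_zero_iff _ (weilOperator ψ hψ α.out).injective).mp
        (supNorm.definite' _ h)) charZp_ne_zero

end PadicSchrodinger

end

/-! Every norm in the statement is the sup norm transported by an intertwining operator, and the
theorem is formal once five facts, collected in `IsSimpleFamily`, are known: the representation is
algebraically irreducible; the norms are invariant; each is rigid, i.e. an invariant seminorm q
dominated by N is zero or equivalent to N, with a constant independent of q; each has a rigid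
vector, such that vectors almost fixed by suitable group elements are close to its multiples; and no
norm of the family dominates another.

Independence is a weak approximation argument (`IsSimpleFamily.separates`), by induction on the
family. Let M be the maximum of the norms other than N i. The infimal convolution of M and N i is
invariant and at most N i. If it vanishes, every vector splits into a part small for N i and a part
small for the others, which is the separation wanted. Otherwise rigidity makes N i dominated by M.
Then the rigid vector e of N i is, by induction, approximately a sum of vectors u j, each close to e
for N j and small for the remaining norms. Each u j is almost fixed for M, hence for N i, so it is
close to a multiple of e for N i. If that multiple were not small, applying group algebra operators
would give N i ≤ const · N j (`small_of_close`). So all N i (u j) are less than N i e, against the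
strong triangle inequality.

For local maximality one takes the supremum of all competing norms normalized at w. It is finite by
`IsSimpleFamily.exists_uniform_bound`: a competitor is controlled by one seminorm for each summand,
rigidity compares that seminorm with N i up to scale, and separation bounds the scale.

The analytic heart is the rigidity of the sup norm (`isRigid_supNorm`). Following Fresnel and de
Mathan, there are polynomials in a p-power root of unity, with coefficients bounded by p, that
approximate the indicator function of p^M ℤ_p with an error less than 1, both bounds being
independent of M (`exists_polynomial_approx`). Inserting modulation operators, elements of the group
algebra of norm at most p^d nearly cut a function down to an arbitrarily small ball. On small balls
every function is a multiple of an indicator function, and these are all translates of each other.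

The operators T_g are built from a functional invariant under a Lagrangian subspace
(`exists_isIntertwining`). Non-domination (`IsIntertwining.not_dominated`) comes from summing p^m
translates of a bump with disjoint supports: T_g turns the sum into a geometric sum of roots of
unity, each value of which is 0 or p^m. -/

noncomputable section

namespace PadicSchrodinger

/-! ### Invariant non-archimedean seminorms and independence. -/

section Abstract

variable {p : ℕ} [Fact p.Prime] {V : Type*} [AddCommGroup V] [Module ℂ_[p] V]
  {G : Type*} [Group G] {ι : Type*}

/-- The strong triangle inequality. -/
def IsUltra (q : Seminorm ℂ_[p] V) : Prop := ∀ v w, q (v + w) ≤ max (q v) (q w)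

/-- A seminorm is invariant under the representation `ρ`. -/
def IsInvSeminorm (ρ : Representation ℂ_[p] G V) (q : Seminorm ℂ_[p] V) : Prop :=
  ∀ g v, q (ρ g v) = q v

lemma IsUltra.sub_le {q : Seminorm ℂ_[p] V} (hq : IsUltra q) (v w : V) :
    q (v - w) ≤ max (q v) (q w) := by
  rw [sub_eq_add_neg]
  simpa using hq v (-w)

lemma IsUltra.sum_le {q : Seminorm ℂ_[p] V} (hq : IsUltra q) {s : Finset ι} {f : ι → V} {B : ℝ}
    (hB : 0 ≤ B) (h : ∀ i ∈ s, q (f i) ≤ B) : q (∑ i ∈ s, f i) ≤ B := by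
  classical
  induction s using Finset.induction_on with
  | empty => simpa
  | insert a s ha ih =>
    rw [Finset.sum_insert ha]
    exact (hq _ _).trans (max_le (h a (by simp)) (ih fun i hi => h i (by simp [hi])))

lemma UltraNorm.isUltra (N : UltraNorm p V) : IsUltra N.toSeminorm := N.ultra'

lemma maxNorm_le {s : Finset ι} {N : ι → UltraNorm p V} {v : V} {B : ℝ} (hB : 0 ≤ B)
    (h : ∀ i ∈ s, N i v ≤ B) : maxNorm s N v ≤ B :=
  Seminorm.finset_sup_apply_le hB h

lemma le_maxNorm {s : Finset ι} (N : ι → UltraNorm p V) {i : ι} (hi : i ∈ s) (v : V) :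
    N i v ≤ maxNorm s N v :=
  Seminorm.le_finset_sup_apply (p := fun i => (N i).toSeminorm) hi

lemma isUltra_maxNorm (s : Finset ι) (N : ι → UltraNorm p V) : IsUltra (maxNorm s N) :=
  fun v w => maxNorm_le (le_max_of_le_left (apply_nonneg _ _)) fun i hi =>
    ((N i).isUltra v w).trans (max_le_max (le_maxNorm N hi v) (le_maxNorm N hi w))

lemma isInvSeminorm_maxNorm {ρ : Representation ℂ_[p] G V} {s : Finset ι} {N : ι → UltraNorm p V}
    (h : ∀ i, IsInvariant ρ (N i)) : IsInvSeminorm ρ (maxNorm s N) := fun g v =>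
  le_antisymm
    (maxNorm_le (apply_nonneg _ _) fun i hi => (h i g v).le.trans (le_maxNorm N hi v))
    (maxNorm_le (apply_nonneg _ _) fun i hi => (h i g v).ge.trans (le_maxNorm N hi _))

lemma IsUltra.sup {q₁ q₂ : Seminorm ℂ_[p] V} (h₁ : IsUltra q₁) (h₂ : IsUltra q₂) :
    IsUltra (q₁ ⊔ q₂) := fun v w => by
  simp only [Seminorm.sup_apply]
  exact max_le
    ((h₁ v w).trans (max_le_max (le_max_left _ _) (le_max_left _ _)))
    ((h₂ v w).trans (max_le_max (le_max_right _ _) (le_max_right _ _)))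

lemma IsInvSeminorm.sup {ρ : Representation ℂ_[p] G V} {q₁ q₂ : Seminorm ℂ_[p] V}
    (h₁ : IsInvSeminorm ρ q₁) (h₂ : IsInvSeminorm ρ q₂) :
    IsInvSeminorm ρ (q₁ ⊔ q₂) := fun g v => by
  simp only [Seminorm.sup_apply, h₁ g v, h₂ g v]

lemma IsUltra.smul {q : Seminorm ℂ_[p] V} (h : IsUltra q) (c : NNReal) : IsUltra (c • q) :=
  fun v w => by
    simp only [_root_.smul_apply, NNReal.smul_def, smul_eq_mul]
    rw [← mul_max_of_nonneg _ _ c.coe_nonneg]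
    exact mul_le_mul_of_nonneg_left (h v w) c.coe_nonneg

lemma IsInvSeminorm.smul {ρ : Representation ℂ_[p] G V} {q : Seminorm ℂ_[p] V}
    (h : IsInvSeminorm ρ q) (c : NNReal) : IsInvSeminorm ρ (c • q) := fun g v => by
  simp only [_root_.smul_apply, h g v]

/-- The infimal convolution `v ↦ inf_u max (q₁ u) (q₂ (v - u))`, the largest non-archimedean
seminorm which is at most `q₁` and at most `q₂`. -/
def infConv (q₁ q₂ : Seminorm ℂ_[p] V) (_h₁ : IsUltra q₁) (_h₂ : IsUltra q₂) :
    Seminorm ℂ_[p] V :=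
  have hbdd : ∀ v, BddBelow (Set.range fun u => max (q₁ u) (q₂ (v - u))) := fun v =>
    ⟨0, by rintro _ ⟨u, rfl⟩; exact le_max_of_le_left (apply_nonneg _ _)⟩
  Seminorm.ofSMulLE (fun v => ⨅ u, max (q₁ u) (q₂ (v - u)))
    (le_antisymm ((ciInf_le (hbdd 0) 0).trans (by simp))
      (le_ciInf fun u => le_max_of_le_left (apply_nonneg _ _)))
    (fun v w => by
      refine le_of_forall_pos_lt_add fun η hη => ?_
      obtain ⟨u, hu⟩ := exists_lt_of_ciInf_lt
        (lt_add_of_pos_right (⨅ u, max (q₁ u) (q₂ (v - u))) (half_pos hη))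
      obtain ⟨u', hu'⟩ := exists_lt_of_ciInf_lt
        (lt_add_of_pos_right (⨅ u, max (q₁ u) (q₂ (w - u))) (half_pos hη))
      refine (ciInf_le (hbdd _) (u + u')).trans_lt ?_
      have e : v + w - (u + u') = (v - u) + (w - u') := by abel
      rw [e]
      have a1 := map_add_le_add q₁ u u'
      have a2 := map_add_le_add q₂ (v - u) (w - u')
      rw [max_lt_iff] at hu hu'
      exact max_lt (by linarith) (by linarith))
    (fun r v => by
      rcases eq_or_ne r 0 with rfl | hr
      · refine (ciInf_le (hbdd _) 0).trans ?_
        simp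
      · have hr' : 0 < ‖r‖ := norm_pos_iff.mpr hr
        rw [← div_le_iff₀' hr']
        refine le_ciInf fun u => ?_
        rw [div_le_iff₀' hr']
        refine (ciInf_le (hbdd _) (r • u)).trans ?_
        rw [← smul_sub, map_smul_eq_mul, map_smul_eq_mul, mul_max_of_nonneg _ _ hr'.le])

variable {q₁ q₂ : Seminorm ℂ_[p] V} {h₁ : IsUltra q₁} {h₂ : IsUltra q₂}

lemma infConv_le (v u : V) : infConv q₁ q₂ h₁ h₂ v ≤ max (q₁ u) (q₂ (v - u)) :=
  ciInf_le (f := fun u => max (q₁ u) (q₂ (v - u)))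
    ⟨0, by rintro _ ⟨u, rfl⟩; exact le_max_of_le_left (apply_nonneg _ _)⟩ u

lemma exists_lt_of_infConv_lt {v : V} {B : ℝ} (h : infConv q₁ q₂ h₁ h₂ v < B) :
    ∃ u, q₁ u < B ∧ q₂ (v - u) < B := by
  obtain ⟨u, hu⟩ := exists_lt_of_ciInf_lt (f := fun u => max (q₁ u) (q₂ (v - u))) h
  exact ⟨u, max_lt_iff.mp hu⟩

lemma infConv_le_left (v : V) : infConv q₁ q₂ h₁ h₂ v ≤ q₁ v :=
  (infConv_le v v).trans (by simp)

lemma infConv_le_right (v : V) : infConv q₁ q₂ h₁ h₂ v ≤ q₂ v :=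
  (infConv_le v 0).trans (by simp)

lemma isUltra_infConv : IsUltra (infConv q₁ q₂ h₁ h₂) := fun v w => by
  refine le_of_forall_gt fun B hB => ?_
  obtain ⟨hv, hw⟩ := max_lt_iff.mp hB
  obtain ⟨u, hu, hu'⟩ := exists_lt_of_infConv_lt hv
  obtain ⟨z, hz, hz'⟩ := exists_lt_of_infConv_lt hw
  refine (infConv_le (v + w) (u + z)).trans_lt (max_lt ?_ ?_)
  · exact (h₁ u z).trans_lt (max_lt hu hz)
  · rw [show v + w - (u + z) = (v - u) + (w - z) by abel]
    exact (h₂ _ _).trans_lt (max_lt hu' hz')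

lemma isInvSeminorm_infConv {ρ : Representation ℂ_[p] G V} (i₁ : IsInvSeminorm ρ q₁)
    (i₂ : IsInvSeminorm ρ q₂) : IsInvSeminorm ρ (infConv q₁ q₂ h₁ h₂) := by
  have key : ∀ g v, infConv q₁ q₂ h₁ h₂ (ρ g v) ≤ infConv q₁ q₂ h₁ h₂ v := fun g v => by
    refine le_of_forall_gt fun B hB => ?_
    obtain ⟨u, hu, hu'⟩ := exists_lt_of_infConv_lt hB
    refine (infConv_le _ (ρ g u)).trans_lt (max_lt ?_ ?_)
    · rwa [i₁]
    · rwa [← map_sub, i₂]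
  refine fun g v => le_antisymm (key g v) ?_
  simpa using key g⁻¹ (ρ g v)

/-- An operator which is bounded with respect to every invariant seminorm, with a common
constant. -/
def IsUniformlyBounded (ρ : Representation ℂ_[p] G V) (A : V →ₗ[ℂ_[p]] V) : Prop :=
  ∃ K : ℝ, 0 ≤ K ∧ ∀ q : Seminorm ℂ_[p] V, IsUltra q → IsInvSeminorm ρ q → ∀ u, q (A u) ≤ K * q u

/-- Algebraic irreducibility. -/
def HasNoInvariantSubspace (ρ : Representation ℂ_[p] G V) : Prop :=
  ∀ W : Submodule ℂ_[p] V, (∀ g, ∀ w ∈ W, ρ g w ∈ W) → W ≠ ⊥ → W = ⊤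

/-- The vectors A v, for A uniformly bounded, form an invariant subspace containing v. The bound of
A is common to all invariant seminorms, which is what later allows estimates uniform in an unknown
norm. -/
lemma HasNoInvariantSubspace.exists_operator {ρ : Representation ℂ_[p] G V}
    (hρ : HasNoInvariantSubspace ρ) {v : V} (hv : v ≠ 0) (w : V) :
    ∃ A : V →ₗ[ℂ_[p]] V, IsUniformlyBounded ρ A ∧ A v = w := by
  let W : Submodule ℂ_[p] V :=
    { carrier := {w | ∃ A : V →ₗ[ℂ_[p]] V, IsUniformlyBounded ρ A ∧ A v = w}
      zero_mem' := ⟨0, ⟨0, le_rfl, fun q _ _ u => by simp⟩, rfl⟩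
      add_mem' := by
        rintro _ _ ⟨A, ⟨K, hK, hA⟩, rfl⟩ ⟨B, ⟨L, hL, hB⟩, rfl⟩
        refine ⟨A + B, ⟨max K L, le_max_of_le_left hK, fun q hq hi u => ?_⟩, rfl⟩
        refine (hq _ _).trans (max_le ((hA q hq hi u).trans ?_) ((hB q hq hi u).trans ?_))
        · exact mul_le_mul_of_nonneg_right (le_max_left _ _) (apply_nonneg _ _)
        · exact mul_le_mul_of_nonneg_right (le_max_right _ _) (apply_nonneg _ _)
      smul_mem' := by
        rintro c _ ⟨A, ⟨K, hK, hA⟩, rfl⟩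
        refine ⟨c • A, ⟨‖c‖ * K, by positivity, fun q hq hi u => ?_⟩, rfl⟩
        rw [LinearMap.smul_apply, map_smul_eq_mul, mul_assoc]
        exact mul_le_mul_of_nonneg_left (hA q hq hi u) (norm_nonneg c) }
  have hW : W = ⊤ := hρ W
    (by
      rintro g _ ⟨A, ⟨K, hK, hA⟩, rfl⟩
      exact ⟨ρ g ∘ₗ A, ⟨K, hK, fun q hq hi u => by
        rw [LinearMap.comp_apply, hi]; exact hA q hq hi u⟩, rfl⟩)
    (fun h => hv <| by
      have : v ∈ W := ⟨LinearMap.id, ⟨1, zero_le_one, fun q _ _ u => by simp⟩, rfl⟩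
      rwa [h, Submodule.mem_bot] at this)
  have : w ∈ W := hW ▸ Submodule.mem_top
  exact this

/-- Every invariant seminorm dominated by `N` is comparable with `N`, uniformly. -/
def IsRigid (ρ : Representation ℂ_[p] G V) (N : Seminorm ℂ_[p] V) : Prop :=
  ∃ R : ℝ, 0 < R ∧ ∀ q : Seminorm ℂ_[p] V, IsUltra q → IsInvSeminorm ρ q → Dominated q N →
    ∀ v f, q v * N f ≤ R * N v * q f

/-- There is a vector `e`, fixed by finitely many group elements, such that every vector which is
almost fixed by them is, in the norm `N`, close to a multiple of `e`. -/
def HasRigidVector (ρ : Representation ℂ_[p] G V) (N : Seminorm ℂ_[p] V) : Prop :=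
  ∃ (e : V) (F : Set G) (C : ℝ), e ≠ 0 ∧ 0 < C ∧ (∀ g ∈ F, ρ g e = e) ∧
    ∀ v, ∃ c : ℂ_[p], ∀ δ : ℝ, 0 ≤ δ → (∀ g ∈ F, N (ρ g v - v) ≤ δ) → N (v - c • e) ≤ C * δ

/-- The hypotheses under which pairwise inequivalent invariant norms are independent. -/
structure IsSimpleFamily (ρ : Representation ℂ_[p] G V) (N : ι → UltraNorm p V) : Prop where
  irred : HasNoInvariantSubspace ρ
  inv : ∀ i, IsInvariant ρ (N i)
  rigid : ∀ i, IsRigid ρ (N i).toSeminorm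
  rigidVector : ∀ i, HasRigidVector ρ (N i).toSeminorm
  not_dominated : ∀ i j, i ≠ j → ¬ Dominated (N i).toSeminorm (N j).toSeminorm

/-- Every vector can be approximated by vectors that are small for all the norms but one. -/
def Separates (s : Finset ι) (N : ι → UltraNorm p V) : Prop :=
  ∀ i ∈ s, ∀ v, ∀ ε > 0, ∃ u, N i (v - u) < ε ∧ ∀ j ∈ s, j ≠ i → N j u < ε

variable {ρ : Representation ℂ_[p] G V} {N : ι → UltraNorm p V}

lemma UltraNorm.pos (N : UltraNorm p V) {v : V} (hv : v ≠ 0) : 0 < N v :=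
  (apply_nonneg N.toSeminorm v).lt_of_ne fun h => hv (N.definite' v h.symm)

/-- If `N i` is dominated by the maximum of norms `N j`, `j ∈ s`, which separate vectors, then
vectors close to the rigid vector `e` of `N i` for `N j`, and small for the others, are small
for `N i`. -/
lemma small_of_close (h : IsSimpleFamily ρ N) {s : Finset ι} {i j : ι} (hij : i ≠ j)
    {D : ℝ} (hD : 0 < D) (hdom : ∀ v, N i v ≤ D * maxNorm s N v)
    {e : V} {F : Set G} {C : ℝ} (he : e ≠ 0) (hC : 0 < C) (hfix : ∀ g ∈ F, ρ g e = e)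
    (hF : ∀ v, ∃ c : ℂ_[p], ∀ δ : ℝ, 0 ≤ δ → (∀ g ∈ F, N i (ρ g v - v) ≤ δ) →
      N i (v - c • e) ≤ C * δ) {η : ℝ} (hη : 0 < η) :
    ∃ δ > 0, ∀ u, N j (e - u) ≤ δ → (∀ l ∈ s, l ≠ j → N l u ≤ δ) → N i u < η := by
  -- Otherwise there are such u with `N i u ≥ η` for every δ, and N i turns out to be dominated by N
  -- j.
  by_contra! hcon
  refine h.not_dominated i j hij ⟨D * N i e / η, by have := (N i).pos he; positivity, fun v => ?_⟩
  obtain ⟨A, ⟨K, hK, hA⟩, rfl⟩ := h.irred.exists_operator he v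
  have hAN : ∀ l u, N l (A u) ≤ K * N l u := fun l => hA _ (N l).isUltra (h.inv l)
  have hu2 : ∀ δ : ℝ, 0 < δ → C * (D * δ) < η →
      N i (A e) ≤ D * N i e / η * N j (A e) + D * N i e / η * (K * δ)
        + N i e / η * (K * (C * (D * δ))) := by
    intro δ hδ hδη
    obtain ⟨u, hu, hul, hηu⟩ := hcon δ hδ
    obtain ⟨c, hc⟩ := hF u
    -- Each g in F fixes e, so it moves u little for N j, because u is near e, and little for the
    -- other norms, because u is small. By domination u is almost fixed for N i.
    have hclose : N i (u - c • e) ≤ C * (D * δ) := by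
      refine hc _ (by positivity) fun g hg => (hdom _).trans ?_
      refine mul_le_mul_of_nonneg_left (maxNorm_le hδ.le fun l hl => ?_) hD.le
      by_cases hlj : l = j
      · subst hlj
        have e1 : ρ g u - u = (e - u) - ρ g (e - u) := by rw [map_sub, hfix g hg]; abel
        rw [e1]
        refine ((N l).isUltra.sub_le _ _).trans (max_le hu ?_)
        exact (h.inv l g _).le.trans hu
      · refine ((N l).isUltra.sub_le _ _).trans (max_le ?_ (hul l hl hlj))
        exact (h.inv l g _).le.trans (hul l hl hlj)
    -- As u is not small for N i but is close to c • e, the scalar c is bounded below. Writing c • A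
    -- e as A u minus A (u - c • e) then bounds N i (A e).
    have hce : η ≤ ‖c‖ * N i e := by
      have h1 : N i u ≤ max (N i (u - c • e)) (N i (c • e)) := by
        have := (N i).isUltra (u - c • e) (c • e)
        rwa [sub_add_cancel] at this
      rcases le_max_iff.mp (hηu.trans h1) with h2 | h2
      · linarith
      · rwa [map_smul_eq_mul] at h2
    have h3 : N i (c • A e) ≤ max (N i (A (u - c • e))) (N i (A u)) := by
      have := (N i).isUltra.sub_le (A u) (A (u - c • e))
      rw [← map_sub, sub_sub_cancel, map_smul, max_comm] at this
      exact this
    have h4 : N i (A u) ≤ D * (N j (A e) + K * δ) := by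
      refine (hdom _).trans (mul_le_mul_of_nonneg_left ?_ hD.le)
      have hp : 0 ≤ N j (A e) := apply_nonneg _ _
      refine maxNorm_le (by positivity) fun l hl => ?_
      by_cases hlj : l = j
      · subst hlj
        have e1 : A u = A e - A (e - u) := by rw [map_sub]; abel
        rw [e1]
        refine ((N l).isUltra.sub_le _ _).trans (max_le ?_ ?_)
        · exact le_add_of_nonneg_right (by positivity)
        · have := (hAN l (e - u)).trans (mul_le_mul_of_nonneg_left hu hK)
          linarith
      · have := (hAN l u).trans (mul_le_mul_of_nonneg_left (hul l hl hlj) hK)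
        linarith
    have h5 : N i (A (u - c • e)) ≤ K * (C * (D * δ)) :=
      (hAN i _).trans (mul_le_mul_of_nonneg_left hclose hK)
    have h6 : ‖c‖ * N i (A e) ≤ D * (N j (A e) + K * δ) + K * (C * (D * δ)) := by
      rw [← map_smul_eq_mul]
      refine h3.trans (max_le (h5.trans ?_) (h4.trans ?_))
      · have hp : 0 ≤ N j (A e) := apply_nonneg _ _
        exact le_add_of_nonneg_left (by positivity)
      · exact le_add_of_nonneg_right (by positivity)
    have hpe := (N i).pos he
    have h7 : η * N i (A e) ≤ N i e * (D * (N j (A e) + K * δ) + K * (C * (D * δ))) :=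
      calc η * N i (A e) ≤ (‖c‖ * N i e) * N i (A e) :=
            mul_le_mul_of_nonneg_right hce (apply_nonneg _ _)
        _ = N i e * (‖c‖ * N i (A e)) := by ring
        _ ≤ _ := mul_le_mul_of_nonneg_left h6 hpe.le
    have h8 : N i (A e) ≤ N i e * (D * (N j (A e) + K * δ) + K * (C * (D * δ))) / η := by
      rw [le_div_iff₀' hη]; exact h7
    refine h8.trans (le_of_eq ?_)
    ring
  -- The constant K depends on the vector A e, but it only multiplies δ, and so disappears in the
  -- limit δ → 0.
  have hlim : Filter.Tendsto (fun δ : ℝ => D * N i e / η * N j (A e) + D * N i e / η * (K * δ)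
        + N i e / η * (K * (C * (D * δ)))) (nhdsWithin 0 (Set.Ioi 0))
        (nhds (D * N i e / η * N j (A e))) := by
    have : Continuous fun δ : ℝ => D * N i e / η * N j (A e) + D * N i e / η * (K * δ)
        + N i e / η * (K * (C * (D * δ))) := by fun_prop
    have h0 := this.tendsto 0
    simp only [mul_zero, add_zero] at h0
    exact h0.mono_left nhdsWithin_le_nhds
  refine ge_of_tendsto hlim ?_
  have hev : ∀ᶠ δ : ℝ in nhdsWithin 0 (Set.Ioi 0), C * (D * δ) < η := by
    have hc : Continuous fun δ : ℝ => C * (D * δ) := by fun_prop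
    have h0 := hc.tendsto 0
    simp only [mul_zero] at h0
    exact (h0.mono_left nhdsWithin_le_nhds).eventually (gt_mem_nhds hη)
  filter_upwards [hev, self_mem_nhdsWithin] with δ h1 h2
  exact hu2 δ h2 h1

/-- If N i were dominated, its rigid vector e would be, up to an error of at most half its norm, a
sum of vectors of norm less than N i e, which the strong triangle inequality forbids. -/
lemma not_dominated_maxNorm (h : IsSimpleFamily ρ N) {s : Finset ι} (hs : Separates s N) {i : ι}
    (hi : i ∉ s) : ¬ Dominated (N i).toSeminorm (maxNorm s N) := by
  classical
  rintro ⟨D, hD, hdom⟩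
  obtain ⟨e, F, C, he, hC, hfix, hF⟩ := h.rigidVector i
  have hpe := (N i).pos he
  have hδ : ∀ j ∈ s, ∃ δ > 0, ∀ u, N j (e - u) ≤ δ → (∀ l ∈ s, l ≠ j → N l u ≤ δ) →
      N i u < N i e := fun j hj =>
    small_of_close h (fun hij : i = j => hi (hij ▸ hj)) hD hdom he hC hfix hF hpe
  choose! δ hδ hδu using hδ
  -- The bound δ j makes `small_of_close` apply; the bound N i e / (2 D) makes the error e - Σ u j
  -- at most N i e / 2 for N i.
  have hu : ∀ j ∈ s, ∃ u, N j (e - u) < min (δ j) (N i e / (2 * D)) ∧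
      ∀ l ∈ s, l ≠ j → N l u < min (δ j) (N i e / (2 * D)) := fun j hj =>
    hs j hj e _ (lt_min (hδ j hj) (by positivity))
  choose! u hu hul using hu
  have hsmall : ∀ j ∈ s, N i (u j) < N i e := fun j hj =>
    hδu j hj (u j) ((hu j hj).le.trans (min_le_left _ _))
      fun l hl hlj => (hul j hj l hl hlj).le.trans (min_le_left _ _)
  have h1 : N i (e - ∑ j ∈ s, u j) ≤ N i e / 2 := by
    refine (hdom _).trans ?_
    have : maxNorm s N (e - ∑ j ∈ s, u j) ≤ N i e / (2 * D) := by
      refine maxNorm_le (by positivity) fun l hl => ?_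
      rw [← Finset.add_sum_erase s u hl, ← sub_sub]
      refine ((N l).isUltra.sub_le _ _).trans (max_le ?_ ?_)
      · exact (hu l hl).le.trans (min_le_right _ _)
      · refine (N l).isUltra.sum_le (by positivity) fun j hj => ?_
        exact (hul j (Finset.mem_of_mem_erase hj) l hl (Finset.ne_of_mem_erase hj).symm).le.trans
          (min_le_right _ _)
    calc D * maxNorm s N (e - ∑ j ∈ s, u j) ≤ D * (N i e / (2 * D)) :=
          mul_le_mul_of_nonneg_left this hD.le
      _ = N i e / 2 := by field_simp
  have h2 : N i (∑ j ∈ s, u j) < N i e := by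
    have : ∀ t ⊆ s, N i (∑ j ∈ t, u j) < N i e := by
      intro t
      induction t using Finset.induction_on with
      | empty => intro _; simpa using hpe
      | insert a t ha ih =>
        intro hts
        rw [Finset.sum_insert ha]
        exact ((N i).isUltra _ _).trans_lt (max_lt (hsmall a (hts (by simp)))
          (ih fun x hx => hts (by simp [hx])))
    exact this s subset_rfl
  have h3 := (N i).isUltra (e - ∑ j ∈ s, u j) (∑ j ∈ s, u j)
  rw [sub_add_cancel] at h3
  have : N i e < N i e := lt_of_le_of_lt h3 (max_lt (h1.trans_lt (by linarith)) h2)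
  exact lt_irrefl _ this

/-- Separation for N i amounts to the vanishing of the infimal convolution of N i with the maximum
of the others. A non-zero value would, by rigidity, make N i dominated by that maximum. -/
theorem IsSimpleFamily.separates (h : IsSimpleFamily ρ N) (s : Finset ι) : Separates s N := by
  classical
  induction s using Finset.strongInduction with
  | H s ih =>
    intro i hi v ε hε
    have hs' := ih (s.erase i) (Finset.erase_ssubset hi)
    set q := infConv (maxNorm (s.erase i) N) (N i).toSeminorm (isUltra_maxNorm _ _) (N i).isUltra
      with hq
    have hq0 : q v = 0 := by
      by_contra hne
      have hpos : 0 < q v := (apply_nonneg q v).lt_of_ne (Ne.symm hne)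
      obtain ⟨R, hR, hRq⟩ := h.rigid i
      refine not_dominated_maxNorm h hs' (Finset.notMem_erase i s)
        ⟨R * N i v / q v + 1, by positivity, fun f => ?_⟩
      have h1 := hRq q isUltra_infConv
        (isInvSeminorm_infConv (isInvSeminorm_maxNorm h.inv) (h.inv i))
        ⟨1, one_pos, fun v => by rw [one_mul]; exact infConv_le_right v⟩ v f
      have h2 : q f ≤ maxNorm (s.erase i) N f := infConv_le_left f
      have h3 : (N i).toSeminorm f ≤ R * N i v / q v * q f := by
        rw [div_mul_eq_mul_div, le_div_iff₀' hpos]; exact h1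
      refine h3.trans ((mul_le_mul_of_nonneg_left h2 (by positivity)).trans ?_)
      exact mul_le_mul_of_nonneg_right (by linarith) (apply_nonneg _ _)
    obtain ⟨u, hu, hu'⟩ := exists_lt_of_infConv_lt (hq0.trans_lt hε)
    exact ⟨u, hu', fun j hj hji =>
      (le_maxNorm N (Finset.mem_erase.mpr ⟨hji, hj⟩) u).trans_lt hu⟩

/-- Write v = (v - u) + u, with v - u small for N i and u small for the others: a seminorm dominated
by both sides is small on both terms. -/
theorem Separates.independentNorms {s : Finset ι} (hs : Separates s N) : IndependentNorms s N := by
  classical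
  rintro i hi q hq ⟨D₁, hD₁, h₁⟩ ⟨D₂, hD₂, h₂⟩
  ext v
  rw [_root_.zero_apply]
  refine le_antisymm (le_of_forall_pos_le_add fun ε hε => ?_) (apply_nonneg q v)
  obtain ⟨u, hu, hu'⟩ := hs i hi v (ε / max D₁ D₂) (by positivity)
  have hm : 0 < max D₁ D₂ := lt_max_of_lt_left hD₁
  have h3 := hq (v - u) u
  rw [sub_add_cancel] at h3
  rw [zero_add]
  refine h3.trans (max_le ((h₁ _).trans ?_) ((h₂ _).trans ?_))
  · calc D₁ * N i (v - u) ≤ max D₁ D₂ * (ε / max D₁ D₂) :=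
          mul_le_mul (le_max_left _ _) hu.le (apply_nonneg _ _) hm.le
      _ = ε := mul_div_cancel₀ _ hm.ne'
  · calc D₂ * maxNorm _ N u ≤ max D₁ D₂ * (ε / max D₁ D₂) :=
          mul_le_mul (le_max_right _ _) (maxNorm_le (by positivity) fun j hj =>
            (hu' j (Finset.mem_of_mem_erase hj) (Finset.ne_of_mem_erase hj)).le)
            (apply_nonneg _ _) hm.le
      _ = ε := mul_div_cancel₀ _ hm.ne'

/-- Approximate each coordinate by a vector v i, replace it by a separated vector u i, and add up:
in the i-th completion only u i counts. -/
theorem Separates.denseRange {s : Finset ι} (hs : Separates s N) :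
    DenseRange (diagonalMap s N) := by
  classical
  rw [Metric.denseRange_iff]
  intro x r hr
  have hx : ∀ i : s, ∃ v : WithNorm (N i), dist (x i) (v : Compl (N i)) < r / 2 := fun i =>
    Metric.denseRange_iff.mp UniformSpace.Completion.denseRange_coe (x i) (r / 2) (half_pos hr)
  choose v hv using hx
  have hu : ∀ i : s, ∃ u : V, N i ((show V from v i) - u) < r / 2 ∧
      ∀ j ∈ s, j ≠ i → N j u < r / 2 := fun i => hs i i.2 _ _ (half_pos hr)
  choose u hu hu' using hu
  refine ⟨∑ i, u i, (dist_pi_lt_iff hr).mpr fun i => ?_⟩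
  have h1 : dist (v i : Compl (N i)) (diagonalMap s N (∑ i, u i) i) < r / 2 := by
    rw [diagonalMap, UniformSpace.Completion.dist_eq, dist_eq_norm]
    change N i ((show V from v i) - ∑ i, u i) < r / 2
    rw [← Finset.add_sum_erase _ u (Finset.mem_univ i), ← sub_sub]
    have : N i (∑ j ∈ Finset.univ.erase i, u j) < r / 2 := by
      have key : ∀ t : Finset s, i ∉ t → N i (∑ j ∈ t, u j) < r / 2 := by
        intro t
        induction t using Finset.induction_on with
        | empty => intro _; simpa using hr
        | insert a t ha ih =>
          intro hit
          rw [Finset.sum_insert ha]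
          simp only [Finset.mem_insert, not_or] at hit
          exact ((N i).isUltra _ _).trans_lt (max_lt
            (hu' a i i.2 fun hh => hit.1 (Subtype.ext hh)) (ih hit.2))
      exact key _ (Finset.notMem_erase _ _)
    exact ((N i).isUltra.sub_le _ _).trans_lt (max_lt (hu i) this)
  calc dist (x i) (diagonalMap s N (∑ i, u i) i) ≤ _ := dist_triangle _ (v i : Compl (N i)) _
    _ < r / 2 + r / 2 := add_lt_add (hv i) h1
    _ = r := add_halves r

end Abstract

/-! ### Uniform bounds and locally maximal norms. -/

section LocallyMaximal

variable {p : ℕ} [Fact p.Prime] {V : Type*} [AddCommGroup V] [Module ℂ_[p] V]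
  {G : Type*} [Group G] {ι : Type*} {ρ : Representation ℂ_[p] G V} {N : ι → UltraNorm p V}

open Classical in
/-- The restriction to the `i`-th summand of the largest seminorm on a direct sum which is at most
`D N j` on the `j`-th summand and at most `N'` on the diagonal. -/
def component (s : Finset ι) (N : ι → UltraNorm p V) (N' : UltraNorm p V) (D : NNReal) (i : ι) :
    Seminorm ℂ_[p] V :=
  infConv (N'.toSeminorm ⊔ D • maxNorm (s.erase i) N) (D • (N i).toSeminorm)
    (N'.isUltra.sup ((isUltra_maxNorm _ _).smul D)) ((N i).isUltra.smul D)

section Component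

variable {s : Finset ι} {N' : UltraNorm p V} {D : NNReal}

lemma exists_of_component_lt {i : ι} {v : V} {B : ℝ} (h : component s N N' D i v < B) :
    ∃ u, N' u < B ∧ D * N i (v - u) < B ∧ ∀ j ∈ s, j ≠ i → D * N j u < B := by
  classical
  obtain ⟨u, hu, hu'⟩ := exists_lt_of_infConv_lt h
  rw [Seminorm.sup_apply, max_lt_iff] at hu
  refine ⟨u, hu.1, hu', fun j hj hji => lt_of_le_of_lt ?_ hu.2⟩
  exact mul_le_mul_of_nonneg_left (le_maxNorm N (Finset.mem_erase.mpr ⟨hji, hj⟩) u) D.coe_nonneg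

lemma component_lt {i : ι} {v u : V} {B : ℝ} (h : N' u < B)
    (hi : D * N i (v - u) < B) (hj : ∀ j ∈ s, j ≠ i → D * N j u < B) :
    component s N N' D i v < B := by
  classical
  refine (infConv_le v u).trans_lt (max_lt ?_ hi)
  rw [Seminorm.sup_apply]
  refine max_lt h ?_
  have hB : 0 < B := (apply_nonneg N'.toSeminorm u).trans_lt h
  change (D : ℝ) * maxNorm _ N u < B
  obtain hs | hs := (s.erase i).eq_empty_or_nonempty
  · rw [hs]
    simpa [maxNorm] using hB
  · obtain ⟨j, hjs, hjm⟩ := Finset.exists_max_image _ (fun j => N j u) hs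
    refine lt_of_le_of_lt (mul_le_mul_of_nonneg_left (maxNorm_le (apply_nonneg _ _) hjm)
      D.coe_nonneg) (hj j (Finset.mem_of_mem_erase hjs) (Finset.ne_of_mem_erase hjs))

lemma component_le (i : ι) (v : V) : component s N N' D i v ≤ D * N i v := infConv_le_right v

lemma mul_sum_lt {i : ι} {t : Finset ι} {u : ι → V} {B : ℝ} (hB : 0 < B)
    (h : ∀ j ∈ t, D * N i (u j) < B) : D * N i (∑ j ∈ t, u j) < B := by
  classical
  induction t using Finset.induction_on with
  | empty => simpa
  | insert a t ha ih =>
    rw [Finset.sum_insert ha]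
    exact ((N i).isUltra.smul D _ _).trans_lt
      (max_lt (h a (by simp)) (ih fun j hj => h j (by simp [hj])))

lemma sum_lt {t : Finset ι} {u : ι → V} {B : ℝ} (hB : 0 < B)
    (h : ∀ j ∈ t, N' (u j) < B) : N' (∑ j ∈ t, u j) < B := by
  classical
  induction t using Finset.induction_on with
  | empty => simpa
  | insert a t ha ih =>
    rw [Finset.sum_insert ha]
    exact (N'.isUltra _ _).trans_lt
      (max_lt (h a (by simp)) (ih fun j hj => h j (by simp [hj])))

/-- Take u i realizing the i-th component and write v = Σ u i + (v - Σ u i). The sum is small for N'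
directly. The remainder is small for every D · N i, since v - u i is and so are the other u j. -/
lemma lt_of_component_lt (hD : ∀ v, N' v ≤ D * maxNorm s N v) {v : V} {B : ℝ} (hB : 0 < B)
    (h : ∀ i ∈ s, component s N N' D i v < B) : N' v < B := by
  classical
  choose! u hu hui huj using fun i hi => exists_of_component_lt (h i hi)
  have h1 : N' (v - ∑ i ∈ s, u i) < B := by
    refine (hD _).trans_lt ?_
    obtain hs | hs := s.eq_empty_or_nonempty
    · simpa [hs, maxNorm] using hB
    obtain ⟨i, his, him⟩ := Finset.exists_max_image s (fun j => N j (v - ∑ i ∈ s, u i)) hs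
    refine lt_of_le_of_lt (mul_le_mul_of_nonneg_left (maxNorm_le (apply_nonneg _ _) him)
      D.coe_nonneg) ?_
    rw [← Finset.add_sum_erase s u his, ← sub_sub]
    refine (((N i).isUltra.smul D).sub_le _ _).trans_lt (max_lt (hui i his) ?_)
    exact mul_sum_lt hB fun j hj =>
      huj j (Finset.mem_of_mem_erase hj) i his (Finset.ne_of_mem_erase hj).symm
  have h2 := N'.isUltra (v - ∑ i ∈ s, u i) (∑ i ∈ s, u i)
  rw [sub_add_cancel] at h2
  exact h2.trans_lt (max_lt h1 (sum_lt hB hu))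

-- In the direct sum, v in the i-th slot is the diagonal vector v minus v in the other slots, so the
-- diagonal norm and the other components control the i-th one.
open Classical in
lemma component_lt_of_others {i : ι} (hi : i ∈ s) {v : V} {B : ℝ} (hv : N' v < B)
    (h : ∀ j ∈ s.erase i, component s N N' D j v < B) : component s N N' D i v < B := by
  have hB : 0 < B := (apply_nonneg N'.toSeminorm v).trans_lt hv
  choose! u hu hui huj using fun j hj => exists_of_component_lt (h j hj)
  refine component_lt (u := v - ∑ j ∈ s.erase i, u j)
    ((N'.isUltra.sub_le _ _).trans_lt (max_lt hv (sum_lt hB hu))) ?_ fun j hj hji => ?_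
  · rw [sub_sub_cancel]
    exact mul_sum_lt hB fun j hj => huj j hj i hi (Finset.ne_of_mem_erase hj).symm
  · have hj' : j ∈ s.erase i := Finset.mem_erase.mpr ⟨hji, hj⟩
    rw [← Finset.add_sum_erase _ u hj', ← sub_sub]
    refine (((N j).isUltra.smul D).sub_le _ _).trans_lt (max_lt (hui j hj') ?_)
    exact mul_sum_lt hB fun l hl =>
      huj l (Finset.mem_of_mem_erase hl) j hj (Finset.ne_of_mem_erase hl).symm

end Component

/-- The invariant norms dominated by `max_{i ∈ s} N i` and normalized at `w` are uniformly
bounded. -/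
theorem IsSimpleFamily.exists_uniform_bound (h : IsSimpleFamily ρ N) {s : Finset ι}
    (hs : s.Nonempty) {w : V} (hw : w ≠ 0) :
    ∃ K : ℝ, 0 < K ∧ ∀ N' : UltraNorm p V, IsInvariant ρ N' → N' w = 1 →
      Dominated N'.toSeminorm (maxNorm s N) → ∀ v, N' v ≤ K * maxNorm s N v := by
  classical
  choose R hR hRq using h.rigid
  have hNw : ∀ i, 0 < N i w := fun i => (N i).pos hw
  -- Chosen so that R i · ε ≤ N i w / 2: by rigidity a vector of N i-norm at most ε has an i-th
  -- component at most half that of w.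
  set ε := s.inf' hs (fun i => N i w / (2 * R i)) with hε
  have hε0 : 0 < ε := by
    rw [hε, Finset.lt_inf'_iff]
    intro i _
    have := hR i
    have := hNw i
    positivity
  have hεi : ∀ i ∈ s, R i * ε ≤ N i w / 2 := fun i hi => by
    have h1 : ε ≤ N i w / (2 * R i) := Finset.inf'_le _ hi
    rw [le_div_iff₀ (by have := hR i; positivity)] at h1
    linarith
  choose! u hu huj using fun i hi => h.separates s i hi w ε hε0
  choose A hA hAu using fun i => h.irred.exists_operator hw (u i)
  choose K hK hAK using hA
  set K₀ := ∑ i ∈ s, K i with hK₀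
  have hKi : ∀ i ∈ s, K i ≤ K₀ := fun i hi => Finset.single_le_sum (fun j _ => hK j) hi
  set C := ∑ i ∈ s, R i * K₀ / N i w with hC
  have hK₀0 : 0 ≤ K₀ := Finset.sum_nonneg fun j _ => hK j
  have hCi : ∀ i ∈ s, R i * K₀ / N i w ≤ C := fun i hi =>
    Finset.single_le_sum (f := fun i => R i * K₀ / N i w) (fun j _ => by
      have := hR j
      have := hNw j
      positivity) hi
  have hC0 : 0 ≤ C := Finset.sum_nonneg fun j _ => by
      have := hR j
      have := hNw j
      positivity
  refine ⟨C + 1, by positivity, fun N' hN' hN'w ⟨D', hD', hdom⟩ => ?_⟩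
  lift D' to NNReal using hD'.le with D
  -- The constants R i depend neither on N' nor on D. This is the reason for working with the
  -- components.
  have hrig : ∀ i v f, component s N N' D i v * N i f ≤ R i * N i v * component s N N' D i f :=
    fun i => hRq i _ isUltra_infConv
      (isInvSeminorm_infConv (IsInvSeminorm.sup hN' ((isInvSeminorm_maxNorm h.inv).smul D))
        (IsInvSeminorm.smul (h.inv i) D))
      ⟨D, hD', component_le i⟩
  have hsmall : ∀ i ∈ s, ∀ x, N i x ≤ ε →
      component s N N' D i x ≤ component s N N' D i w / 2 := fun i hi x hx => by
    have h1 := hrig i x w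
    have h2 : R i * N i x ≤ N i w / 2 :=
      (mul_le_mul_of_nonneg_left hx (hR i).le).trans (hεi i hi)
    have h3 := h1.trans (mul_le_mul_of_nonneg_right h2 (apply_nonneg _ w))
    have h4 : component s N N' D i x * N i w ≤ (component s N N' D i w / 2) * N i w := by
      linarith
    exact le_of_mul_le_mul_right h4 (hNw i)
  -- Take i where the component of w is largest and write w = (w - u i) + u i. The first term loses
  -- a factor 2. For the second, N' (u i) ≤ K i because u i is an operator applied to w and N' w =
  -- 1, while the other components of u i are at most half the maximum. A maximum above K₀ is
  -- therefore impossible.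
  have hle : ∀ i ∈ s, component s N N' D i w ≤ K₀ := by
    obtain ⟨i, his, him⟩ := Finset.exists_max_image s (fun j => component s N N' D j w) hs
    refine fun j hj => (him j hj).trans ?_
    by_contra! hcon
    have hpos : 0 < component s N N' D i w := hK₀0.trans_lt hcon
    have h1 : component s N N' D i (w - u i) < component s N N' D i w :=
      (hsmall i his _ (hu i his).le).trans_lt (half_lt_self hpos)
    have h2 : component s N N' D i (u i) < component s N N' D i w := by
      refine component_lt_of_others his ?_ fun j hj => ?_
      · have h3 := hAK i N'.toSeminorm N'.isUltra hN' w
        rw [hAu, hN'w, mul_one] at h3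
        exact h3.trans_lt ((hKi i his).trans_lt hcon)
      · have hjs := Finset.mem_of_mem_erase hj
        refine (hsmall j hjs _ (huj i his j hjs (Finset.ne_of_mem_erase hj)).le).trans_lt ?_
        have := him j hjs
        linarith
    have h3 : component s N N' D i w ≤
        max (component s N N' D i (w - u i)) (component s N N' D i (u i)) := by
      have : component s N N' D i (w - u i + u i) ≤ _ := isUltra_infConv _ _
      rwa [sub_add_cancel] at this
    exact lt_irrefl _ (h3.trans_lt (max_lt h1 h2))
  intro v
  refine le_of_forall_gt fun B hB => ?_
  have hm : 0 ≤ maxNorm s N v := apply_nonneg _ _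
  have hB0 : 0 < B := lt_of_le_of_lt (by positivity) hB
  refine lt_of_component_lt hdom hB0 fun i hi => lt_of_le_of_lt ?_ hB
  have h1 := (hrig i v w).trans (mul_le_mul_of_nonneg_left (hle i hi)
    (mul_nonneg (hR i).le (apply_nonneg _ _)))
  have h2 : component s N N' D i v ≤ R i * K₀ / N i w * N i v := by
    rw [div_mul_eq_mul_div, le_div_iff₀ (hNw i)]
    linarith
  calc component s N N' D i v ≤ R i * K₀ / N i w * N i v := h2
    _ ≤ C * maxNorm s N v :=
        mul_le_mul (hCi i hi) (le_maxNorm N hi v) (apply_nonneg _ _) hC0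
    _ ≤ (C + 1) * maxNorm s N v := mul_le_mul_of_nonneg_right (by linarith) hm

/-- The supremum of a bounded non-empty family of norms. -/
def iSupNorm {κ : Type*} [Nonempty κ] (M : κ → UltraNorm p V)
    (hM : ∀ v, BddAbove (Set.range fun k => M k v)) : UltraNorm p V where
  toSeminorm := Seminorm.ofSMulLE (fun v => ⨆ k, M k v) (by simp)
    (fun v w => ciSup_le fun k => (map_add_le_add (M k).toSeminorm v w).trans
      (add_le_add (le_ciSup (hM v) k) (le_ciSup (hM w) k)))
    (fun r v => ciSup_le fun k => by
      rw [map_smul_eq_mul]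
      exact mul_le_mul_of_nonneg_left (le_ciSup (hM v) k) (norm_nonneg r))
  ultra' v w := ciSup_le fun k => ((M k).isUltra v w).trans
    (max_le_max (le_ciSup (hM v) k) (le_ciSup (hM w) k))
  definite' v hv := (M (Classical.arbitrary κ)).definite' v
    (le_antisymm ((le_ciSup (hM v) _).trans hv.le) (apply_nonneg (M _).toSeminorm v))

/-- The multiple of `max_{i ∈ s} N i` which is normalized at `w`. -/
def normalizedMax (s : Finset ι) (hs : s.Nonempty) (N : ι → UltraNorm p V) {w : V} (hw : w ≠ 0) :
    UltraNorm p V :=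
  have hpos : ∀ {v}, v ≠ 0 → 0 < maxNorm s N v := fun {v} hv =>
    ((N _).pos hv).trans_le (le_maxNorm N hs.choose_spec v)
  { toSeminorm := (maxNorm s N w)⁻¹.toNNReal • maxNorm s N
    ultra' := (isUltra_maxNorm s N).smul _
    definite' := fun v hv => by
      by_contra h
      exact (mul_pos (NNReal.coe_pos.mpr (Real.toNNReal_pos.mpr (inv_pos.mpr (hpos hw)))) (hpos h)).ne' hv }

/-- The norm is the supremum of all invariant norms normalized at w and dominated by the maximum. It
is finite by the uniform bound, and is itself dominated by the maximum, so anything dominated by it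
already belongs to the family. -/
theorem IsSimpleFamily.exists_isLocallyMaximalAt (h : IsSimpleFamily ρ N) {s : Finset ι}
    (hs : s.Nonempty) {w : V} (hw : w ≠ 0) :
    ∃ M : UltraNorm p V, Equivalent (maxNorm s N) M.toSeminorm ∧ IsLocallyMaximalAt ρ M w := by
  obtain ⟨K, hK, hbound⟩ := h.exists_uniform_bound hs hw
  have hw0 : 0 < maxNorm s N w :=
    ((N _).pos hw).trans_le (le_maxNorm N hs.choose_spec w)
  have hn : ∀ v, normalizedMax s hs N hw v = (maxNorm s N w)⁻¹ * maxNorm s N v :=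
    fun v => congrArg (· * maxNorm s N v) (Real.coe_toNNReal _ (inv_nonneg.mpr hw0.le))
  let κ := {N' : UltraNorm p V // IsInvariant ρ N' ∧ N' w = 1 ∧
    Dominated N'.toSeminorm (maxNorm s N)}
  let k₀ : κ := ⟨normalizedMax s hs N hw, fun g v => by
      rw [hn, hn, isInvSeminorm_maxNorm h.inv], by rw [hn, inv_mul_cancel₀ hw0.ne'],
    ⟨(maxNorm s N w)⁻¹, inv_pos.mpr hw0, fun v => (hn v).le⟩⟩
  have : Nonempty κ := ⟨k₀⟩
  have hb : ∀ v, BddAbove (Set.range fun k : κ => k.1 v) := fun v =>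
    ⟨K * maxNorm s N v, by rintro _ ⟨k, rfl⟩; exact hbound k.1 k.2.1 k.2.2.1 k.2.2.2 v⟩
  let M := iSupNorm (fun k : κ => k.1) hb
  have hM : ∀ v, M v = ⨆ k : κ, k.1 v := fun v => rfl
  have hMle : ∀ v, M v ≤ K * maxNorm s N v := fun v =>
    ciSup_le fun k => hbound k.1 k.2.1 k.2.2.1 k.2.2.2 v
  have hleM : ∀ (k : κ) v, k.1 v ≤ M v := fun k v => le_ciSup (hb v) k
  refine ⟨M, ⟨⟨maxNorm s N w, hw0, fun v => ?_⟩, K, hK, hMle⟩, hw, fun g v => ?_, ?_,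
    fun N' hN' hN'w ⟨D, hD, hdom⟩ => ?_⟩
  · have := hleM k₀ v
    change (normalizedMax s hs N hw) v ≤ _ at this
    rwa [hn, inv_mul_le_iff₀ hw0] at this
  · rw [hM, hM]
    exact iSup_congr fun k => k.2.1 g v
  · rw [hM, iSup_congr fun k : κ => k.2.2.1, ciSup_const]
  · exact hleM ⟨N', hN', hN'w, D * K, by positivity, fun v => (hdom v).trans (by
      rw [mul_assoc]; exact mul_le_mul_of_nonneg_left (hMle v) hD.le)⟩

end LocallyMaximal

/-! ### Absolute values of ζ - 1 for p-power roots of unity, and sums of gcds. -/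

section RootsOfUnity

variable {p : ℕ} [Fact p.Prime]

lemma norm_natCast_prime : ‖(p : ℂ_[p])‖ = (p : ℝ)⁻¹ := by
  have := PadicComplex.norm_extends' p (p : ℚ_[p])
  rw [Padic.norm_p] at this
  rw [← this, PadicComplex.coe_eq, map_natCast, map_natCast]

lemma norm_intCast_le_one (n : ℤ) : ‖(n : ℂ_[p])‖ ≤ 1 := by
  have := PadicComplex.norm_extends' p (n : ℚ_[p])
  have h := Padic.norm_int_le_one (p := p) n
  rw [← this] at h
  rwa [PadicComplex.coe_eq, map_intCast, map_intCast] at h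

lemma norm_eq_one_of_pow_eq_one' {ζ : ℂ_[p]} {n : ℕ} (hn : n ≠ 0) (h : ζ ^ n = 1) : ‖ζ‖ = 1 :=
  (pow_eq_one_iff_of_nonneg (norm_nonneg ζ) hn).mp (by rw [← norm_pow, h, norm_one])

lemma norm_pow_sub_one_le {ζ : ℂ_[p]} (h : ‖ζ‖ ≤ 1) (n : ℕ) : ‖ζ ^ n - 1‖ ≤ ‖ζ - 1‖ := by
  rw [← geom_sum_mul, norm_mul]
  refine mul_le_of_le_one_left (norm_nonneg _)
    (IsUltrametricDist.norm_sum_le_of_forall_le_of_nonneg zero_le_one fun i _ => ?_)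
  rw [norm_pow]
  exact pow_le_one₀ (norm_nonneg _) h

lemma norm_sub_one_le_one {ζ : ℂ_[p]} (h : ‖ζ‖ ≤ 1) : ‖ζ - 1‖ ≤ 1 := by
  rw [sub_eq_add_neg]
  refine (IsUltrametricDist.norm_add_le_max ζ (-1)).trans (max_le h ?_)
  rw [norm_neg, norm_one]

lemma norm_sub_one_eq_of_isPrimitiveRoot {ζ ξ : ℂ_[p]} {n : ℕ} (hn : n ≠ 0)
    (hζ : IsPrimitiveRoot ζ n) (hξ : IsPrimitiveRoot ξ n) : ‖ξ - 1‖ = ‖ζ - 1‖ := by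
  have key : ∀ {ζ ξ : ℂ_[p]}, IsPrimitiveRoot ζ n → IsPrimitiveRoot ξ n →
      ‖ξ - 1‖ ≤ ‖ζ - 1‖ := by
    intro ζ ξ hζ hξ
    have : NeZero n := ⟨hn⟩
    obtain ⟨i, -, rfl⟩ := hζ.eq_pow_of_pow_eq_one hξ.pow_eq_one
    exact norm_pow_sub_one_le (norm_eq_one_of_pow_eq_one' hn hζ.pow_eq_one).le i
  exact le_antisymm (key hζ hξ) (key hξ hζ)

/-- The cyclotomic polynomial takes the value p at 1, and its factors 1 - ξ all have the same
absolute value. -/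
lemma norm_sub_one_pow_totient {ζ : ℂ_[p]} {L : ℕ} (hζ : IsPrimitiveRoot ζ (p ^ (L + 1))) :
    ‖ζ - 1‖ ^ (p ^ L * (p - 1)) = (p : ℝ)⁻¹ := by
  have hp : p.Prime := Fact.out
  have h1 := Polynomial.eval_one_cyclotomic_prime_pow (R := ℂ_[p]) (p := p) L
  rw [Polynomial.cyclotomic_eq_prod_X_sub_primitiveRoots hζ, Polynomial.eval_prod] at h1
  have h2 := congrArg norm h1
  rw [norm_prod, norm_natCast_prime] at h2
  rw [← h2, Finset.prod_congr rfl (g := fun _ => ‖ζ - 1‖), Finset.prod_const,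
    hζ.card_primitiveRoots, Nat.totient_prime_pow_succ hp]
  intro ξ hξ
  rw [Polynomial.eval_sub, Polynomial.eval_X, Polynomial.eval_C, norm_sub_rev]
  exact norm_sub_one_eq_of_isPrimitiveRoot (pow_ne_zero _ hp.ne_zero) hζ
    ((mem_primitiveRoots (pow_pos hp.pos _)).mp hξ)

lemma norm_pow_prime_pow_sub_one {ζ : ℂ_[p]} {L j : ℕ} (hζ : IsPrimitiveRoot ζ (p ^ L))
    (hj : j < L) : ‖ζ ^ p ^ j - 1‖ = ‖ζ - 1‖ ^ p ^ j := by
  have hp : p.Prime := Fact.out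
  obtain ⟨l, rfl⟩ := Nat.exists_eq_add_of_lt hj
  have h1 : IsPrimitiveRoot (ζ ^ p ^ j) (p ^ (l + 1)) :=
    hζ.pow (pow_pos hp.pos _) (by rw [← pow_add, add_assoc])
  have h2 := norm_sub_one_pow_totient h1
  have h3 := norm_sub_one_pow_totient (L := j + l) hζ
  have hne : p ^ l * (p - 1) ≠ 0 :=
    mul_ne_zero (pow_ne_zero _ hp.ne_zero) (Nat.sub_ne_zero_of_lt hp.one_lt)
  refine (pow_left_inj₀ (norm_nonneg _) (by positivity) hne).mp ?_
  rw [h2, ← h3, ← pow_mul]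
  ring_nf

/-- With t = ‖ζ - 1‖, one has ‖ζ^i - 1‖ = t^(p^v), where v is the valuation of i, as long as p^v is
less than the order of ζ. Truncating the gcd at p^h turns the equality into an upper bound; the next
lemma is the matching lower bound. -/
lemma norm_pow_sub_one_le_gcd {ζ : ℂ_[p]} {L h : ℕ} (hζ : IsPrimitiveRoot ζ (p ^ L)) (hh : h < L)
    (i : ℕ) : ‖ζ ^ i - 1‖ ≤ ‖ζ - 1‖ ^ i.gcd (p ^ h) := by
  have hp : p.Prime := Fact.out
  obtain ⟨j, hj, hji⟩ := (Nat.dvd_prime_pow hp).mp (Nat.gcd_dvd_right i (p ^ h))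
  have hd : p ^ j ∣ i := hji ▸ Nat.gcd_dvd_left i (p ^ h)
  obtain ⟨u, rfl⟩ := hd
  have h1 := norm_eq_one_of_pow_eq_one' (pow_ne_zero _ hp.ne_zero) hζ.pow_eq_one
  rw [hji, ← norm_pow_prime_pow_sub_one hζ (hj.trans_lt hh), pow_mul]
  exact norm_pow_sub_one_le (by rw [norm_pow, h1, one_pow]) u

lemma gcd_le_norm_pow_sub_one {ζ : ℂ_[p]} {L n i : ℕ} (hζ : IsPrimitiveRoot ζ (p ^ L))
    (hn : n < L) (hi : 0 < i) (hin : i < p ^ n) :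
    ‖ζ - 1‖ ^ i.gcd (p ^ n) ≤ ‖ζ ^ i - 1‖ := by
  have hp : p.Prime := Fact.out
  obtain ⟨v, u, hu, rfl⟩ := Nat.exists_eq_pow_mul_and_not_dvd hi.ne' p hp.ne_one
  have hu0 : 0 < u := Nat.pos_of_ne_zero (by rintro rfl; simp at hu)
  have hv : v < n := (Nat.pow_lt_pow_iff_right hp.one_lt).mp
    (lt_of_le_of_lt (Nat.le_mul_of_pos_right _ hu0) hin)
  have hcop : ∀ k, Nat.Coprime u (p ^ k) := fun k =>
    ((Nat.coprime_pow_right_iff (n := k + 1) (by omega) _ _).mpr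
      ((Nat.coprime_comm.mp ((Nat.Prime.coprime_iff_not_dvd hp).mpr hu)))).coprime_dvd_right
      (pow_dvd_pow p (Nat.le_succ k))
  have hg : (p ^ v * u).gcd (p ^ n) = p ^ v := by
    obtain ⟨k, rfl⟩ := Nat.exists_eq_add_of_le hv.le
    rw [pow_add, Nat.gcd_mul_left, (hcop k).gcd_eq_one, mul_one]
  have h1 : IsPrimitiveRoot (ζ ^ p ^ v) (p ^ (L - v)) :=
    hζ.pow (pow_pos hp.pos _) (by rw [← pow_add]; congr 1; omega)
  have h2 := h1.pow_of_coprime u (hcop _)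
  rw [hg, ← norm_pow_prime_pow_sub_one hζ (hv.trans hn), pow_mul,
    norm_sub_one_eq_of_isPrimitiveRoot (pow_ne_zero _ hp.ne_zero) h1 h2]

lemma sum_range_mul_eq {M : Type*} [AddCommMonoid M] (f : ℕ → M) (a b : ℕ) :
    ∑ i ∈ Finset.range (a * b), f i =
      ∑ i ∈ Finset.range a, ∑ c ∈ Finset.range b, f (b * i + c) := by
  induction a with
  | zero => simp
  | succ a ih => rw [Nat.succ_mul, Finset.sum_range_add, ih, Finset.sum_range_succ, mul_comm a b]

/-- Pillai's formula for the sum of the `gcd`s with a prime power. -/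
lemma mul_sum_gcd_prime_pow (n h : ℕ) (hh : h ≤ n) :
    p * ∑ i ∈ Finset.range (p ^ n), i.gcd (p ^ h) + h * p ^ n = p ^ (n + 1) * (1 + h) := by
  have hp : p.Prime := Fact.out
  induction n generalizing h with
  | zero =>
    obtain rfl : h = 0 := by omega
    simp
  | succ n ih =>
    cases h with
    | zero => simp [pow_succ, mul_comm]
    | succ h =>
      -- In each block of p consecutive integers p - 1 have gcd 1, and the multiple of p contributes
      -- p times a gcd of lower level. The added p ^ n avoids a subtraction.
      have h1 : ∑ i ∈ Finset.range (p ^ (n + 1)), i.gcd (p ^ (h + 1)) + p ^ n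
          = p ^ (n + 1) + p * ∑ i ∈ Finset.range (p ^ n), i.gcd (p ^ h) := by
        rw [pow_succ p n, sum_range_mul_eq, Finset.mul_sum]
        have h2 : ∀ i, ∑ c ∈ Finset.range p, (p * i + c).gcd (p ^ (h + 1)) + 1
            = p + p * i.gcd (p ^ h) := by
          intro i
          obtain ⟨m, hm⟩ := Nat.exists_eq_succ_of_ne_zero hp.ne_zero
          have h3 : ∀ c ∈ Finset.range m, (p * i + (c + 1)).gcd (p ^ (h + 1)) = 1 := by
            intro c hc
            have hc' := Finset.mem_range.mp hc
            refine Nat.Coprime.pow_right _ (Nat.coprime_comm.mp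
              ((Nat.Prime.coprime_iff_not_dvd hp).mpr fun hd => ?_))
            have := (Nat.dvd_add_right (dvd_mul_right p i)).mp hd
            exact absurd (Nat.le_of_dvd (by omega) this) (by omega)
          have h4 : ∑ c ∈ Finset.range p, (p * i + c).gcd (p ^ (h + 1)) = 
              ∑ c ∈ Finset.range m, (p * i + (c + 1)).gcd (p ^ (h + 1))
                + (p * i + 0).gcd (p ^ (h + 1)) := by
            rw [← Finset.sum_range_succ' (fun c => (p * i + c).gcd (p ^ (h + 1))) m, hm]
          rw [h4, Finset.sum_congr rfl h3, add_zero, pow_succ' p h, Nat.gcd_mul_left]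
          simp only [Finset.sum_const, Finset.card_range, smul_eq_mul, mul_one]
          omega
        calc _ = ∑ i ∈ Finset.range (p ^ n),
              (∑ c ∈ Finset.range p, (p * i + c).gcd (p ^ (h + 1)) + 1) := by
                rw [Finset.sum_add_distrib]; simp
          _ = _ := by
            rw [Finset.sum_congr rfl fun i _ => h2 i, Finset.sum_add_distrib]
            simp [mul_comm]
      have h2 := ih h (by omega)
      generalize ∑ i ∈ Finset.range (p ^ (n + 1)), i.gcd (p ^ (h + 1)) = A at *
      generalize ∑ i ∈ Finset.range (p ^ n), i.gcd (p ^ h) = B at *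
      zify at h1 h2 ⊢
      linear_combination (p : ℤ) * h1 + (p : ℤ) * h2

end RootsOfUnity

/-! ### q-Newton interpolation at the powers of a root of unity. -/

section Interpolation

open Polynomial

variable {p : ℕ} [Fact p.Prime]

lemma norm_coeff_mul_le {f g : ℂ_[p][X]} {a b : ℝ} (ha : 0 ≤ a) (hb : 0 ≤ b)
    (hf : ∀ k, ‖f.coeff k‖ ≤ a) (hg : ∀ k, ‖g.coeff k‖ ≤ b) (k : ℕ) :
    ‖(f * g).coeff k‖ ≤ a * b := by
  rw [coeff_mul]
  refine IsUltrametricDist.norm_sum_le_of_forall_le_of_nonneg (by positivity) fun x _ => ?_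
  rw [norm_mul]
  exact mul_le_mul (hf _) (hg _) (norm_nonneg _) ha

lemma norm_coeff_map_intCast_le (r : ℤ[X]) (k : ℕ) :
    ‖(r.map (Int.castRingHom ℂ_[p])).coeff k‖ ≤ 1 := by
  rw [coeff_map]
  exact norm_intCast_le_one _

/-- The nodal polynomial of the first `k` powers of `q`. -/
def powNodal (q : ℂ_[p]) (k : ℕ) : ℂ_[p][X] := ∏ i ∈ Finset.range k, (X - C (q ^ i))

lemma powNodal_succ (q : ℂ_[p]) (k : ℕ) : powNodal q (k + 1) = powNodal q k * (X - C (q ^ k)) :=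
  Finset.prod_range_succ _ _

/-- In the Taylor expansion of `powNodal q k` at `1`, the `j`-th coefficient is bounded by the
Gauss norm of radius `r`. -/
lemma norm_taylor_powNodal_le {q : ℂ_[p]} {r : ℝ} (hr : 0 ≤ r) (k j : ℕ) :
    ‖(taylor 1 (powNodal q k)).coeff j‖ * r ^ j ≤ ∏ i ∈ Finset.range k, max r ‖q ^ i - 1‖ := by
  induction k generalizing j with
  | zero =>
    simp only [powNodal, Finset.range_zero, Finset.prod_empty, taylor_one]
    rw [coeff_C]
    split_ifs with h
    · simp [h]
    · simp
  | succ k ih =>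
    rw [powNodal_succ, taylor_mul, Finset.prod_range_succ]
    -- Recentred at 1, each factor is X - (q^k - 1), of Gauss norm max r ‖q^k - 1‖; the Gauss norm
    -- is submultiplicative.
    have h1 : taylor 1 (X - C (q ^ k)) = X - C (q ^ k - 1) := by
      rw [map_sub, taylor_X, taylor_C, C_sub, C_1]; ring
    have hP : 0 ≤ ∏ i ∈ Finset.range k, max r ‖q ^ i - 1‖ :=
      Finset.prod_nonneg fun i _ => le_max_of_le_left hr
    have hx : ∀ (y z : ℂ_[p]), ‖y - z‖ ≤ max ‖y‖ ‖z‖ := fun y z => by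
      simpa [sub_eq_add_neg] using IsUltrametricDist.norm_add_le_max y (-z)
    have h0 : ∀ j, ‖(taylor 1 (powNodal q k)).coeff j * (q ^ k - 1)‖ * r ^ j ≤
        (∏ i ∈ Finset.range k, max r ‖q ^ i - 1‖) * max r ‖q ^ k - 1‖ := fun j => by
      rw [norm_mul, mul_right_comm]
      exact mul_le_mul (ih j) (le_max_right _ _) (norm_nonneg _) hP
    rw [h1, mul_sub]
    cases j with
    | zero =>
      rw [coeff_sub, mul_coeff_zero, mul_coeff_zero, coeff_X_zero, mul_zero, zero_sub, norm_neg,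
        coeff_C_zero]
      exact h0 0
    | succ j =>
      rw [coeff_sub, coeff_mul_X, coeff_mul_C]
      refine (mul_le_mul_of_nonneg_right (hx _ _) (by positivity)).trans ?_
      rw [max_mul_of_nonneg _ _ (by positivity)]
      refine max_le ?_ (h0 _)
      rw [pow_succ, ← mul_assoc]
      exact mul_le_mul (ih j) (le_max_left _ _) hr hP

/-- The linear functional on polynomials which maps `X ^ b` to `1` if `m ∣ b`, and to `0`
otherwise. -/
def divFunctional (p : ℕ) [Fact p.Prime] (m : ℕ) : ℂ_[p][X] →ₗ[ℂ_[p]] ℂ_[p] :=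
  Polynomial.lsum fun b => if m ∣ b then LinearMap.id else 0

lemma divFunctional_monomial (m b : ℕ) (a : ℂ_[p]) :
    divFunctional p m (monomial b a) = if m ∣ b then a else 0 := by
  rw [divFunctional, Polynomial.lsum_apply, sum_monomial_index _ _ (by simp)]
  split_ifs <;> simp

lemma divFunctional_X_pow (m b : ℕ) :
    divFunctional p m (X ^ b) = if m ∣ b then 1 else 0 := by
  rw [X_pow_eq_monomial, divFunctional_monomial]

lemma divFunctional_mul_X_pow (m : ℕ) (g : ℂ_[p][X]) :
    divFunctional p m (g * X ^ m) = divFunctional p m g := by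
  induction g using Polynomial.induction_on' with
  | add f g hf hg => rw [add_mul, map_add, map_add, hf, hg]
  | monomial n a =>
    rw [monomial_mul_X_pow, divFunctional_monomial, divFunctional_monomial]
    simp

lemma norm_divFunctional_le (m : ℕ) {g : ℂ_[p][X]} {B : ℝ} (hB : 0 ≤ B)
    (h : ∀ k, ‖g.coeff k‖ ≤ B) : ‖divFunctional p m g‖ ≤ B := by
  rw [divFunctional, Polynomial.lsum_apply, Polynomial.sum]
  refine IsUltrametricDist.norm_sum_le_of_forall_le_of_nonneg hB fun k _ => ?_
  split_ifs
  · exact h k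
  · simpa

lemma norm_divFunctional_X_sub_one_pow_le_one (m j : ℕ) :
    ‖divFunctional p m ((X - C 1) ^ j)‖ ≤ 1 := by
  refine norm_divFunctional_le m zero_le_one fun k => ?_
  have : ((X - C 1) ^ j : ℂ_[p][X]) = (((X - C 1) ^ j : ℤ[X])).map (Int.castRingHom ℂ_[p]) := by
    simp
  rw [this]
  exact norm_coeff_map_intCast_le _ k

/-- Modulo p, (X - 1)^(p^M) is X^(p^M) - 1, and the functional is unchanged under multiplication by
X^(p^M). -/
lemma norm_divFunctional_X_sub_one_pow_le (M j : ℕ) (hj : p ^ M ≤ j) :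
    ‖divFunctional p (p ^ M) ((X - C 1) ^ j)‖ ≤ (p : ℝ)⁻¹ := by
  obtain ⟨j, rfl⟩ := Nat.exists_eq_add_of_le hj
  obtain ⟨r, hr⟩ := exists_add_pow_prime_pow_eq (Fact.out : p.Prime) (X - 1 : ℤ[X]) 1 M
  rw [sub_add_cancel, one_pow, mul_one, mul_assoc] at hr
  have h1 : ((X - C 1) ^ (p ^ M + j) : ℂ_[p][X]) = (X - C 1) ^ j * X ^ p ^ M - (X - C 1) ^ j
      - (p : ℂ_[p]) • (((X - 1) * r) * (X - 1) ^ j).map (Int.castRingHom ℂ_[p]) := by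
    have h2 := congrArg (Polynomial.map (Int.castRingHom ℂ_[p])) hr
    simp only [Polynomial.map_pow, map_X, Polynomial.map_add, Polynomial.map_sub,
      Polynomial.map_one, Polynomial.map_mul, Polynomial.map_natCast] at h2
    simp only [Polynomial.map_pow, map_X, Polynomial.map_sub,
      Polynomial.map_one, Polynomial.map_mul, C_1]
    rw [h2, smul_eq_C_mul, C_eq_natCast]
    ring
  rw [h1, map_sub, map_sub, divFunctional_mul_X_pow, sub_self, zero_sub, norm_neg, map_smul,
    smul_eq_mul, norm_mul, norm_natCast_prime]
  refine mul_le_of_le_one_right (by positivity) ?_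
  exact norm_divFunctional_le _ zero_le_one fun k => norm_coeff_map_intCast_le _ k

/-- The Newton coefficients of the indicator function of the multiples of `m`. -/
def newtonCoeff (m : ℕ) (q : ℂ_[p]) (k : ℕ) : ℂ_[p] := divFunctional p m (powNodal q k)

lemma norm_coeff_powNodal_le {q : ℂ_[p]} (hq : ‖q‖ = 1) (k j : ℕ) :
    ‖(powNodal q k).coeff j‖ ≤ 1 := by
  induction k generalizing j with
  | zero =>
    rw [powNodal, Finset.range_zero, Finset.prod_empty, coeff_one]
    split_ifs <;> simp
  | succ k ih =>
    rw [powNodal_succ, ← mul_one (1 : ℝ)]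
    refine norm_coeff_mul_le zero_le_one zero_le_one ih (fun i => ?_) j
    have hc : ‖q ^ k‖ = 1 := by rw [norm_pow, hq, one_pow]
    generalize q ^ k = c at hc
    rcases i with _ | _ | i <;> simp [coeff_X, coeff_C, hc]

lemma norm_newtonCoeff_le_one {q : ℂ_[p]} (hq : ‖q‖ = 1) (m k : ℕ) :
    ‖newtonCoeff m q k‖ ≤ 1 :=
  norm_divFunctional_le m zero_le_one (norm_coeff_powNodal_le hq k)

/-- Expand the nodal polynomial at 1. Terms of degree at least p^M gain 1/p from the functional;
those of lower degree have coefficients controlled by the Gauss norm of radius r. -/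
lemma norm_newtonCoeff_le {q : ℂ_[p]} (hq : ‖q‖ = 1) (M k : ℕ) {r : ℝ} (hr : 0 < r)
    (hr1 : r ≤ 1) : ‖newtonCoeff (p ^ M) q k‖ ≤
      max (p : ℝ)⁻¹ ((r ^ p ^ M)⁻¹ * ∏ i ∈ Finset.range k, max r ‖q ^ i - 1‖) := by
  have h1 : powNodal q k = (taylor 1 (powNodal q k)).sum fun i a => a • (X - C 1) ^ i := by
    simp only [smul_eq_C_mul]
    exact (sum_taylor_eq _ _).symm
  rw [newtonCoeff, h1, Polynomial.sum, map_sum]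
  refine IsUltrametricDist.norm_sum_le_of_forall_le_of_nonneg
    (le_max_of_le_left (by positivity)) fun j _ => ?_
  rw [map_smul, smul_eq_mul, norm_mul]
  rcases le_or_gt (p ^ M) j with hj | hj
  · refine le_max_of_le_left ?_
    have h2 := norm_taylor_powNodal_le (q := q) zero_le_one k j
    rw [one_pow, mul_one] at h2
    have h3 : ∏ i ∈ Finset.range k, max 1 ‖q ^ i - 1‖ = 1 :=
      Finset.prod_eq_one fun i _ => max_eq_left
        (norm_sub_one_le_one (by rw [norm_pow, hq, one_pow]))
    rw [h3] at h2
    calc _ ≤ 1 * (p : ℝ)⁻¹ := mul_le_mul h2 (norm_divFunctional_X_sub_one_pow_le M j hj)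
          (norm_nonneg _) zero_le_one
      _ = _ := one_mul _
  · refine le_max_of_le_right ?_
    refine (mul_le_of_le_one_right (norm_nonneg _)
      (norm_divFunctional_X_sub_one_pow_le_one _ _)).trans ?_
    have h2 := norm_taylor_powNodal_le (q := q) hr.le k j
    rw [inv_mul_eq_div, le_div_iff₀ (by positivity)]
    refine le_trans (mul_le_mul_of_nonneg_left ?_ (norm_nonneg _)) h2
    exact pow_le_pow_of_le_one hr.le hr1 hj.le

/-- The Gaussian binomial coefficients. -/
def gaussBinom (q : ℂ_[p]) : ℕ → ℕ → ℂ_[p]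
  | _, 0 => 1
  | 0, _ + 1 => 0
  | b + 1, k + 1 => gaussBinom q b k + q ^ (k + 1) * gaussBinom q b (k + 1)

lemma gaussBinom_zero_right (q : ℂ_[p]) (b : ℕ) : gaussBinom q b 0 = 1 := by
  cases b <;> rw [gaussBinom]

lemma norm_gaussBinom_le {q : ℂ_[p]} (hq : ‖q‖ = 1) (b k : ℕ) : ‖gaussBinom q b k‖ ≤ 1 := by
  induction b generalizing k with
  | zero => cases k <;> simp [gaussBinom]
  | succ b ih =>
    cases k with
    | zero => simp [gaussBinom]
    | succ k =>
      rw [gaussBinom]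
      refine (IsUltrametricDist.norm_add_le_max _ _).trans (max_le (ih k) ?_)
      rw [norm_mul, norm_pow, hq, one_pow, one_mul]
      exact ih _

lemma gaussBinom_eq_zero (q : ℂ_[p]) {b k : ℕ} (h : b < k) : gaussBinom q b k = 0 := by
  induction b generalizing k with
  | zero => obtain ⟨k, rfl⟩ := Nat.exists_eq_succ_of_ne_zero h.ne'; rw [gaussBinom]
  | succ b ih =>
    obtain ⟨k, rfl⟩ := Nat.exists_eq_succ_of_ne_zero (Nat.zero_lt_of_lt h).ne'
    rw [gaussBinom, ih (by omega), ih (by omega), mul_zero, add_zero]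

lemma X_pow_eq_sum_gaussBinom (q : ℂ_[p]) (b : ℕ) :
    (X ^ b : ℂ_[p][X]) = ∑ k ∈ Finset.range (b + 1), gaussBinom q b k • powNodal q k := by
  induction b with
  | zero => simp [gaussBinom, powNodal]
  | succ b ih =>
    have hX : ∀ k, powNodal q k * X = powNodal q (k + 1) + q ^ k • powNodal q k := fun k => by
      rw [powNodal_succ, smul_eq_C_mul]; ring
    have h1 : ∑ k ∈ Finset.range (b + 1), (gaussBinom q b k * q ^ k) • powNodal q k
        = ∑ k ∈ Finset.range (b + 1), (q ^ (k + 1) * gaussBinom q b (k + 1)) • powNodal q (k + 1)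
          + powNodal q 0 := by
      have h2 := Finset.sum_range_succ' (fun k => (gaussBinom q b k * q ^ k) • powNodal q k) (b + 1)
      rw [Finset.sum_range_succ, gaussBinom_eq_zero q (Nat.lt_succ_self b), zero_mul, zero_smul,
        add_zero] at h2
      rw [h2, gaussBinom_zero_right, pow_zero, mul_one, one_smul]
      simp only [mul_comm]
    rw [pow_succ, ih, Finset.sum_mul, Finset.sum_range_succ' _ (b + 1), gaussBinom_zero_right, one_smul]
    simp only [smul_mul_assoc, hX, smul_add, smul_smul, gaussBinom, add_smul,
      Finset.sum_add_distrib]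
    rw [h1, add_assoc]

lemma sum_newtonCoeff_mul_gaussBinom (m : ℕ) (q : ℂ_[p]) (b : ℕ) :
    ∑ k ∈ Finset.range (b + 1), newtonCoeff m q k * gaussBinom q b k
      = if m ∣ b then 1 else 0 := by
  rw [← divFunctional_X_pow, X_pow_eq_sum_gaussBinom q b, map_sum]
  simp only [map_smul, smul_eq_mul, newtonCoeff, mul_comm]

/-- The polynomial which takes the value `gaussBinom q b k` at `q ^ b`. -/
def gaussBinomPoly (q : ℂ_[p]) (k : ℕ) : ℂ_[p][X] :=
  (∏ i ∈ Finset.range k, (q ^ i * (q ^ (i + 1) - 1)))⁻¹ • powNodal q k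

/-- This links the recursive Gaussian binomials, integral without any division, with genuine
polynomials in q^b, whose denominators are the quantities to be bounded. -/
lemma eval_gaussBinomPoly {q : ℂ_[p]} (hq : q ≠ 0) (b k : ℕ)
    (h : ∀ i < k, q ^ (i + 1) - 1 ≠ 0) : (gaussBinomPoly q k).eval (q ^ b) = gaussBinom q b k := by
  induction b generalizing k with
  | zero =>
    cases k with
    | zero => simp [gaussBinomPoly, gaussBinom, powNodal]
    | succ k => simp [gaussBinomPoly, gaussBinom, powNodal, eval_prod, Finset.prod_range_succ']
  | succ b ih =>
    cases k with
    | zero => simp [gaussBinomPoly, gaussBinom, powNodal]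
    | succ k =>
      rw [gaussBinom, ← ih k fun i hi => h i (by omega), ← ih (k + 1) h]
      have h1 : (powNodal q (k + 1)).eval (q ^ (b + 1))
          = (q ^ (b + 1) - 1) * q ^ k * (powNodal q k).eval (q ^ b) := by
        simp only [powNodal, eval_prod, eval_sub, eval_X, eval_C]
        rw [Finset.prod_range_succ', pow_zero, mul_comm, mul_assoc]
        congr 1
        rw [← Finset.card_range k, ← Finset.prod_const, Finset.card_range,
          ← Finset.prod_mul_distrib]
        exact Finset.prod_congr rfl fun i _ => by ring
      have h2 : (powNodal q (k + 1)).eval (q ^ b)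
          = (powNodal q k).eval (q ^ b) * (q ^ b - q ^ k) := by
        rw [powNodal_succ, eval_mul, eval_sub, eval_X, eval_C]
      simp only [gaussBinomPoly, eval_smul, smul_eq_mul]
      rw [h1, h2, Finset.prod_range_succ]
      have h3 : ∏ i ∈ Finset.range k, (q ^ i * (q ^ (i + 1) - 1)) ≠ 0 :=
        Finset.prod_ne_zero_iff.mpr fun i hi => mul_ne_zero (pow_ne_zero _ hq)
          (h i (by have := Finset.mem_range.mp hi; omega))
      have h4 := h k (by omega)
      have h5 : q ^ k ≠ 0 := pow_ne_zero _ hq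
      field_simp
      ring

end Interpolation

/-! ### Approximating the indicator function of the multiples of p^M. -/

section Approximation

open Polynomial

variable {p : ℕ} [Fact p.Prime]

lemma prod_range_le_prod_range {f : ℕ → ℝ} {a b : ℕ} (hab : a ≤ b) (h0 : ∀ i, 0 ≤ f i)
    (h1 : ∀ i, f i ≤ 1) : ∏ i ∈ Finset.range b, f i ≤ ∏ i ∈ Finset.range a, f i := by
  obtain ⟨c, rfl⟩ := Nat.exists_eq_add_of_le hab
  rw [Finset.prod_range_add]
  exact mul_le_of_le_one_right (Finset.prod_nonneg fun i _ => h0 i)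
    (Finset.prod_le_one (fun i _ => h0 _) fun i _ => h1 _)

lemma two_mul_le_prime_pow (M : ℕ) : 2 * M ≤ p ^ (2 * M) := by
  have hp : p.Prime := Fact.out
  exact (Nat.lt_pow_self hp.one_lt).le

/-- The error in the approximation of indicator functions. -/
def approxError (p : ℕ) : ℝ := (p : ℝ)⁻¹ ^ ((2 * p : ℝ)⁻¹)

omit [Fact p.Prime] in
lemma approxError_nonneg : 0 ≤ approxError p := Real.rpow_nonneg (by positivity) _

lemma approxError_lt_one : approxError p < 1 := by
  have hp : p.Prime := Fact.out
  have hp0 : (0 : ℝ) < p := by exact_mod_cast hp.pos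
  exact Real.rpow_lt_one (by positivity) (inv_lt_one_of_one_lt₀ (by exact_mod_cast hp.one_lt))
    (by positivity)

lemma approxError_pow : approxError p ^ (2 * p) = (p : ℝ)⁻¹ := by
  have hp : p.Prime := Fact.out
  have hp0 : (p : ℝ) ≠ 0 := by exact_mod_cast hp.ne_zero
  rw [approxError, ← Real.rpow_natCast, ← Real.rpow_mul (by positivity)]
  push_cast
  rw [inv_mul_cancel₀ (by positivity), Real.rpow_one]

lemma le_approxError {x : ℝ} (h : x ^ (2 * p) ≤ (p : ℝ)⁻¹) : x ≤ approxError p := by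
  have hp : p.Prime := Fact.out
  rw [← approxError_pow] at h
  exact le_of_pow_le_pow_left₀ (mul_ne_zero two_ne_zero hp.ne_zero) approxError_nonneg h

/-- **Fresnel–de Mathan**: the indicator function of the multiples of `p ^ M` is approximated by a
polynomial in a root of unity of large order, with coefficients which are bounded independently
of `M`. -/
theorem exists_polynomial_approx (M : ℕ) : ∃ L, M ≤ L ∧ ∀ ζ : ℂ_[p], IsPrimitiveRoot ζ (p ^ L) →
    ∃ E : ℂ_[p][X], (∀ k, ‖E.coeff k‖ ≤ p) ∧
      ∀ b : ℕ, ‖E.eval (ζ ^ b) - if p ^ M ∣ b then 1 else 0‖ ≤ approxError p := by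
  have hp : p.Prime := Fact.out
  have hp0 : (0 : ℝ) < p := by exact_mod_cast hp.pos
  -- The approximant is the Newton series truncated at p^n. With n = p^(2M) and order p^(n + 2M +
  -- 1), the totient exponent is exactly n p^n (p - 1), proportional to the sum of gcds below p^n.
  -- Also 2M ≤ n, so h = n - M is at least n / 2.
  obtain ⟨n, hn⟩ : ∃ n, n = p ^ (2 * M) := ⟨_, rfl⟩
  have hMn : 2 * M ≤ n := hn ▸ two_mul_le_prime_pow M
  obtain ⟨h, hh⟩ : ∃ h, n = M + h := Nat.exists_eq_add_of_le (by omega)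
  refine ⟨n + 2 * M + 1, by omega, fun ζ hζ => ?_⟩
  have hζ1 : ‖ζ‖ = 1 := norm_eq_one_of_pow_eq_one' (pow_ne_zero _ hp.ne_zero) hζ.pow_eq_one
  have hζ0 : ζ ≠ 0 := norm_ne_zero_iff.mp (by rw [hζ1]; exact one_ne_zero)
  set t := ‖ζ - 1‖ with ht
  have ht1 : t ≤ 1 := norm_sub_one_le_one hζ1.le
  have htpow : t ^ (n * p ^ n * (p - 1)) = (p : ℝ)⁻¹ := by
    rw [← norm_sub_one_pow_totient hζ, pow_add p n, ← hn]
    congr 1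
    ring
  have ht0 : 0 < t := by
    refine (norm_nonneg _).lt_of_ne fun h0 => ?_
    have := hζ.pow_eq_one
    have h1 : ζ = 1 := sub_eq_zero.mp (norm_eq_zero.mp h0.symm)
    rw [h1, IsPrimitiveRoot.one_left_iff] at hζ
    exact (Nat.one_lt_pow (by omega) hp.one_lt).ne' hζ
  have hL : n < n + 2 * M + 1 := by omega
  have hne : ∀ i, 0 < i → i < p ^ n → ζ ^ i - 1 ≠ 0 := fun i hi hin =>
    norm_ne_zero_iff.mp ((pow_pos ht0 _).trans_le (gcd_le_norm_pow_sub_one hζ hL hi hin)).ne'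
  have hpn : 0 < p ^ n := pow_pos hp.pos _
  have hp1 : p - 1 + 1 = p := Nat.sub_add_cancel hp.one_le
  have hp1' : ((p - 1 : ℕ) : ℤ) = p - 1 := by omega
  -- Largest denominator: the product of the ‖ζ^i - 1‖ for 0 < i < p^n is at least t^S with p S = n
  -- p^n (p - 1), hence t^S ≥ t^(p S) = 1/p.
  have hbinom : ∀ k ≤ p ^ n - 1, ∀ j, ‖(gaussBinomPoly ζ k).coeff j‖ ≤ p := by
    intro k hk j
    rw [gaussBinomPoly, coeff_smul, smul_eq_mul, norm_mul, norm_inv, norm_prod]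
    refine (mul_le_of_le_one_right (by positivity) (norm_coeff_powNodal_le hζ1 k j)).trans ?_
    refine inv_le_of_inv_le₀ hp0 ?_
    simp only [norm_mul, norm_pow, hζ1, one_pow, one_mul]
    have h1 : ∏ i ∈ Finset.range (p ^ n - 1), ‖ζ ^ (i + 1) - 1‖ ≤
        ∏ i ∈ Finset.range k, ‖ζ ^ (i + 1) - 1‖ :=
      prod_range_le_prod_range hk (fun i => norm_nonneg _)
        fun i => norm_sub_one_le_one (by rw [norm_pow, hζ1, one_pow])
    refine le_trans ?_ h1
    have h2 : ∏ i ∈ Finset.range (p ^ n - 1), t ^ (i + 1).gcd (p ^ n) ≤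
        ∏ i ∈ Finset.range (p ^ n - 1), ‖ζ ^ (i + 1) - 1‖ :=
      Finset.prod_le_prod (fun i _ => by positivity) fun i hi =>
        gcd_le_norm_pow_sub_one hζ hL (by omega) (by have := Finset.mem_range.mp hi; omega)
    refine le_trans ?_ h2
    rw [Finset.prod_pow_eq_pow_sum, ← htpow]
    refine pow_le_pow_of_le_one ht0.le ht1 ?_
    have h3 := mul_sum_gcd_prime_pow (p := p) n n le_rfl
    obtain ⟨m, hm⟩ := Nat.exists_eq_succ_of_ne_zero hpn.ne'
    have h4 : ∑ i ∈ Finset.range (p ^ n), i.gcd (p ^ n) =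
        ∑ i ∈ Finset.range (p ^ n - 1), (i + 1).gcd (p ^ n) + p ^ n := by
      conv_lhs => rw [show p ^ n = (p ^ n - 1) + 1 by omega, Finset.sum_range_succ']
      rw [Nat.sub_add_cancel hpn]
      simp
    rw [h4] at h3
    generalize ∑ i ∈ Finset.range (p ^ n - 1), (i + 1).gcd (p ^ n) = S at *
    have h5 : p * S = n * p ^ n * (p - 1) := by
      zify
      rw [hp1']
      zify at h3
      rw [pow_succ] at h3
      linear_combination h3
    rw [← h5]
    exact Nat.le_mul_of_pos_left _ hp.pos
  -- With radius r = t^(p^h), the low-degree bound is t^S' with p S' = h p^n (p - 1). As 2h ≥ n, its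
  -- power of exponent 2p is at most 1/p, whence the value of `approxError`.
  have hcoeff : ∀ k, p ^ n ≤ k → ‖newtonCoeff (p ^ M) ζ k‖ ≤ approxError p := by
    intro k hk
    have hr0 : 0 < t ^ p ^ h := by positivity
    have hr1 : t ^ p ^ h ≤ 1 := pow_le_one₀ ht0.le ht1
    refine (norm_newtonCoeff_le hζ1 M k hr0 hr1).trans (max_le ?_ ?_)
    · refine le_approxError (pow_le_of_le_one (by positivity) ?_ (mul_ne_zero two_ne_zero hp.ne_zero))
      exact inv_le_one_of_one_le₀ (by exact_mod_cast hp.one_le)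
    · have h1 : ∏ i ∈ Finset.range k, max (t ^ p ^ h) ‖ζ ^ i - 1‖ ≤
          ∏ i ∈ Finset.range (p ^ n), max (t ^ p ^ h) ‖ζ ^ i - 1‖ :=
        prod_range_le_prod_range hk
          (fun i => le_max_of_le_left hr0.le) fun i => max_le hr1
            (norm_sub_one_le_one (by rw [norm_pow, hζ1, one_pow]))
      have h2 : ∏ i ∈ Finset.range (p ^ n), max (t ^ p ^ h) ‖ζ ^ i - 1‖ ≤
          ∏ i ∈ Finset.range (p ^ n), t ^ i.gcd (p ^ h) :=
        Finset.prod_le_prod (fun i _ => le_max_of_le_left hr0.le) fun i _ =>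
          max_le (pow_le_pow_of_le_one ht0.le ht1 (Nat.gcd_le_right _ (pow_pos hp.pos _)))
            (norm_pow_sub_one_le_gcd hζ (by omega) i)
      rw [Finset.prod_pow_eq_pow_sum] at h2
      have h3 := mul_sum_gcd_prime_pow (p := p) n h (by omega)
      generalize ∑ i ∈ Finset.range (p ^ n), i.gcd (p ^ h) = S at *
      have h4 : p ^ n ≤ S := by
        have h6 : h * p ^ n ≤ h * p ^ (n + 1) :=
          Nat.mul_le_mul_left _ (Nat.pow_le_pow_right hp.pos (Nat.le_succ n))
        have h5 : p * p ^ n ≤ p * S := by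
          rw [← pow_succ']
          nlinarith
        exact Nat.le_of_mul_le_mul_left h5 hp.pos
      obtain ⟨S', rfl⟩ := Nat.exists_eq_add_of_le h4
      have h5 : (t ^ p ^ h) ^ p ^ M = t ^ p ^ n := by
        rw [← pow_mul, ← pow_add, hh, add_comm]
      rw [h5]
      have h6 : (t ^ p ^ n)⁻¹ * t ^ (p ^ n + S') = t ^ S' := by
        rw [pow_add, inv_mul_cancel_left₀ (by positivity)]
      refine (mul_le_mul_of_nonneg_left (h1.trans h2) (by positivity)).trans ?_
      rw [h6]
      refine le_approxError ?_
      rw [← htpow, ← pow_mul]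
      refine pow_le_pow_of_le_one ht0.le ht1 ?_
      have h7 : p * S' = h * p ^ n * (p - 1) := by
        zify
        rw [hp1']
        zify at h3
        rw [pow_succ] at h3
        linear_combination h3
      calc n * p ^ n * (p - 1) ≤ (2 * h) * p ^ n * (p - 1) := by gcongr; omega
        _ = 2 * (p * S') := by rw [h7]; ring
        _ = S' * (2 * p) := by ring
  refine ⟨∑ k ∈ Finset.range (p ^ n), newtonCoeff (p ^ M) ζ k • gaussBinomPoly ζ k,
    fun j => ?_, fun b => ?_⟩
  · rw [finsetSum_coeff]
    refine IsUltrametricDist.norm_sum_le_of_forall_le_of_nonneg hp0.le fun k hk => ?_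
    rw [coeff_smul, smul_eq_mul, norm_mul]
    have := Finset.mem_range.mp hk
    exact (mul_le_of_le_one_left (norm_nonneg _) (norm_newtonCoeff_le_one hζ1 _ _)).trans
      (hbinom k (by omega) j)
  · have h1 : (∑ k ∈ Finset.range (p ^ n), newtonCoeff (p ^ M) ζ k • gaussBinomPoly ζ k).eval (ζ ^ b)
        = ∑ k ∈ Finset.range (p ^ n), newtonCoeff (p ^ M) ζ k * gaussBinom ζ b k := by
      rw [eval_finsetSum]
      refine Finset.sum_congr rfl fun k hk => ?_
      rw [eval_smul, smul_eq_mul, eval_gaussBinomPoly hζ0 b k fun i hi =>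
        hne _ (by omega) (by have := Finset.mem_range.mp hk; omega)]
    -- Binomials with k > b vanish, so the range can be enlarged to contain the truncation; the
    -- error is then the tail k ≥ p^n.
    have h2 : ∑ k ∈ Finset.range (p ^ n + (b + 1)), newtonCoeff (p ^ M) ζ k * gaussBinom ζ b k
        = if p ^ M ∣ b then 1 else 0 := by
      rw [← sum_newtonCoeff_mul_gaussBinom (p ^ M) ζ b]
      refine (Finset.sum_subset (by simp) fun k _ hk => ?_).symm
      rw [gaussBinom_eq_zero ζ (by simpa using hk), mul_zero]
    rw [h1, ← h2, Finset.sum_range_add, sub_add_cancel_left, norm_neg]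
    refine IsUltrametricDist.norm_sum_le_of_forall_le_of_nonneg approxError_nonneg fun k _ => ?_
    rw [norm_mul]
    exact (mul_le_of_le_one_right (norm_nonneg _) (norm_gaussBinom_le hζ1 _ _)).trans
      (hcoeff _ (by omega))

/-- A polynomial which is equal to the indicator function of `1` on the roots of unity of order
dividing `m`. -/
lemma exists_polynomial_exact {m : ℕ} (hm : m ≠ 0) : ∃ E : ℂ_[p][X],
    E.eval 1 = 1 ∧ ∀ z : ℂ_[p], z ^ m = 1 → z ≠ 1 → E.eval z = 0 := by
  refine ⟨(m : ℂ_[p])⁻¹ • ∑ i ∈ Finset.range m, X ^ i, ?_, fun z hz h => ?_⟩ <;>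
    rw [eval_smul, eval_finsetSum] <;> simp only [eval_pow, eval_X]
  · simp [hm]
  · have h1 := geom_sum_mul z m
    rw [hz, sub_self] at h1
    rw [(mul_eq_zero.mp h1).resolve_right (sub_ne_zero.mpr h), smul_zero]

end Approximation

/-! ### Smooth characters of ℚ_p. -/

section Character

variable {p : ℕ} [Fact p.Prime] {ψ : AddChar ℚ_[p] ℂ_[p]}

lemma exists_nat_close {y : ℚ_[p]} (hy : ‖y‖ ≤ 1) (L : ℕ) :
    ∃ b : ℕ, ∃ z : ℚ_[p], ‖z‖ ≤ 1 ∧ y = b + p ^ L * z := by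
  obtain ⟨Y, rfl⟩ : ∃ Y : ℤ_[p], (Y : ℚ_[p]) = y := ⟨⟨y, hy⟩, rfl⟩
  obtain ⟨z, hz⟩ := Ideal.mem_span_singleton'.mp (PadicInt.appr_spec L Y)
  refine ⟨PadicInt.appr Y L, z, z.2, ?_⟩
  have h1 := congrArg (fun x : ℤ_[p] => (x : ℚ_[p])) hz
  push_cast at h1
  linear_combination -h1

lemma exists_char_radius (hψ : IsOpen {x | ψ x = 1}) : ∃ r > 0, ∀ x, ‖x‖ ≤ r → ψ x = 1 := by
  obtain ⟨r, hr, h⟩ := Metric.isOpen_iff.mp hψ 0 (by simp)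
  exact ⟨r / 2, half_pos hr, fun x hx => h (by
    rw [Metric.mem_ball, dist_zero_right]
    exact hx.trans_lt (half_lt_self hr))⟩

lemma exists_pow_mul_char_eq_one (hψ : IsOpen {x | ψ x = 1}) (x : ℚ_[p]) :
    ∃ k : ℕ, ∀ y : ℚ_[p], ‖y‖ ≤ 1 → ψ (p ^ k * x * y) = 1 := by
  obtain ⟨r, hr, h⟩ := exists_char_radius hψ
  have h1 : Filter.Tendsto (fun k : ℕ => (p : ℚ_[p]) ^ k * x) Filter.atTop (nhds (0 * x)) :=
    (tendsto_pow_atTop_nhds_zero_of_norm_lt_one Padic.norm_p_lt_one).mul_const x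
  rw [zero_mul] at h1
  obtain ⟨k, hk⟩ := ((tendsto_zero_iff_norm_tendsto_zero.mp h1).eventually
    (ge_mem_nhds hr)).exists
  exact ⟨k, fun y hy => h _ (by
    rw [norm_mul]; exact (mul_le_of_le_one_right (norm_nonneg _) hy).trans hk)⟩

/-- Take the least k such that ψ is trivial on p^k x ℤ_p; it is positive, and level k - 1 provides
z. -/
lemma exists_conductor (hψ : IsOpen {x | ψ x = 1}) (hne : ∃ x, ψ x ≠ 1) :
    ∃ z : ℚ_[p], ψ z ≠ 1 ∧ ∀ y : ℚ_[p], ‖y‖ ≤ 1 → ψ (p * z * y) = 1 := by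
  classical
  obtain ⟨x, hx⟩ := hne
  have hex := exists_pow_mul_char_eq_one hψ x
  have hpos : Nat.find hex ≠ 0 := fun h0 => hx <| by
    have := Nat.find_spec hex 1 (by simp)
    rw [h0] at this
    simpa using this
  obtain ⟨k, hk⟩ := Nat.exists_eq_succ_of_ne_zero hpos
  have hmin := Nat.find_min hex (m := k) (by omega)
  push Not at hmin
  obtain ⟨y, hy, hy1⟩ := hmin
  refine ⟨p ^ k * x * y, hy1, fun y' hy' => ?_⟩
  have := Nat.find_spec hex (y * y') (by
    rw [norm_mul]; exact mul_le_one₀ hy (norm_nonneg _) hy')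
  rw [hk] at this
  rw [← this]
  congr 1
  rw [Nat.succ_eq_add_one]
  ring

/-- For every order `p ^ L` and every ball, some dilation of the character `ψ` parametrizes on the
ball the roots of unity of order dividing `p ^ L`. -/
lemma exists_dilation (hψ : IsOpen {x | ψ x = 1}) (hne : ∃ x, ψ x ≠ 1) (n L : ℕ) :
    ∃ (β : ℚ_[p]) (ζ : ℂ_[p]), IsPrimitiveRoot ζ (p ^ L) ∧ ∀ x : ℚ_[p], ‖x‖ ≤ p ^ n →
      ∃ b : ℕ, ψ (β * x) = ζ ^ b ∧ ∀ M ≤ L, (p ^ M ∣ b ↔ ‖x‖ ≤ p ^ n * ((p : ℝ) ^ M)⁻¹) := by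
  have hp : p.Prime := Fact.out
  have hp0 : (0 : ℝ) < p := by exact_mod_cast hp.pos
  have hpQ : (p : ℚ_[p]) ≠ 0 := by exact_mod_cast hp.ne_zero
  obtain ⟨z, hz, hz1⟩ := exists_conductor hψ hne
  have hcast : ∀ (x : ℚ_[p]) (k : ℕ), ψ (k * x) = ψ x ^ k := fun x k => by
    rw [← nsmul_eq_mul, AddChar.map_nsmul_eq_pow]
  -- The order is exactly p^L: for L > 0 the power of exponent p^(L-1) is ψ z ≠ 1. On the ball of
  -- radius p^n, the exponent b below is an integer approximating p^n x modulo p^L.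
  set ζ := ψ (p * z / p ^ L) with hζ
  have hζpow : ∀ y : ℚ_[p], ‖y‖ ≤ 1 → ψ (p ^ L * (p * z / p ^ L) * y) = 1 := fun y hy => by
    rw [mul_div_cancel₀ _ (pow_ne_zero L hpQ)]
    exact hz1 y hy
  have hprim : IsPrimitiveRoot ζ (p ^ L) := by
    have h1 : ζ ^ p ^ L = 1 := by
      rw [hζ, ← hcast, ← hζpow 1 (by simp)]
      push_cast
      rw [mul_one]
    cases L with
    | zero => rwa [pow_zero, IsPrimitiveRoot.one_right_iff, ← pow_one ζ, ← pow_zero p]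
    | succ l =>
      refine IsPrimitiveRoot.iff_orderOf.mpr (orderOf_eq_prime_pow (fun h2 => hz ?_) h1)
      rw [hζ, ← hcast] at h2
      rw [← h2]
      congr 1
      push_cast
      field_simp
      ring
  refine ⟨p * z / p ^ L * p ^ n, ζ, hprim, fun x hx => ?_⟩
  have hy : ‖(p : ℚ_[p]) ^ n * x‖ ≤ 1 := by
    rw [norm_mul, Padic.norm_p_pow, _root_.zpow_neg, zpow_natCast, inv_mul_le_iff₀ (by positivity),
      mul_one]
    exact hx
  obtain ⟨b, w, hw, hbw⟩ := exists_nat_close hy L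
  refine ⟨b, ?_, fun M hM => ?_⟩
  · rw [mul_assoc, hbw, mul_add, AddChar.map_add_eq_mul, mul_comm _ (b : ℚ_[p]), hcast, ← hζ,
      mul_comm (p * z / p ^ L : ℚ_[p]), mul_right_comm, hζpow w hw, mul_one]
  · have h1 : ‖x‖ ≤ p ^ n * ((p : ℝ) ^ M)⁻¹ ↔ ‖(p : ℚ_[p]) ^ n * x‖ ≤ ((p : ℝ) ^ M)⁻¹ := by
      rw [norm_mul, Padic.norm_p_pow, _root_.zpow_neg, zpow_natCast, inv_mul_le_iff₀ (by positivity)]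
    have h2 := Padic.norm_int_le_pow_iff_dvd (p := p) b M
    rw [_root_.zpow_neg, zpow_natCast] at h2
    have h3 : ((p ^ M : ℕ) : ℤ) ∣ b ↔ p ^ M ∣ b := Int.natCast_dvd_natCast
    push_cast at h2 h3
    rw [h1, ← h3, ← h2]
    have h4 : ‖(p : ℚ_[p]) ^ L * w‖ ≤ ((p : ℝ) ^ M)⁻¹ := by
      rw [norm_mul, Padic.norm_p_pow, _root_.zpow_neg, zpow_natCast]
      refine (mul_le_of_le_one_right (by positivity) hw).trans ?_
      exact inv_anti₀ (by positivity)
        (pow_le_pow_right₀ (by exact_mod_cast hp.one_le) hM)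
    constructor
    · intro h
      rw [hbw]
      exact (IsUltrametricDist.norm_add_le_max _ _).trans (max_le h h4)
    · intro h
      have h5 : (b : ℚ_[p]) = (p : ℚ_[p]) ^ n * x + -((p : ℚ_[p]) ^ L * w) := by rw [hbw]; ring
      rw [h5]
      exact (IsUltrametricDist.norm_add_le_max _ _).trans (max_le h (by rwa [norm_neg]))

end Character

/-! ### Schwartz functions and multiplication operators from the group algebra. -/

section Schwartz

variable {p : ℕ} [Fact p.Prime] {d : ℕ}

lemma norm_le_supNorm (f : schwartz p d) (x : Fin d → ℚ_[p]) : ‖f.1 x‖ ≤ supNorm f :=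
  le_ciSup (bddAbove_norm f) x

lemma supNorm_le {f : schwartz p d} {B : ℝ} (h : ∀ x, ‖f.1 x‖ ≤ B) : supNorm f ≤ B :=
  ciSup_le h

/-- Multiplication by a locally constant function. -/
def mulLC (a : (Fin d → ℚ_[p]) → ℂ_[p]) (ha : IsLocallyConstant a) :
    schwartz p d →ₗ[ℂ_[p]] schwartz p d where
  toFun f := ⟨fun x => a x * f.1 x, ha.mul f.2.1, f.2.2.mul_left⟩
  map_add' f g := by ext x; exact mul_add _ _ _
  map_smul' c f := by ext x; exact mul_left_comm _ _ _

/-- The indicator function of a closed ball. -/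
def ballInd (y : Fin d → ℚ_[p]) (r : ℝ) : (Fin d → ℚ_[p]) → ℂ_[p] :=
  Set.indicator (Metric.closedBall y r) 1

lemma ballInd_of_mem {x y : Fin d → ℚ_[p]} {r : ℝ} (h : dist x y ≤ r) : ballInd y r x = 1 :=
  Set.indicator_of_mem (Metric.mem_closedBall.mpr h) _

lemma ballInd_of_notMem {x y : Fin d → ℚ_[p]} {r : ℝ} (h : ¬ dist x y ≤ r) :
    ballInd y r x = 0 :=
  Set.indicator_of_notMem (fun h' => h (Metric.mem_closedBall.mp h')) _

lemma isLocallyConstant_ballInd (y : Fin d → ℚ_[p]) {r : ℝ} (hr : 0 < r) :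
    IsLocallyConstant (ballInd y r) := by
  have hcl : IsClopen (Metric.closedBall y r) :=
    IsUltrametricDist.isClopen_closedBall _ hr.ne'
  rw [ballInd, ← LocallyConstant.coe_charFn ℂ_[p] hcl]
  exact LocallyConstant.isLocallyConstant _

/-- The indicator function of a closed ball, as an element of `schwartz p d`. -/
def ballS (y : Fin d → ℚ_[p]) {r : ℝ} (hr : 0 < r) : schwartz p d :=
  ⟨ballInd y r, isLocallyConstant_ballInd y hr,
    HasCompactSupport.intro (isCompact_closedBall y r)
      (fun _ hx => Set.indicator_of_notMem hx _)⟩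

lemma inv_pow_pos (p : ℕ) [Fact p.Prime] (k : ℕ) : (0 : ℝ) < ((p : ℝ) ^ k)⁻¹ := by
  have hp : p.Prime := Fact.out
  have hp0 : (0 : ℝ) < p := by exact_mod_cast hp.pos
  positivity

lemma tendsto_inv_pow (p : ℕ) [Fact p.Prime] :
    Filter.Tendsto (fun k : ℕ => ((p : ℝ) ^ k)⁻¹) Filter.atTop (nhds 0) := by
  have hp : p.Prime := Fact.out
  simp only [← inv_pow]
  exact tendsto_pow_atTop_nhds_zero_of_lt_one (by positivity)
    (inv_lt_one_of_one_lt₀ (by exact_mod_cast hp.one_lt))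

lemma exists_inv_pow_le {δ : ℝ} (hδ : 0 < δ) : ∃ k₀, ∀ k ≥ k₀, ((p : ℝ) ^ k)⁻¹ ≤ δ :=
  Filter.eventually_atTop.mp ((tendsto_inv_pow p).eventually (ge_mem_nhds hδ))

lemma exists_forall_eq_of_dist_le {a : (Fin d → ℚ_[p]) → ℂ_[p]} (ha : IsLocallyConstant a)
    {K : Set (Fin d → ℚ_[p])} (hK : IsCompact K) :
    ∃ k₀, ∀ k ≥ k₀, ∀ x ∈ K, ∀ y, dist y x ≤ ((p : ℝ) ^ k)⁻¹ → a y = a x := by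
  obtain ⟨δ, hδ, h⟩ := lebesgue_number_lemma_of_metric (c := fun z : ℂ_[p] => a ⁻¹' {z}) hK
    (fun z => ha {z}) (fun x _ => Set.mem_iUnion.mpr ⟨a x, rfl⟩)
  obtain ⟨k₀, hk₀⟩ := exists_inv_pow_le (p := p) (half_pos hδ)
  refine ⟨k₀, fun k hk x hx y hy => ?_⟩
  obtain ⟨z, hz⟩ := h x hx
  have h1 : a y = z := hz (Metric.mem_ball.mpr (by have := hk₀ k hk; linarith))
  have h2 : a x = z := hz (Metric.mem_ball_self hδ)
  rw [h1, h2]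

lemma exists_partition {K : Set (Fin d → ℚ_[p])} (hK : IsCompact K) {r : ℝ} (hr : 0 < r) :
    ∃ t : Finset (Fin d → ℚ_[p]), ∀ x ∈ K, ∃ y ∈ t, dist x y ≤ r ∧
      ∀ y' ∈ t, dist x y' ≤ r → y' = y := by
  classical
  -- The representative is chosen from the ball as a set, and ultrametric balls of equal radius that
  -- meet coincide, so it depends only on the ball.
  let rep : (Fin d → ℚ_[p]) → (Fin d → ℚ_[p]) := fun x =>
    Classical.epsilon fun y => y ∈ Metric.closedBall x r
  have hrep : ∀ x, dist (rep x) x ≤ r := fun x =>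
    Classical.epsilon_spec (p := fun y => y ∈ Metric.closedBall x r)
      ⟨x, Metric.mem_closedBall_self hr.le⟩
  have hrep2 : ∀ x y, dist x y ≤ r → rep x = rep y := fun x y hxy => by
    have : Metric.closedBall x r = Metric.closedBall y r :=
      IsUltrametricDist.closedBall_eq_of_mem (Metric.mem_closedBall.mpr (by rwa [dist_comm]))
    simp only [rep, this]
  obtain ⟨s, -, hs, hKs⟩ := hK.finite_cover_balls hr
  refine ⟨hs.toFinset.image rep, fun x hx => ?_⟩
  obtain ⟨z, hz, hxz⟩ := Set.mem_iUnion₂.mp (hKs hx)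
  refine ⟨rep x, ?_, by rw [dist_comm]; exact hrep x, fun y' hy' hxy' => ?_⟩
  · rw [hrep2 x z (Metric.mem_ball.mp hxz).le]
    exact Finset.mem_image_of_mem _ (hs.mem_toFinset.mpr hz)
  · obtain ⟨w, -, rfl⟩ := Finset.mem_image.mp hy'
    refine (hrep2 _ _ ?_).symm
    exact (dist_triangle_max x (rep w) w).trans (max_le hxy' (hrep w))

/-- The product of a locally constant function and of a Schwartz function `f` is a linear
combination of restrictions of `f` to small balls. -/
lemma exists_mulLC_eq_sum {a : (Fin d → ℚ_[p]) → ℂ_[p]} (ha : IsLocallyConstant a)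
    (f : schwartz p d) (k₀ : ℕ) :
    ∃ k ≥ k₀, ∃ (t : Finset (Fin d → ℚ_[p])) (c : (Fin d → ℚ_[p]) → ℂ_[p]),
      mulLC a ha f = ∑ y ∈ t, c y •
        mulLC (ballInd y ((p : ℝ) ^ k)⁻¹) (isLocallyConstant_ballInd y (inv_pow_pos p k)) f ∧
      ∀ B : ℝ, 0 ≤ B → (∀ x, f.1 x ≠ 0 → ‖a x‖ ≤ B) → ∀ y, ‖c y‖ ≤ B := by
  classical
  obtain ⟨k₁, hk₁⟩ := exists_forall_eq_of_dist_le ha f.2.2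
  set k := max k₀ k₁
  set r : ℝ := ((p : ℝ) ^ k)⁻¹ with hr
  have hr0 : 0 < r := inv_pow_pos p k
  obtain ⟨t, ht⟩ := exists_partition (d := d) f.2.2 hr0
  -- Sampling a at a point where f is non-zero lets a bound for a on the support of f pass to the
  -- coefficients.
  let c : (Fin d → ℚ_[p]) → ℂ_[p] := fun y =>
    if h : ∃ x, dist x y ≤ r ∧ f.1 x ≠ 0 then a h.choose else 0
  refine ⟨k, le_max_left _ _, t, c, ?_, fun B hB h y => ?_⟩
  · ext x
    have hsum : (∑ y ∈ t, c y • mulLC (ballInd y r) (isLocallyConstant_ballInd y hr0) f).1 x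
        = ∑ y ∈ t, c y * (ballInd y r x * f.1 x) := by
      rw [AddSubmonoidClass.coe_finsetSum, Finset.sum_apply]
      rfl
    refine Eq.trans ?_ hsum.symm
    change a x * f.1 x = _
    by_cases hfx : f.1 x = 0
    · simp [hfx]
    have hxK : x ∈ tsupport f.1 := subset_tsupport _ hfx
    obtain ⟨y, hy, hxy, huniq⟩ := ht x hxK
    rw [Finset.sum_eq_single_of_mem y hy fun y' hy' hne => ?_]
    · have hex : ∃ x, dist x y ≤ r ∧ f.1 x ≠ 0 := ⟨x, hxy, hfx⟩
      have hc : c y = a x := by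
        simp only [c, dif_pos hex]
        refine hk₁ k (le_max_right _ _) x hxK _ ?_
        refine (dist_triangle_max _ y x).trans (max_le hex.choose_spec.1 ?_)
        rwa [dist_comm]
      rw [hc, ballInd_of_mem hxy, one_mul]
    · rw [ballInd_of_notMem fun h => hne (huniq y' hy' h), zero_mul, mul_zero]
  · simp only [c]
    split_ifs with hex
    · exact h _ hex.choose_spec.2
    · simpa

variable {ψ : AddChar ℚ_[p] ℂ_[p]} {hψ : IsOpen {x | ψ x = 1}}

lemma schrodinger_apply (h : Heisenberg p d) (f : schwartz p d) (x : Fin d → ℚ_[p]) :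
    (schrodinger ψ hψ h f).1 x =
      ψ (h.t + (1 / 2) * ((h.w ∘ Sum.inl) ⬝ᵥ (h.w ∘ Sum.inr)) + (h.w ∘ Sum.inr) ⬝ᵥ x) *
        f.1 (x + h.w ∘ Sum.inl) := rfl

/-- The element of the Heisenberg group which acts as the multiplication by
`ψ (β (x i - y))`. -/
def modulation (i : Fin d) (β y : ℚ_[p]) : Heisenberg p d :=
  ⟨Sum.elim 0 (Pi.single i β), -(β * y)⟩

lemma schrodinger_modulation (i : Fin d) (β y : ℚ_[p]) (f : schwartz p d) (x : Fin d → ℚ_[p]) :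
    (schrodinger ψ hψ (modulation i β y) f).1 x = ψ (β * (x i - y)) * f.1 x := by
  rw [schrodinger_apply]
  simp only [modulation, Sum.elim_comp_inl, Sum.elim_comp_inr, zero_dotProduct, mul_zero,
    add_zero, single_dotProduct]
  congr 2
  ring

/-- The element of the Heisenberg group which acts as the translation by `a`. -/
def translation (a : Fin d → ℚ_[p]) : Heisenberg p d := ⟨Sum.elim a 0, 0⟩

lemma schrodinger_translation (a : Fin d → ℚ_[p]) (f : schwartz p d) (x : Fin d → ℚ_[p]) :
    (schrodinger ψ hψ (translation a) f).1 x = f.1 (x + a) := by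
  rw [schrodinger_apply]
  simp [translation]

lemma schrodinger_translation_ballS (a y : Fin d → ℚ_[p]) {r : ℝ} (hr : 0 < r) :
    schrodinger ψ hψ (translation a) (ballS (y + a) hr) = ballS y hr := by
  ext x
  refine (schrodinger_translation _ _ _).trans ?_
  change ballInd _ _ _ = ballInd _ _ _
  by_cases h : dist x y ≤ r
  · rw [ballInd_of_mem h, ballInd_of_mem (by rwa [dist_add_right])]
  · rw [ballInd_of_notMem h, ballInd_of_notMem (by rwa [dist_add_right])]

lemma aeval_modulation_apply (i : Fin d) (β y : ℚ_[p]) (E : Polynomial ℂ_[p]) (f : schwartz p d)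
    (x : Fin d → ℚ_[p]) :
    (Polynomial.aeval (schrodinger ψ hψ (modulation i β y)) E f).1 x =
      E.eval (ψ (β * (x i - y))) * f.1 x := by
  have hpow : ∀ n : ℕ, ((schrodinger ψ hψ (modulation i β y) ^ n) f).1 x =
      ψ (β * (x i - y)) ^ n * f.1 x := by
    intro n
    induction n with
    | zero => simp
    | succ n ih =>
      rw [pow_succ', Module.End.mul_apply, schrodinger_modulation, ih]; ring
  induction E using Polynomial.induction_on' with
  | add E F hE hF =>
    rw [map_add, LinearMap.add_apply, Polynomial.eval_add, add_mul, ← hE, ← hF]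
    rfl
  | monomial n c =>
    rw [Polynomial.aeval_monomial, Polynomial.eval_monomial, mul_assoc, ← hpow n]
    rfl

lemma aeval_le {q : Seminorm ℂ_[p] (schwartz p d)} (hq : IsUltra q)
    (hi : IsInvSeminorm (schrodinger ψ hψ) q) (h : Heisenberg p d) {E : Polynomial ℂ_[p]} {R : ℝ}
    (hR : 0 ≤ R) (hE : ∀ j, ‖E.coeff j‖ ≤ R) (f : schwartz p d) :
    q (Polynomial.aeval (schrodinger ψ hψ h) E f) ≤ R * q f := by
  rw [Polynomial.aeval_eq_sum_range, LinearMap.sum_apply]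
  refine hq.sum_le (mul_nonneg hR (apply_nonneg _ _)) fun j _ => ?_
  rw [LinearMap.smul_apply, map_smul_eq_mul, ← map_pow, hi]
  exact mul_le_mul_of_nonneg_right (hE j) (apply_nonneg _ _)

lemma aeval_mem {W : Submodule ℂ_[p] (schwartz p d)}
    (hW : ∀ h, ∀ f ∈ W, schrodinger ψ hψ h f ∈ W) (h : Heisenberg p d) (E : Polynomial ℂ_[p])
    {f : schwartz p d} (hf : f ∈ W) : Polynomial.aeval (schrodinger ψ hψ h) E f ∈ W := by
  rw [Polynomial.aeval_eq_sum_range, LinearMap.sum_apply]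
  refine W.sum_mem fun j _ => ?_
  rw [LinearMap.smul_apply, ← map_pow]
  exact W.smul_mem _ (hW _ _ hf)

open Classical in
/-- If a polynomial in a dilation of `ψ` approximates the indicator function of a ball of `ℚ_[p]`,
then an operator of the group algebra approximates the multiplication by the indicator function of
a cube. -/
lemma exists_cube_operator {n k : ℕ} {ε R : ℝ} {β : ℚ_[p]} {E : Polynomial ℂ_[p]}
    (hE : ∀ x : ℚ_[p], ‖x‖ ≤ p ^ n →
      ‖E.eval (ψ (β * x)) - if ‖x‖ ≤ ((p : ℝ) ^ k)⁻¹ then 1 else 0‖ ≤ ε)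
    (hε : 0 ≤ ε) (hε1 : ε ≤ 1) (hR : 0 ≤ R) (hER : ∀ j, ‖E.coeff j‖ ≤ R) (y : Fin d → ℚ_[p])
    (s : Finset (Fin d)) :
    ∃ (A : schwartz p d →ₗ[ℂ_[p]] schwartz p d) (a : (Fin d → ℚ_[p]) → ℂ_[p])
      (ha : IsLocallyConstant a), A = mulLC a ha ∧
      (∀ q, IsUltra q → IsInvSeminorm (schrodinger ψ hψ) q → ∀ f, q (A f) ≤ R ^ s.card * q f) ∧
      (∀ W : Submodule ℂ_[p] (schwartz p d), (∀ h, ∀ f ∈ W, schrodinger ψ hψ h f ∈ W) →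
        ∀ f ∈ W, A f ∈ W) ∧
      ∀ x, (∀ i, ‖x i - y i‖ ≤ p ^ n) →
        ‖a x - if ∀ i ∈ s, ‖x i - y i‖ ≤ ((p : ℝ) ^ k)⁻¹ then 1 else 0‖ ≤ ε := by
  induction s using Finset.induction_on with
  | empty =>
    refine ⟨LinearMap.id, fun _ => 1, IsLocallyConstant.const 1, ?_, fun q _ _ f => by simp,
      fun W _ f hf => hf, fun x _ => by simpa⟩
    ext f x
    exact (one_mul _).symm
  | insert i s his ih =>
    obtain ⟨A, a, ha, hA, hAq, hAW, hAa⟩ := ih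
    have hlc : IsLocallyConstant fun x : Fin d → ℚ_[p] => E.eval (ψ (β * (x i - y i))) := by
      have h1 : IsLocallyConstant fun x : Fin d → ℚ_[p] => ψ (β * (x i - y i)) :=
        (isLocallyConstant_addChar hψ).comp_continuous
          (f := fun x : Fin d → ℚ_[p] => β * (x i - y i)) (by fun_prop)
      exact h1.comp fun z => E.eval z
    refine ⟨Polynomial.aeval (schrodinger ψ hψ (modulation i β (y i))) E ∘ₗ A,
      _, hlc.mul ha, ?_, fun q hq hi f => ?_, fun W hW f hf => ?_, fun x hx => ?_⟩
    · ext f x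
      rw [LinearMap.comp_apply, hA]
      refine (aeval_modulation_apply _ _ _ _ _ _).trans ?_
      exact (mul_assoc _ _ _).symm
    · rw [LinearMap.comp_apply, Finset.card_insert_of_notMem his, pow_succ', mul_assoc]
      exact (aeval_le hq hi _ hR hER _).trans (mul_le_mul_of_nonneg_left (hAq q hq hi f) hR)
    · exact aeval_mem hW _ _ (hAW W hW f hf)
    · have h1 := hE (x i - y i) (hx i)
      have h2 := hAa x hx
      change ‖E.eval (ψ (β * (x i - y i))) * a x - _‖ ≤ ε
      set u := E.eval (ψ (β * (x i - y i)))
      -- Since ε ≤ 1, multiplying the approximations coordinate by coordinate does not increase the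
      -- error; only the operator bound grows, by a factor R for each coordinate.
      have key : ∀ b c : ℂ_[p], ‖u - b‖ ≤ ε → ‖a x - c‖ ≤ ε → ‖b‖ ≤ 1 → ‖c‖ ≤ 1 →
          ‖u * a x - b * c‖ ≤ ε := fun b c hb hc hb1 hc1 => by
        have e1 : u * a x - b * c = (u - b) * (a x - c) + ((u - b) * c + b * (a x - c)) := by ring
        rw [e1]
        refine (IsUltrametricDist.norm_add_le_max _ _).trans (max_le ?_
          ((IsUltrametricDist.norm_add_le_max _ _).trans (max_le ?_ ?_))) <;> rw [norm_mul]
        · exact (mul_le_of_le_one_right (norm_nonneg _) (hc.trans hε1)).trans hb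
        · exact (mul_le_of_le_one_right (norm_nonneg _) hc1).trans hb
        · exact (mul_le_of_le_one_left (norm_nonneg _) hb1).trans hc
      have h3 := key _ _ h1 h2 (by split_ifs <;> simp) (by split_ifs <;> simp)
      convert h3 using 3
      simp only [Finset.forall_mem_insert]
      split_ifs <;> simp_all

end Schwartz

/-! ### Rigidity, irreducibility and the rigid vector for the sup norm. -/

section SupNorm

variable {p : ℕ} [Fact p.Prime] {d : ℕ} {ψ : AddChar ℚ_[p] ℂ_[p]} {hψ : IsOpen {x | ψ x = 1}}

lemma dist_le_iff_norm_sub_le {x y : Fin d → ℚ_[p]} {r : ℝ} (hr : 0 ≤ r) :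
    dist x y ≤ r ↔ ∀ i, ‖x i - y i‖ ≤ r := by
  rw [dist_pi_le_iff hr]
  simp only [dist_eq_norm]

lemma exists_dist_le_of_hasCompactSupport (f : schwartz p d) (y : Fin d → ℚ_[p]) :
    ∃ n : ℕ, ∀ x, f.1 x ≠ 0 → dist x y ≤ p ^ n := by
  have hp : p.Prime := Fact.out
  obtain ⟨r, hr⟩ := f.2.2.isBounded.subset_closedBall y
  obtain ⟨n, hn⟩ := pow_unbounded_of_one_lt r (show (1 : ℝ) < p by exact_mod_cast hp.one_lt)
  exact ⟨n, fun x hx => (Metric.mem_closedBall.mp (hr (subset_tsupport _ hx))).trans hn.le⟩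

/-- An element of the group algebra, of norm at most `p ^ d`, approximates on a given ball the
multiplication by the indicator function of a small ball. -/
lemma exists_approx_ballInd (hne : ∃ x, ψ x ≠ 1) (n k : ℕ) (y : Fin d → ℚ_[p]) :
    ∃ (a : (Fin d → ℚ_[p]) → ℂ_[p]) (ha : IsLocallyConstant a),
      (∀ q, IsUltra q → IsInvSeminorm (schrodinger ψ hψ) q →
        ∀ f, q (mulLC a ha f) ≤ p ^ d * q f) ∧
      ∀ x, dist x y ≤ p ^ n → ‖a x - ballInd y ((p : ℝ) ^ k)⁻¹ x‖ ≤ approxError p := by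
  classical
  have hp0 : (0 : ℝ) < p := by exact_mod_cast (Fact.out : p.Prime).pos
  obtain ⟨L, hL, h⟩ := exists_polynomial_approx (p := p) (n + k)
  obtain ⟨β, ζ, hζ, hβ⟩ := exists_dilation hψ hne n L
  obtain ⟨E, hE, hE'⟩ := h ζ hζ
  have key : ∀ x : ℚ_[p], ‖x‖ ≤ p ^ n →
      ‖E.eval (ψ (β * x)) - if ‖x‖ ≤ ((p : ℝ) ^ k)⁻¹ then 1 else 0‖ ≤ approxError p := by
    intro x hx
    obtain ⟨b, hb, hb'⟩ := hβ x hx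
    have h1 := hb' _ hL
    have h2 : (p : ℝ) ^ n * ((p : ℝ) ^ (n + k))⁻¹ = ((p : ℝ) ^ k)⁻¹ := by
      rw [pow_add]; field_simp
    rw [h2] at h1
    rw [hb, ← if_congr h1 rfl rfl]
    exact hE' b
  obtain ⟨A, a, ha, rfl, hAq, -, hAa⟩ := exists_cube_operator (hψ := hψ) key approxError_nonneg
    approxError_lt_one.le hp0.le hE y Finset.univ
  refine ⟨a, ha, fun q hq hi f => ?_, fun x hx => ?_⟩
  · simpa using hAq q hq hi f
  · have h3 := hAa x ((dist_le_iff_norm_sub_le (by positivity)).mp hx)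
    simp only [Finset.mem_univ, true_imp_iff,
      ← dist_le_iff_norm_sub_le (inv_pow_pos p k).le] at h3
    convert h3 using 3
    split_ifs with h4
    · exact ballInd_of_mem h4
    · exact ballInd_of_notMem h4

/-- An element of the group algebra agrees on a given ball with the multiplication by the
indicator function of a small ball. -/
lemma exists_exact_ballInd (hne : ∃ x, ψ x ≠ 1) (n k : ℕ) (y : Fin d → ℚ_[p]) :
    ∃ (a : (Fin d → ℚ_[p]) → ℂ_[p]) (ha : IsLocallyConstant a),
      (∀ W : Submodule ℂ_[p] (schwartz p d), (∀ h, ∀ f ∈ W, schrodinger ψ hψ h f ∈ W) →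
        ∀ f ∈ W, mulLC a ha f ∈ W) ∧
      ∀ x, dist x y ≤ p ^ n → a x = ballInd y ((p : ℝ) ^ k)⁻¹ x := by
  classical
  have hp : p.Prime := Fact.out
  have hp0 : (0 : ℝ) < p := by exact_mod_cast hp.pos
  obtain ⟨β, ζ, hζ, hβ⟩ := exists_dilation hψ hne n (n + k)
  obtain ⟨E, hE, hE'⟩ := exists_polynomial_exact (p := p) (pow_ne_zero (n + k) hp.ne_zero)
  have key : ∀ x : ℚ_[p], ‖x‖ ≤ p ^ n →
      ‖E.eval (ψ (β * x)) - if ‖x‖ ≤ ((p : ℝ) ^ k)⁻¹ then 1 else 0‖ ≤ 0 := by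
    intro x hx
    obtain ⟨b, hb, hb'⟩ := hβ x hx
    have h1 := hb' _ le_rfl
    have h2 : (p : ℝ) ^ n * ((p : ℝ) ^ (n + k))⁻¹ = ((p : ℝ) ^ k)⁻¹ := by
      rw [pow_add]; field_simp
    rw [h2, ← hζ.pow_eq_one_iff_dvd] at h1
    rw [hb, ← if_congr h1 rfl rfl, norm_le_zero_iff, sub_eq_zero]
    split_ifs with h3
    · rw [h3, hE]
    · exact hE' _ (by rw [← pow_mul, mul_comm, pow_mul, hζ.pow_eq_one, one_pow]) h3
  obtain ⟨A, a, ha, rfl, -, hAW, hAa⟩ := exists_cube_operator (hψ := hψ) key le_rfl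
    zero_le_one (Finset.sum_nonneg fun j _ => norm_nonneg (E.coeff j)) (s := Finset.univ)
    (fun j => by
      by_cases hj : j ∈ E.support
      · exact Finset.single_le_sum (f := fun j => ‖E.coeff j‖) (fun _ _ => norm_nonneg _) hj
      · rw [Polynomial.notMem_support_iff.mp hj, norm_zero]
        exact Finset.sum_nonneg fun j _ => norm_nonneg _) y
  refine ⟨a, ha, hAW, fun x hx => ?_⟩
  have h3 := hAa x ((dist_le_iff_norm_sub_le (by positivity)).mp hx)
  simp only [Finset.mem_univ, true_imp_iff,
    ← dist_le_iff_norm_sub_le (inv_pow_pos p k).le, norm_le_zero_iff, sub_eq_zero] at h3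
  rw [h3]
  split_ifs with h4
  · exact (ballInd_of_mem h4).symm
  · exact (ballInd_of_notMem h4).symm

/-- A Schwartz function is a linear combination of indicator functions of small balls. -/
lemma exists_eq_sum_ballS (v : schwartz p d) (k₀ : ℕ) :
    ∃ k ≥ k₀, ∃ (t : Finset (Fin d → ℚ_[p])) (c : (Fin d → ℚ_[p]) → ℂ_[p]),
      v = ∑ y ∈ t, c y • ballS y (inv_pow_pos p k) ∧ ∀ y, ‖c y‖ ≤ supNorm v := by
  classical
  have hp : p.Prime := Fact.out
  have hp1 : (1 : ℝ) ≤ p := by exact_mod_cast hp.one_le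
  obtain ⟨m, hm⟩ := exists_dist_le_of_hasCompactSupport v 0
  have hm0 : (0 : ℝ) < p ^ m := by positivity
  have hv : v = mulLC v.1 v.2.1 (ballS 0 hm0) := by
    ext x
    change v.1 x = v.1 x * ballInd _ _ x
    by_cases hx : v.1 x = 0
    · rw [hx, zero_mul]
    · rw [ballInd_of_mem (hm x hx), mul_one]
  obtain ⟨k, hk, t, c, h, hc⟩ := exists_mulLC_eq_sum v.2.1 (ballS 0 hm0) k₀
  have hkm : ((p : ℝ) ^ k)⁻¹ ≤ p ^ m :=
    (inv_le_one_of_one_le₀ (one_le_pow₀ hp1)).trans (one_le_pow₀ hp1)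
  refine ⟨k, hk, t, fun y => if dist y 0 ≤ (p : ℝ) ^ m then c y else 0, ?_, fun y => ?_⟩
  · conv_lhs => rw [hv, h]
    refine Finset.sum_congr rfl fun y _ => ?_
    ext x
    change c y * (ballInd y _ x * ballInd _ _ x) = (ite _ _ _) * ballInd y _ x
    by_cases hxy : dist x y ≤ ((p : ℝ) ^ k)⁻¹
    · rw [ballInd_of_mem hxy]
      have hiff : dist x 0 ≤ (p : ℝ) ^ m ↔ dist y 0 ≤ (p : ℝ) ^ m :=
        ⟨fun h => (dist_triangle_max y x 0).trans (max_le (by rw [dist_comm]; exact hxy.trans hkm) h),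
          fun h => (dist_triangle_max x y 0).trans (max_le (hxy.trans hkm) h)⟩
      split_ifs with h0
      · rw [ballInd_of_mem (hiff.mpr h0), one_mul]
      · rw [ballInd_of_notMem (mt hiff.mp h0)]; ring
    · rw [ballInd_of_notMem hxy]; ring
  · dsimp only
    split_ifs
    · exact hc _ (apply_nonneg _ _) (fun x _ => norm_le_supNorm v x) y
    · rw [norm_zero]; exact apply_nonneg _ _

lemma mulLC_ballInd_eq_smul {f : schwartz p d} {x : Fin d → ℚ_[p]} {r : ℝ} (hr : 0 < r)
    (h : ∀ y, dist y x ≤ r → f.1 y = f.1 x) :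
    mulLC (ballInd x r) (isLocallyConstant_ballInd x hr) f = f.1 x • ballS x hr := by
  ext y
  change ballInd x r y * f.1 y = f.1 x * ballInd x r y
  by_cases hy : dist y x ≤ r
  · rw [h y hy, mul_comm]
  · rw [ballInd_of_notMem hy]; ring

lemma ballS_eq_schrodinger (x y : Fin d → ℚ_[p]) {r : ℝ} (hr : 0 < r) :
    ballS y hr = schrodinger ψ hψ (translation (x - y)) (ballS x hr) := by
  rw [← schrodinger_translation_ballS (hψ := hψ) (x - y) y hr]
  congr 2
  abel

/-- Restricting f to small balls costs at most a factor p^d for q, by bootstrapping the approximate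
restriction operators. Restrictions to small enough balls are multiples of indicator functions,
whose translates also make up v. -/
theorem isRigid_supNorm (hne : ∃ x, ψ x ≠ 1) :
    IsRigid (schrodinger ψ hψ) (supNorm (p := p) (d := d)).toSeminorm := by
  have hp0 : (0 : ℝ) < p := by exact_mod_cast (Fact.out : p.Prime).pos
  refine ⟨p ^ d, by positivity, fun q hq hi ⟨D, hD, hqD⟩ v f => ?_⟩
  -- Domination by the sup norm serves only to make the supremum of B finite, so D does not enter
  -- the final constant.
  let B : (Fin d → ℚ_[p]) × ℕ → ℝ := fun z => q (mulLC (ballInd z.1 ((p : ℝ) ^ z.2)⁻¹)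
    (isLocallyConstant_ballInd z.1 (inv_pow_pos p z.2)) f)
  have hB : BddAbove (Set.range B) := by
    refine ⟨D * supNorm f, ?_⟩
    rintro _ ⟨z, rfl⟩
    refine (hqD _).trans (mul_le_mul_of_nonneg_left (supNorm_le fun x => ?_) hD.le)
    change ‖ballInd _ _ x * f.1 x‖ ≤ _
    by_cases hx : dist x z.1 ≤ ((p : ℝ) ^ z.2)⁻¹
    · rw [ballInd_of_mem hx, one_mul]; exact norm_le_supNorm f x
    · rw [ballInd_of_notMem hx, zero_mul, norm_zero]; exact apply_nonneg _ _
  have hC0 : 0 ≤ ⨆ z, B z := Real.iSup_nonneg fun z => apply_nonneg _ _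
  have h1 : ∀ z, B z ≤ max (p ^ d * q f) (approxError p * ⨆ z, B z) := by
    rintro ⟨y, k⟩
    obtain ⟨n, hn⟩ := exists_dist_le_of_hasCompactSupport f y
    obtain ⟨a, ha, haq, hab⟩ := exists_approx_ballInd (hψ := hψ) hne n k y
    have hsub : IsLocallyConstant (ballInd y ((p : ℝ) ^ k)⁻¹ - a) :=
      (isLocallyConstant_ballInd y (inv_pow_pos p k)).sub ha
    obtain ⟨k', -, t, c, h, hc⟩ := exists_mulLC_eq_sum hsub f 0
    have h2 := hc _ approxError_nonneg (fun x hx => by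
      rw [Pi.sub_apply, norm_sub_rev]; exact hab x (hn x hx))
    have h3 : mulLC (ballInd y ((p : ℝ) ^ k)⁻¹) (isLocallyConstant_ballInd y (inv_pow_pos p k)) f
        = mulLC a ha f + mulLC _ hsub f := by
      ext x
      change _ * _ = a x * f.1 x + (_ - a x) * f.1 x
      ring
    change q _ ≤ _
    rw [h3]
    refine (hq _ _).trans (max_le_max (haq q hq hi f) ?_)
    rw [h]
    refine hq.sum_le (mul_nonneg approxError_nonneg hC0) fun y' _ => ?_
    rw [map_smul_eq_mul]
    exact mul_le_mul (h2 y') (le_ciSup hB (y', k')) (apply_nonneg _ _) approxError_nonneg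
  -- The error of the approximate restriction is a combination of restrictions of f with
  -- coefficients at most `approxError`, which is less than 1, so that term cannot realize the
  -- supremum.
  have h2 : ⨆ z, B z ≤ p ^ d * q f := by
    rcases le_max_iff.mp (ciSup_le h1) with h | h
    · exact h
    · have : ⨆ z, B z ≤ 0 := by nlinarith [approxError_lt_one (p := p)]
      exact this.trans (by positivity)
  -- At one common scale, v is a combination of translates of a ball with coefficients at most its
  -- sup norm, and f is constant on the ball around x.
  have h3 : ∀ x, q v * ‖f.1 x‖ ≤ supNorm v * ⨆ z, B z := by
    intro x
    obtain ⟨k₀, hk₀⟩ := exists_forall_eq_of_dist_le f.2.1 (isCompact_singleton (x := x))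
    obtain ⟨k, hk, t, c, h, hc⟩ := exists_eq_sum_ballS v k₀
    have h4 : q v ≤ supNorm v * q (ballS x (inv_pow_pos p k)) := by
      conv_lhs => rw [h]
      refine hq.sum_le (by positivity) fun y _ => ?_
      rw [map_smul_eq_mul, ballS_eq_schrodinger (hψ := hψ) x y, hi]
      exact mul_le_mul_of_nonneg_right (hc y) (apply_nonneg _ _)
    have h5 : ‖f.1 x‖ * q (ballS x (inv_pow_pos p k)) ≤ ⨆ z, B z := by
      rw [← map_smul_eq_mul, ← mulLC_ballInd_eq_smul _ (hk₀ k hk x rfl)]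
      exact le_ciSup hB (x, k)
    calc q v * ‖f.1 x‖ ≤ supNorm v * q (ballS x (inv_pow_pos p k)) * ‖f.1 x‖ :=
          mul_le_mul_of_nonneg_right h4 (norm_nonneg _)
      _ = supNorm v * (‖f.1 x‖ * q (ballS x (inv_pow_pos p k))) := by ring
      _ ≤ _ := mul_le_mul_of_nonneg_left h5 (apply_nonneg _ _)
  have h4 : q v * supNorm f ≤ supNorm v * ⨆ z, B z := by
    rcases (apply_nonneg q v).eq_or_lt with h0 | h0
    · rw [← h0, zero_mul]; exact mul_nonneg (apply_nonneg _ _) hC0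
    · rw [← le_div_iff₀' h0]
      exact supNorm_le fun x => (le_div_iff₀' h0).mpr (h3 x)
  calc q v * supNorm f ≤ supNorm v * ⨆ z, B z := h4
    _ ≤ supNorm v * (p ^ d * q f) := mul_le_mul_of_nonneg_left h2 (apply_nonneg _ _)
    _ = _ := by ring

/-- Without any bound on coefficients, group algebra operators can cut a function down to a small
ball exactly. This yields an indicator function, and its translates span. -/
theorem hasNoInvariantSubspace_schrodinger (hne : ∃ x, ψ x ≠ 1) :
    HasNoInvariantSubspace (schrodinger (d := d) ψ hψ) := by
  intro W hW hbot
  obtain ⟨f, hf, hf0⟩ := (Submodule.ne_bot_iff W).mp hbot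
  obtain ⟨x, hx⟩ : ∃ x, f.1 x ≠ 0 := by
    by_contra! h
    exact hf0 (Subtype.ext (funext h))
  obtain ⟨k₀, hk₀⟩ := exists_forall_eq_of_dist_le f.2.1 (isCompact_singleton (x := x))
  obtain ⟨n, hn⟩ := exists_dist_le_of_hasCompactSupport f x
  refine (Submodule.eq_top_iff').mpr fun v => ?_
  obtain ⟨k, hk, t, c, h, -⟩ := exists_eq_sum_ballS v k₀
  obtain ⟨a, ha, haW, hab⟩ := exists_exact_ballInd (hψ := hψ) hne n k x
  have h1 : mulLC a ha f = f.1 x • ballS x (inv_pow_pos p k) := by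
    rw [← mulLC_ballInd_eq_smul _ (hk₀ k hk x rfl)]
    ext y
    change a y * f.1 y = _ * f.1 y
    by_cases hy : f.1 y = 0
    · rw [hy, mul_zero, mul_zero]
    · rw [hab y (hn y hy)]
  have h2 : ballS x (inv_pow_pos p k) ∈ W := by
    have := W.smul_mem (f.1 x)⁻¹ (h1 ▸ haW W hW f hf)
    rwa [smul_smul, inv_mul_cancel₀ hx, one_smul] at this
  rw [h]
  refine W.sum_mem fun y _ => W.smul_mem _ ?_
  rw [ballS_eq_schrodinger (hψ := hψ) x y]
  exact hW _ _ h2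

/-- The value ψ x is a non-trivial root of unity of p-power order, so some positive power of ‖ψ x -
1‖, a number at most 1, equals 1/p. -/
lemma inv_le_norm_char_sub_one (hψ : IsOpen {x | ψ x = 1}) {x : ℚ_[p]} (hx : ψ x ≠ 1) :
    (p : ℝ)⁻¹ ≤ ‖ψ x - 1‖ := by
  obtain ⟨k, hk⟩ := exists_pow_mul_char_eq_one hψ x
  have h1 : ψ x ^ p ^ k = 1 := by
    rw [← AddChar.map_nsmul_eq_pow, ← hk 1 (by simp), nsmul_eq_mul]
    push_cast
    rw [mul_one]
  have hp : p.Prime := Fact.out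
  obtain ⟨j, -, hj⟩ := (Nat.dvd_prime_pow hp).mp (orderOf_dvd_of_pow_eq_one h1)
  obtain ⟨i, rfl⟩ := Nat.exists_eq_succ_of_ne_zero
    (fun h0 : j = 0 => hx (orderOf_eq_one_iff.mp (by rw [hj, h0, pow_zero])))
  have h2 := norm_sub_one_pow_totient (IsPrimitiveRoot.iff_orderOf.mpr hj)
  rw [← h2]
  have h3 := norm_eq_one_of_pow_eq_one' (pow_ne_zero k hp.ne_zero) h1
  refine pow_le_of_le_one (norm_nonneg _) (norm_sub_one_le_one h3.le) ?_
  exact mul_ne_zero (pow_ne_zero _ hp.ne_zero) (Nat.sub_ne_zero_of_lt hp.one_lt)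

/-- As (p x)⁻¹ is integral, z is a natural multiple of p z x up to an element of the kernel, so ψ (p
z x) = 1 would force ψ z = 1. -/
lemma char_ne_one_of_one_lt_norm (hψ : IsOpen {x | ψ x = 1}) {z : ℚ_[p]} (hz : ψ z ≠ 1)
    {x : ℚ_[p]} (hx : 1 < ‖x‖) : ψ (p * z * x) ≠ 1 := by
  intro h
  obtain ⟨k, hk⟩ := exists_pow_mul_char_eq_one hψ (p * z * x)
  have hp : p.Prime := Fact.out
  have hp0 : (p : ℚ_[p]) ≠ 0 := by exact_mod_cast hp.ne_zero
  have hx0 : x ≠ 0 := norm_pos_iff.mp (zero_lt_one.trans hx)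
  have hw : ‖((p : ℚ_[p]) * x)⁻¹‖ ≤ 1 := by
    have h1 : ¬ ‖x‖ ≤ (p : ℝ) ^ (0 : ℤ) := by simpa using hx
    rw [Padic.norm_le_pow_iff_norm_lt_pow_add_one, zero_add, zpow_one, not_lt] at h1
    rw [norm_inv, norm_mul, Padic.norm_p]
    refine inv_le_one_of_one_le₀ ?_
    rwa [inv_mul_eq_div, one_le_div (by exact_mod_cast hp.pos)]
  obtain ⟨b, y, hy, hby⟩ := exists_nat_close hw k
  refine hz ?_
  have h2 : z = b • (p * z * x) + p ^ k * (p * z * x) * y := by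
    have : z = (p * z * x) * ((p : ℚ_[p]) * x)⁻¹ := by field_simp
    conv_lhs => rw [this, hby]
    rw [nsmul_eq_mul]
    ring
  rw [h2, AddChar.map_add_eq_mul, AddChar.map_nsmul_eq_pow, h, one_pow, one_mul, hk y hy]

/-- The vector is the indicator function of ℤ_p^d, with scalar c = v 0. Almost invariance under unit
translations makes v almost constant on ℤ_p^d, by density of ℕ^d. Almost invariance under the
modulations by p z makes v small elsewhere, with the loss p coming from ‖ψ - 1‖ ≥ 1/p. -/
theorem hasRigidVector_supNorm (hne : ∃ x, ψ x ≠ 1) :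
    HasRigidVector (schrodinger ψ hψ) (supNorm (p := p) (d := d)).toSeminorm := by
  have hp : p.Prime := Fact.out
  have hp0 : (0 : ℝ) < p := by exact_mod_cast hp.pos
  have hp1 : (1 : ℝ) ≤ p := by exact_mod_cast hp.one_le
  obtain ⟨z, hz, hz1⟩ := exists_conductor hψ hne
  have hchar : ∀ x, (charZp p d).1 x = ballInd 0 1 x := fun _ => rfl
  refine ⟨charZp p d, (Set.range fun i => translation (Pi.single i 1)) ∪
    Set.range fun i => modulation i (p * z) 0, p, charZp_ne_zero, hp0, ?_, fun v => ?_⟩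
  · rintro _ (⟨i, rfl⟩ | ⟨i, rfl⟩)
    · ext x
      refine (schrodinger_translation _ _ _).trans ?_
      have h1 : dist (x + Pi.single i 1) 0 ≤ 1 ↔ dist x 0 ≤ 1 := by
        have h2 : ‖(Pi.single i 1 : Fin d → ℚ_[p])‖ ≤ 1 := by
          rw [Pi.norm_single, norm_one]
        rw [dist_zero_right, dist_zero_right]
        constructor
        · intro h
          have := (IsUltrametricDist.norm_add_le_max (x + Pi.single i 1) (-Pi.single i 1)).trans
            (max_le h (by rwa [norm_neg]))
          rwa [add_neg_cancel_right] at this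
        · intro h
          exact (IsUltrametricDist.norm_add_le_max _ _).trans (max_le h h2)
      rw [hchar, hchar]
      by_cases h : dist x 0 ≤ 1
      · rw [ballInd_of_mem h, ballInd_of_mem (h1.mpr h)]
      · rw [ballInd_of_notMem h, ballInd_of_notMem (mt h1.mp h)]
    · ext x
      refine (schrodinger_modulation _ _ _ _ _).trans ?_
      rw [hchar]
      by_cases h : dist x 0 ≤ 1
      · rw [sub_zero, hz1 _ (by
          have := (dist_le_iff_norm_sub_le zero_le_one).mp h i
          simpa using this), one_mul]
      · rw [ballInd_of_notMem h, mul_zero]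
  · refine ⟨v.1 0, fun δ hδ h => supNorm_le fun x => ?_⟩
    change ‖v.1 x - v.1 0 * ballInd 0 1 x‖ ≤ _
    have htr : ∀ i x, ‖v.1 (x + Pi.single i 1) - v.1 x‖ ≤ δ := fun i x => by
      rw [← schrodinger_translation (hψ := hψ)]
      exact (norm_le_supNorm (_ - v) x).trans (h _ (Or.inl ⟨i, rfl⟩))
    have hmod : ∀ i x, ‖ψ (p * z * x i) - 1‖ * ‖v.1 x‖ ≤ δ := fun i x => by
      have := (norm_le_supNorm _ x).trans (h _ (Or.inr ⟨i, rfl⟩))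
      rw [← norm_mul, sub_mul, one_mul, ← sub_zero (x i), ← schrodinger_modulation (hψ := hψ)]
      exact this
    by_cases hx : dist x 0 ≤ 1
    · rw [ballInd_of_mem hx, mul_one]
      let H : AddSubmonoid (Fin d → ℚ_[p]) :=
        { carrier := {a | ∀ x, ‖v.1 (x + a) - v.1 x‖ ≤ δ}
          zero_mem' := fun x => by simpa
          add_mem' := fun {a b} ha hb x => by
            rw [← sub_add_sub_cancel _ (v.1 (x + a)), ← add_assoc]
            exact (IsUltrametricDist.norm_add_le_max _ _).trans (max_le (hb _) (ha _)) }
      obtain ⟨k, hk⟩ := exists_forall_eq_of_dist_le v.2.1 (isCompact_singleton (x := x))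
      have hx' := (dist_le_iff_norm_sub_le zero_le_one).mp hx
      simp only [Pi.zero_apply, sub_zero] at hx'
      choose b y hy hb using fun i => exists_nat_close (hx' i) k
      have hH : (fun i => (b i : ℚ_[p])) ∈ H := by
        have : (fun i => (b i : ℚ_[p])) = ∑ i, b i • (Pi.single i 1 : Fin d → ℚ_[p]) := by
          ext j
          simp [Finset.sum_apply, Pi.single_apply]
        rw [this]
        exact H.sum_mem fun i _ => H.nsmul_mem (fun x => htr i x) _
      have h1 := hH 0
      rw [zero_add, hk k le_rfl x rfl (fun i => (b i : ℚ_[p]))] at h1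
      · exact h1.trans (le_mul_of_one_le_left hδ hp1)
      · refine (dist_le_iff_norm_sub_le (inv_pow_pos p k).le).mpr fun i => ?_
        have : (b i : ℚ_[p]) - x i = -(p ^ k * y i) := by linear_combination -hb i
        rw [this, norm_neg, norm_mul, Padic.norm_p_pow, _root_.zpow_neg, zpow_natCast]
        exact mul_le_of_le_one_right (by positivity) (hy i)
    · rw [ballInd_of_notMem hx, mul_zero, sub_zero]
      obtain ⟨i, hi⟩ : ∃ i, 1 < ‖x i‖ := by
        by_contra! hle
        exact hx ((dist_le_iff_norm_sub_le zero_le_one).mpr fun i => by simpa using hle i)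
      have h1 := inv_le_norm_char_sub_one hψ (char_ne_one_of_one_lt_norm hψ hz hi)
      have h2 := (mul_le_mul_of_nonneg_right h1 (norm_nonneg (v.1 x))).trans (hmod i x)
      rwa [inv_mul_le_iff₀ hp0] at h2

end SupNorm

/-! ### The symplectic action and functionals invariant under a Lagrangian subspace. -/

section Symplectic

variable {p : ℕ} [Fact p.Prime] {d : ℕ}

lemma omega_eq_dotProduct (w₁ w₂ : Fin d ⊕ Fin d → ℚ_[p]) :
    omega w₁ w₂ = -(w₁ ⬝ᵥ (J (Fin d) ℚ_[p] *ᵥ w₂)) := by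
  rw [omega, J, fromBlocks_mulVec]
  simp only [dotProduct, Fintype.sum_sum_type, Sum.elim_inl, Sum.elim_inr, Function.comp_apply,
    zero_mulVec, neg_mulVec, one_mulVec, zero_add, add_zero, Pi.neg_apply, mul_neg,
    Finset.sum_neg_distrib]
  ring

lemma omega_vecMul (g : symplecticGroup (Fin d) ℚ_[p]) (w₁ w₂ : Fin d ⊕ Fin d → ℚ_[p]) :
    omega (w₁ ᵥ* g.1) (w₂ ᵥ* g.1) = omega w₁ w₂ := by
  have hg : g.1 * J (Fin d) ℚ_[p] * g.1ᵀ = J (Fin d) ℚ_[p] := SymplecticGroup.mem_iff.mp g.2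
  rw [omega_eq_dotProduct, omega_eq_dotProduct, ← mulVec_transpose g.1 w₂, ← dotProduct_mulVec,
    mulVec_mulVec, mulVec_mulVec, hg]

lemma act_mul (h k : Heisenberg p d) (g : symplecticGroup (Fin d) ℚ_[p]) :
    (h * k).act g = h.act g * k.act g := by
  simp only [Heisenberg.act, mul_def, add_vecMul, omega_vecMul]

lemma act_act (h : Heisenberg p d) (g g' : symplecticGroup (Fin d) ℚ_[p]) :
    (h.act g).act g' = h.act (g * g') := by
  simp only [Heisenberg.act, vecMul_vecMul, Submonoid.coe_mul]

lemma act_one (h : Heisenberg p d) : h.act 1 = h := by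
  simp only [Heisenberg.act, OneMemClass.coe_one, vecMul_one]

lemma act_inv_act (h : Heisenberg p d) (g : symplecticGroup (Fin d) ℚ_[p]) :
    (h.act g⁻¹).act g = h := by
  rw [act_act, inv_mul_cancel, act_one]

lemma act_center (s : ℚ_[p]) (g : symplecticGroup (Fin d) ℚ_[p]) :
    (⟨0, s⟩ : Heisenberg p d).act g = ⟨0, s⟩ := by
  simp only [Heisenberg.act, zero_vecMul]

/-- The element `[(0, b), 0]` of the Heisenberg group. -/
def character (b : Fin d → ℚ_[p]) : Heisenberg p d := ⟨Sum.elim 0 b, 0⟩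

lemma character_zero : character (0 : Fin d → ℚ_[p]) = 1 := by
  simp [character, one_def]

lemma character_add (b c : Fin d → ℚ_[p]) :
    character (b + c) = character b * character c := by
  simp only [character, mul_def, omega, Sum.elim_comp_inl, Sum.elim_comp_inr, zero_dotProduct,
    dotProduct_zero, sub_zero, mul_zero, add_zero, Heisenberg.mk.injEq, and_true]
  ext j
  cases j <;> simp

lemma character_smul_act (s : ℚ_[p]) (b : Fin d → ℚ_[p])
    (g : symplecticGroup (Fin d) ℚ_[p]) :
    ((character (s • b)).act g).w = s • ((character b).act g).w := by
  have : (Sum.elim (0 : Fin d → ℚ_[p]) (s • b)) = s • Sum.elim (0 : Fin d → ℚ_[p]) b := by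
    ext j; cases j <;> simp
  simp only [character, Heisenberg.act, this, smul_vecMul]

/-- Moving a translation past h leaves a Lagrangian factor on the left and a central factor carrying
exactly the phase of the Schrödinger formula. -/
lemma translation_mul (x : Fin d → ℚ_[p]) (h : Heisenberg p d) :
    translation x * h = character (h.w ∘ Sum.inr) *
      (⟨0, h.t + (1 / 2) * ((h.w ∘ Sum.inl) ⬝ᵥ (h.w ∘ Sum.inr)) + (h.w ∘ Sum.inr) ⬝ᵥ x⟩ *
        translation (x + h.w ∘ Sum.inl)) := by
  simp only [translation, character, mul_def, omega, Sum.elim_comp_inl, Sum.elim_comp_inr, zero_dotProduct, dotProduct_zero, add_zero, zero_add,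
    Heisenberg.mk.injEq, Pi.zero_comp]
  constructor
  · ext i
    cases i <;> simp
  · rw [dotProduct_add, dotProduct_comm (h.w ∘ Sum.inr) (h.w ∘ Sum.inl),
      dotProduct_comm x]
    ring

variable {ψ : AddChar ℚ_[p] ℂ_[p]} {hψ : IsOpen {x | ψ x = 1}}

lemma schrodinger_center (s : ℚ_[p]) (f : schwartz p d) :
    schrodinger ψ hψ ⟨0, s⟩ f = ψ s • f := by
  ext x
  refine (schrodinger_apply _ _ _).trans ?_
  simp [Pi.zero_comp]

lemma schrodinger_character (b : Fin d → ℚ_[p]) (f : schwartz p d) (x : Fin d → ℚ_[p]) :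
    (schrodinger ψ hψ (character b) f).1 x = ψ (b ⬝ᵥ x) * f.1 x := by
  rw [schrodinger_apply]
  simp [character]

/-- Every Schwartz function is fixed by a neighbourhood of the origin. -/
lemma eventually_schrodinger_eq (f : schwartz p d) :
    ∀ᶠ w in nhds (0 : Fin d ⊕ Fin d → ℚ_[p]), schrodinger ψ hψ ⟨w, 0⟩ f = f := by
  obtain ⟨k, hk⟩ := exists_forall_eq_of_dist_le f.2.1 f.2.2
  have h1 : ∀ᶠ w in nhds (0 : Fin d ⊕ Fin d → ℚ_[p]), ‖w ∘ Sum.inl‖ ≤ ((p : ℝ) ^ k)⁻¹ := by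
    have hc : Continuous fun w : Fin d ⊕ Fin d → ℚ_[p] => ‖w ∘ Sum.inl‖ :=
      (continuous_pi fun i => continuous_apply (Sum.inl i)).norm
    have h0 := hc.tendsto 0
    rw [show (0 : Fin d ⊕ Fin d → ℚ_[p]) ∘ Sum.inl = 0 from rfl, norm_zero] at h0
    exact h0.eventually (ge_mem_nhds (inv_pow_pos p k))
  have h2 : ∀ᶠ w in nhds (0 : Fin d ⊕ Fin d → ℚ_[p]), ∀ y ∈ tsupport f.1,
      ψ (0 + (1 / 2) * ((w ∘ Sum.inl) ⬝ᵥ (w ∘ Sum.inr)) +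
        (w ∘ Sum.inr) ⬝ᵥ (y - w ∘ Sum.inl)) = 1 := by
    refine IsCompact.eventually_forall_of_forall_eventually f.2.2 fun y _ => ?_
    have hc : Continuous fun z : (Fin d ⊕ Fin d → ℚ_[p]) × (Fin d → ℚ_[p]) =>
        0 + (1 / 2) * ((z.1 ∘ Sum.inl) ⬝ᵥ (z.1 ∘ Sum.inr)) +
          (z.1 ∘ Sum.inr) ⬝ᵥ (z.2 - z.1 ∘ Sum.inl) := by
      unfold dotProduct
      simp only [Function.comp_apply, Pi.sub_apply]
      fun_prop
    refine hc.continuousAt.eventually (hψ.mem_nhds ?_)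
    simp [show (0 : Fin d ⊕ Fin d → ℚ_[p]) ∘ Sum.inl = 0 from rfl,
      show (0 : Fin d ⊕ Fin d → ℚ_[p]) ∘ Sum.inr = 0 from rfl]
  filter_upwards [h1, h2] with w hw hw'
  ext x
  refine (schrodinger_apply _ _ _).trans ?_
  by_cases hx : f.1 (x + w ∘ Sum.inl) = 0
  · rw [hx, mul_zero]
    by_contra hne
    refine hne (Eq.trans ?_ (hk k le_rfl x (subset_tsupport _ (Ne.symm hne)) (x + w ∘ Sum.inl) ?_))
    · exact hx.symm
    · rwa [dist_eq_norm, add_sub_cancel_left]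
  · have hmem := subset_tsupport _ hx
    have h3 := hw' _ hmem
    rw [add_sub_cancel_right] at h3
    rw [h3, one_mul]
    refine (hk k le_rfl _ hmem x ?_).symm
    rwa [dist_comm, dist_eq_norm, add_sub_cancel_left]

lemma tendsto_pow_smul_zero {E : Type*} [NormedAddCommGroup E] [NormedSpace ℚ_[p] E] (w : E) :
    Filter.Tendsto (fun m : ℕ => (p : ℚ_[p]) ^ m • w) Filter.atTop (nhds 0) := by
  have := (tendsto_pow_atTop_nhds_zero_of_norm_lt_one (Padic.norm_p_lt_one (p := p))).smul_const w
  rwa [zero_smul] at this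

section Functional

variable (g : symplecticGroup (Fin d) ℚ_[p])

/-- On the Lagrangian subspace of the vectors `(a, c) = (0, b) g`, the quadratic form `a ⬝ c` is
small when `a` is small. -/
lemma exists_radius_lagrangian (hψ : IsOpen {x | ψ x = 1}) :
    ∃ r : ℝ, 0 < r ∧ ∀ b : Fin d → ℚ_[p], ‖((character b).act g).w ∘ Sum.inl‖ ≤ r →
      ψ ((1 / 2) * ((((character b).act g).w ∘ Sum.inl) ⬝ᵥ
        (((character b).act g).w ∘ Sum.inr))) = 1 := by
  let A : (Fin d → ℚ_[p]) →ₗ[ℚ_[p]] (Fin d → ℚ_[p]) :=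
    { toFun := fun b => ((character b).act g).w ∘ Sum.inl
      map_add' := fun b c => by rw [character_add, act_mul]; rfl
      map_smul' := fun s b => by rw [character_smul_act]; rfl }
  let B : (Fin d → ℚ_[p]) →ₗ[ℚ_[p]] (Fin d → ℚ_[p]) :=
    { toFun := fun b => ((character b).act g).w ∘ Sum.inr
      map_add' := fun b c => by rw [character_add, act_mul]; rfl
      map_smul' := fun s b => by rw [character_smul_act]; rfl }
  -- A linear section of A over its range, extended to the whole space. Since the subspace is
  -- isotropic, changing b by an element of the kernel of A does not affect A b ⬝ B b, so the form
  -- is a continuous function of a = A b alone.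
  obtain ⟨s₀, hs₀⟩ := A.rangeRestrict.exists_rightInverse_of_surjective A.range_rangeRestrict
  obtain ⟨s, hs⟩ := s₀.exists_extend
  have hAs : ∀ b, A (s (A b)) = A b := fun b => by
    have h1 : s (A b) = s₀ (A.rangeRestrict b) := by rw [← hs]; rfl
    rw [h1]
    exact congrArg Subtype.val (LinearMap.congr_fun hs₀ (A.rangeRestrict b))
  have hker : ∀ b k, A k = 0 → A b ⬝ᵥ B k = 0 := fun b k hk => by
    have h1 : omega ((character b).act g).w ((character k).act g).w = 0 := by
      simp only [Heisenberg.act, omega_vecMul]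
      simp [character, omega]
    rw [omega] at h1
    change A b ⬝ᵥ B k - B b ⬝ᵥ A k = 0 at h1
    rwa [hk, dotProduct_zero, sub_zero] at h1
  have hquad : ∀ b, A b ⬝ᵥ B b = A b ⬝ᵥ B (s (A b)) := fun b => by
    have h1 := hker b (b - s (A b)) (by rw [map_sub, hAs, sub_self])
    rwa [map_sub, dotProduct_sub, sub_eq_zero] at h1
  have hcont : Continuous fun a : Fin d → ℚ_[p] => (1 / 2 : ℚ_[p]) * (a ⬝ᵥ (B ∘ₗ s) a) := by
    have := (B ∘ₗ s).continuous_of_finiteDimensional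
    unfold dotProduct
    fun_prop
  have h0 : ∀ᶠ a in nhds (0 : Fin d → ℚ_[p]), ψ ((1 / 2) * (a ⬝ᵥ (B ∘ₗ s) a)) = 1 :=
    hcont.continuousAt.eventually (hψ.mem_nhds (by simp))
  obtain ⟨r, hr, h⟩ := Metric.eventually_nhds_iff.mp h0
  refine ⟨r / 2, half_pos hr, fun b hb => ?_⟩
  change ψ ((1 / 2) * (A b ⬝ᵥ B b)) = 1
  rw [hquad]
  refine h ?_
  rw [dist_zero_right]
  exact lt_of_le_of_lt hb (half_lt_self hr)

/-- A vector which is killed by a sum over some finite family of elements of a Lagrangian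
subspace. -/
def IsAverageZero (ψ : AddChar ℚ_[p] ℂ_[p]) (hψ : IsOpen {x | ψ x = 1})
    (g : symplecticGroup (Fin d) ℚ_[p]) (f : schwartz p d) : Prop :=
  ∃ (ι : Type) (_ : Fintype ι) (b : ι → Fin d → ℚ_[p]) (i₀ : ι), b i₀ = 0 ∧
    ∑ i, schrodinger ψ hψ ((character (b i)).act g) f = 0

variable {g}

lemma schrodinger_character_act_add (b c : Fin d → ℚ_[p]) (f : schwartz p d) :
    schrodinger ψ hψ ((character (b + c)).act g) f =
      schrodinger ψ hψ ((character b).act g) (schrodinger ψ hψ ((character c).act g) f) := by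
  rw [character_add, act_mul, map_mul]
  rfl

/-- The operators attached to the Lagrangian subspace commute, so the sum over the product family
factors and either factor can be applied first. -/
lemma IsAverageZero.add {f f' : schwartz p d} (h : IsAverageZero ψ hψ g f)
    (h' : IsAverageZero ψ hψ g f') : IsAverageZero ψ hψ g (f + f') := by
  obtain ⟨ι, _, b, i₀, hb, h⟩ := h
  obtain ⟨ι', _, b', i₀', hb', h'⟩ := h'
  refine ⟨ι × ι', inferInstance, fun z => b z.1 + b' z.2, (i₀, i₀'), by simp [hb, hb'], ?_⟩
  simp only [map_add, Finset.sum_add_distrib]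
  have e1 : ∑ z : ι × ι', schrodinger ψ hψ ((character (b z.1 + b' z.2)).act g) f = 0 := by
    rw [Fintype.sum_prod_type_right]
    refine Finset.sum_eq_zero fun j _ => ?_
    simp only [add_comm (b _), schrodinger_character_act_add]
    rw [← map_sum, h, map_zero]
  have e2 : ∑ z : ι × ι', schrodinger ψ hψ ((character (b z.1 + b' z.2)).act g) f' = 0 := by
    rw [Fintype.sum_prod_type]
    refine Finset.sum_eq_zero fun j _ => ?_
    simp only [schrodinger_character_act_add]
    rw [← map_sum, h', map_zero]
  rw [e1, e2, add_zero]

/-- Sum over the multiples i b with i < p^m: the sum telescopes to the difference between the action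
of p^m b on f and f, which vanishes for some m because f is smooth. -/
lemma isAverageZero_sub (b : Fin d → ℚ_[p]) (f : schwartz p d) :
    IsAverageZero ψ hψ g (schrodinger ψ hψ ((character b).act g) f - f) := by
  have hp : p.Prime := Fact.out
  obtain ⟨m, hm⟩ := ((tendsto_pow_smul_zero (p := p) (((character b).act g).w)).eventually
    (eventually_schrodinger_eq (hψ := hψ) f)).exists
  have : NeZero (p ^ m) := ⟨pow_ne_zero m hp.ne_zero⟩
  refine ⟨Fin (p ^ m), inferInstance, fun i => (i : ℕ) • b, 0, by simp, ?_⟩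
  simp only [map_sub, ← schrodinger_character_act_add, ← succ_nsmul]
  rw [Fin.sum_univ_eq_sum_range (fun i => schrodinger ψ hψ ((character ((i + 1) • b)).act g) f -
    schrodinger ψ hψ ((character (i • b)).act g) f) (p ^ m),
    Finset.sum_range_sub (fun i => schrodinger ψ hψ ((character (i • b)).act g) f), zero_smul,
    character_zero]
  have h1 : (character (p ^ m • b)).act g = ⟨(p : ℚ_[p]) ^ m • ((character b).act g).w, 0⟩ := by
    rw [← character_smul_act, ← Nat.cast_smul_eq_nsmul ℚ_[p], Nat.cast_pow]
    rfl
  rw [h1, hm]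
  have h2 : (1 : Heisenberg p d).act g = 1 := act_center 0 g
  rw [h2, map_one, Module.End.one_apply, sub_self]

/-- At the origin each term is 0 or 1, and the term with b = 0 is 1, so the sum is a positive
integer, non-zero in characteristic 0. -/
lemma not_isAverageZero_ballS {r : ℝ} (hr : 0 < r)
    (h : ∀ b : Fin d → ℚ_[p], ‖((character b).act g).w ∘ Sum.inl‖ ≤ r →
      ψ ((1 / 2) * ((((character b).act g).w ∘ Sum.inl) ⬝ᵥ
        (((character b).act g).w ∘ Sum.inr))) = 1) :
    ¬ IsAverageZero ψ hψ g (ballS 0 hr) := by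
  classical
  rintro ⟨ι, _, b, i₀, hb, hsum⟩
  have h1 := congrFun (congrArg Subtype.val hsum) 0
  rw [AddSubmonoidClass.coe_finsetSum, Finset.sum_apply] at h1
  have h2 : ∀ i, (schrodinger ψ hψ ((character (b i)).act g) (ballS 0 hr)).1 0 =
      if ‖((character (b i)).act g).w ∘ Sum.inl‖ ≤ r then 1 else 0 := fun i => by
    rw [schrodinger_apply, zero_add, dotProduct_zero, add_zero]
    change ψ (0 + _) * ballInd 0 r _ = _
    rw [zero_add]
    split_ifs with hi
    · rw [h _ hi, ballInd_of_mem (by rwa [dist_zero_right]), one_mul]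
    · rw [ballInd_of_notMem (by rwa [dist_zero_right]), mul_zero]
  rw [Finset.sum_congr rfl fun i _ => h2 i, Finset.sum_boole] at h1
  have h3 := Nat.cast_eq_zero.mp h1
  rw [Finset.card_eq_zero] at h3
  refine Finset.notMem_empty i₀ (h3 ▸ Finset.mem_filter.mpr ⟨Finset.mem_univ _, ?_⟩)
  rw [hb, character_zero, show (1 : Heisenberg p d).act g = 1 from act_center 0 g]
  change ‖(0 : Fin d → ℚ_[p])‖ ≤ r
  rw [norm_zero]
  exact hr.le

/-- There is a non-zero functional which is invariant under the Lagrangian subspace of the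
vectors `(0, b) g`. -/
lemma exists_invariant_functional (g : symplecticGroup (Fin d) ℚ_[p]) :
    ∃ μ : schwartz p d →ₗ[ℂ_[p]] ℂ_[p], μ ≠ 0 ∧
      ∀ b f, μ (schrodinger ψ hψ ((character b).act g) f) = μ f := by
  obtain ⟨r, hr, h⟩ := exists_radius_lagrangian g hψ
  let D : Submodule ℂ_[p] (schwartz p d) := Submodule.span ℂ_[p]
    (Set.range fun z : (Fin d → ℚ_[p]) × schwartz p d =>
      schrodinger ψ hψ ((character z.1).act g) z.2 - z.2)
  have hD : ∀ f ∈ D, IsAverageZero ψ hψ g f := fun f hf => by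
    induction hf using Submodule.span_induction with
    | mem f hf =>
      obtain ⟨z, rfl⟩ := hf
      exact isAverageZero_sub z.1 z.2
    | zero => exact ⟨Unit, inferInstance, fun _ => 0, (), rfl, by simp⟩
    | add f f' _ _ hf hf' => exact hf.add hf'
    | smul c f _ hf =>
      obtain ⟨ι, _, b, i₀, hb, hsum⟩ := hf
      refine ⟨ι, inferInstance, b, i₀, hb, ?_⟩
      simp only [map_smul]
      rw [← Finset.smul_sum, hsum, smul_zero]
  -- The indicator function of the ball is outside the span D of the coboundaries, so some
  -- functional kills D but not this function.
  obtain ⟨μ, hμ, hμD⟩ := Submodule.exists_le_ker_of_notMem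
    (fun hmem => not_isAverageZero_ballS hr h (hD _ hmem))
  refine ⟨μ, fun h0 => hμ (by rw [h0]; rfl), fun b f => ?_⟩
  have := hμD (Submodule.subset_span ⟨(b, f), rfl⟩)
  rwa [LinearMap.mem_ker, map_sub, sub_eq_zero] at this

end Functional
end Symplectic

/-! ### Existence of intertwining operators, and non-domination outside the Siegel parabolic. -/

section Intertwining

variable {p : ℕ} [Fact p.Prime] {d : ℕ} {ψ : AddChar ℚ_[p] ℂ_[p]} {hψ : IsOpen {x | ψ x = 1}}
  {g : symplecticGroup (Fin d) ℚ_[p]} {μ : schwartz p d →ₗ[ℂ_[p]] ℂ_[p]}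

lemma apply_schrodinger_translation_act
    (hμ : ∀ b f, μ (schrodinger ψ hψ ((character b).act g) f) = μ f) (x : Fin d → ℚ_[p])
    (h : Heisenberg p d) (f : schwartz p d) :
    μ (schrodinger ψ hψ ((translation x).act g) (schrodinger ψ hψ (h.act g) f)) =
      ψ (h.t + (1 / 2) * ((h.w ∘ Sum.inl) ⬝ᵥ (h.w ∘ Sum.inr)) + (h.w ∘ Sum.inr) ⬝ᵥ x) *
        μ (schrodinger ψ hψ ((translation (x + h.w ∘ Sum.inl)).act g) f) := by
  rw [← Module.End.mul_apply, ← map_mul, ← act_mul, translation_mul, act_mul, map_mul,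
    Module.End.mul_apply, hμ, act_mul, map_mul, Module.End.mul_apply, act_center,
    schrodinger_center, map_smul, smul_eq_mul]

lemma exists_norm_le_of_char_eq_one (hne : ∃ x, ψ x ≠ 1) {δ : ℝ} (hδ : 0 < δ) :
    ∃ R : ℝ, ∀ x : Fin d → ℚ_[p], (∀ b, ‖b‖ ≤ δ → ψ (b ⬝ᵥ x) = 1) → ‖x‖ ≤ R := by
  obtain ⟨z, hz⟩ := hne
  refine ⟨‖z‖ / δ, fun x hx => ?_⟩
  refine (pi_norm_le_iff_of_nonneg (by positivity)).mpr fun i => ?_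
  by_contra! hlt
  have hxi : 0 < ‖x i‖ := lt_of_le_of_lt (by positivity) hlt
  refine hz ?_
  rw [← hx (Pi.single i (z / x i)) ?_, single_dotProduct, div_mul_cancel₀ _ (norm_pos_iff.mp hxi)]
  rw [Pi.norm_single, norm_div, div_le_iff₀ hxi]
  rw [div_lt_iff₀ hδ] at hlt
  linarith

/-- The function attached to `f` by an invariant functional is a Schwartz function. -/
lemma matrixCoeff_mem_schwartz (hne : ∃ x, ψ x ≠ 1)
    (hμ : ∀ b f, μ (schrodinger ψ hψ ((character b).act g) f) = μ f) (f : schwartz p d) :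
    (fun x => μ (schrodinger ψ hψ ((translation x).act g) f)) ∈ schwartz p d := by
  have hc : Continuous fun w : Fin d ⊕ Fin d → ℚ_[p] => w ᵥ* g.1 := by
    unfold vecMul dotProduct
    fun_prop
  have h0 := hc.tendsto 0
  rw [zero_vecMul] at h0
  obtain ⟨δ, hδ, h⟩ := Metric.eventually_nhds_iff.mp
    (h0.eventually (eventually_schrodinger_eq (hψ := hψ) f))
  -- All small w g fix f. Pure translations w then give local constancy, and pure characters force ψ
  -- (b ⬝ x) = 1 for small b wherever the function is non-zero, which bounds x.
  have key : ∀ w x, ‖w‖ < δ → μ (schrodinger ψ hψ ((translation x).act g) f) =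
      ψ (0 + (1 / 2) * ((w ∘ Sum.inl) ⬝ᵥ (w ∘ Sum.inr)) + (w ∘ Sum.inr) ⬝ᵥ x) *
        μ (schrodinger ψ hψ ((translation (x + w ∘ Sum.inl)).act g) f) := fun w x hw => by
    rw [← apply_schrodinger_translation_act hμ x ⟨w, 0⟩]
    congr 2
    exact (h (by rwa [dist_zero_right])).symm
  have hnorm : ∀ a b : Fin d → ℚ_[p], ‖a‖ < δ → ‖b‖ < δ → ‖Sum.elim a b‖ < δ :=
    fun a b ha hb => by
      refine (pi_norm_lt_iff hδ).mpr ?_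
      rintro (i | i)
      · exact (norm_le_pi_norm a i).trans_lt ha
      · exact (norm_le_pi_norm b i).trans_lt hb
  refine ⟨(IsLocallyConstant.iff_eventually_eq _).mpr fun x => ?_, ?_⟩
  · refine Metric.eventually_nhds_iff.mpr ⟨δ, hδ, fun y hy => ?_⟩
    have := key (Sum.elim (y - x) 0) x (hnorm _ _ (by rwa [← dist_eq_norm]) (by simpa))
    simp only [Sum.elim_comp_inl, Sum.elim_comp_inr, dotProduct_zero, zero_dotProduct, mul_zero,
      add_zero, AddChar.map_zero_eq_one, one_mul, add_sub_cancel] at this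
    exact this.symm
  · obtain ⟨R, hR⟩ := exists_norm_le_of_char_eq_one (d := d) hne (half_pos hδ)
    refine HasCompactSupport.intro (isCompact_closedBall 0 R) fun x hx => ?_
    by_contra hne'
    refine hx (mem_closedBall_zero_iff.mpr (hR x fun b hb => ?_))
    have := key (Sum.elim 0 b) x (hnorm _ _ (by simpa) (hb.trans_lt (half_lt_self hδ)))
    simp only [Sum.elim_comp_inl, Sum.elim_comp_inr, zero_dotProduct, mul_zero,
      add_zero, zero_add] at this
    exact (mul_eq_right₀ hne').mp this.symm

/-- Frobenius reciprocity: the invariant functional μ gives the map taking f to the function x ↦ μ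
(ρ(x g) f). Its value at 0 is μ f, so it is non-zero, and irreducibility makes it bijective. -/
theorem exists_isIntertwining (hne : ∃ x, ψ x ≠ 1) (g : symplecticGroup (Fin d) ℚ_[p]) :
    ∃ T, IsIntertwining ψ hψ g T := by
  obtain ⟨μ, hμ0, hμ⟩ := exists_invariant_functional (hψ := hψ) g
  let T : schwartz p d →ₗ[ℂ_[p]] schwartz p d :=
    { toFun := fun f => ⟨fun x => μ (schrodinger ψ hψ ((translation x).act g) f),
        matrixCoeff_mem_schwartz hne hμ f⟩
      map_add' := fun f f' => by ext x; simp
      map_smul' := fun c f => by ext x; simp }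
  have hT : ∀ h f, schrodinger ψ hψ h (T f) = T (schrodinger ψ hψ (h.act g) f) := fun h f => by
    ext x
    exact (apply_schrodinger_translation_act hμ x h f).symm
  obtain ⟨f, hf⟩ : ∃ f, T f ≠ 0 := by
    by_contra! hzero
    refine hμ0 (LinearMap.ext fun f => ?_)
    have h1 := congrFun (congrArg Subtype.val (hzero f)) 0
    change μ (schrodinger ψ hψ ((character 0).act g) f) = 0 at h1
    rwa [hμ] at h1
  have hirr := hasNoInvariantSubspace_schrodinger (d := d) (hψ := hψ) hne
  have hker : LinearMap.ker T = ⊥ := by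
    by_contra hbot
    have := hirr (LinearMap.ker T) (fun h v hv => by
      rw [LinearMap.mem_ker] at hv ⊢
      rw [← act_inv_act h g, ← hT, hv, map_zero]) hbot
    exact hf (LinearMap.mem_ker.mp (this ▸ Submodule.mem_top))
  have hran : LinearMap.range T = ⊤ := by
    refine hirr _ ?_ fun hbot => hf ?_
    · rintro h _ ⟨v, rfl⟩
      exact ⟨_, (hT h v).symm⟩
    · exact (Submodule.mem_bot ℂ_[p]).mp (hbot ▸ LinearMap.mem_range_self T f)
  exact ⟨LinearEquiv.ofBijective T
    ⟨LinearMap.ker_eq_bot.mp hker, LinearMap.range_eq_top.mp hran⟩, hT⟩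

theorem isIntertwining_weilOperator (hne : ∃ x, ψ x ≠ 1) (g : symplecticGroup (Fin d) ℚ_[p]) :
    IsIntertwining ψ hψ g (weilOperator ψ hψ g) :=
  Classical.epsilon_spec (exists_isIntertwining hne g)

lemma IsIntertwining.symm_apply {T : schwartz p d ≃ₗ[ℂ_[p]] schwartz p d}
    (hT : IsIntertwining ψ hψ g T) (h : Heisenberg p d) (v : schwartz p d) :
    T.symm (schrodinger ψ hψ h v) = schrodinger ψ hψ (h.act g) (T.symm v) := by
  rw [LinearEquiv.symm_apply_eq, ← hT, LinearEquiv.apply_symm_apply]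

lemma IsIntertwining.symm_trans {g' : symplecticGroup (Fin d) ℚ_[p]}
    {T T' : schwartz p d ≃ₗ[ℂ_[p]] schwartz p d}
    (hT : IsIntertwining ψ hψ g T) (hT' : IsIntertwining ψ hψ g' T') :
    IsIntertwining ψ hψ (g' * g⁻¹) (T.symm.trans T') := fun h f => by
  rw [LinearEquiv.trans_apply, hT', LinearEquiv.trans_apply, ← act_act, hT.symm_apply, act_inv_act]

/-- The sup norm is not dominated by its image under an intertwining operator attached to a
matrix outside of the Siegel parabolic. -/
theorem IsIntertwining.not_dominated {T : schwartz p d ≃ₗ[ℂ_[p]] schwartz p d}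
    (hT : IsIntertwining ψ hψ g T) (hg : g ∉ siegel p d) (D : ℝ) :
    ¬ ∀ v, supNorm v ≤ D * supNorm (T v) := by
  classical
  intro hD
  have hp : p.Prime := Fact.out
  have hp0 : (0 : ℝ) < p := by exact_mod_cast hp.pos
  have hpQ : (p : ℚ_[p]) ≠ 0 := by exact_mod_cast hp.ne_zero
  obtain ⟨b, hb⟩ : ∃ b : Fin d → ℚ_[p], ((character b).act g).w ∘ Sum.inl ≠ 0 := by
    by_contra! hzero
    refine hg ?_
    change g.1.toBlocks₂₁ = 0
    ext i j
    have h1 := congrFun (hzero (Pi.single i 1)) j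
    have h2 : (Sum.elim 0 (Pi.single i 1) : Fin d ⊕ Fin d → ℚ_[p]) = Pi.single (Sum.inr i) 1 := by
      ext k; cases k <;> simp [Pi.single_apply]
    simpa [Heisenberg.act, character, h2, toBlocks₂₁] using h1
  set w := ((character b).act g).w with hw
  have hact : ∀ s : ℚ_[p], (character (s • b)).act g = ⟨s • w, 0⟩ := fun s => by
    rw [hw, ← character_smul_act]; rfl
  -- The phase is quadratic in s once x is scaled to s • y. Hence for small s ≠ 0 it is trivial on
  -- the whole ball of radius ‖s a‖, where a is the first half of w, and translation by s a
  -- preserves that ball.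
  have hev : ∀ᶠ s in nhds (0 : ℚ_[p]), ∀ y ∈ Metric.closedBall 0 ‖w ∘ Sum.inl‖,
      ψ ((1 / 2) * ((s • (w ∘ Sum.inl)) ⬝ᵥ (s • (w ∘ Sum.inr))) +
        (s • (w ∘ Sum.inr)) ⬝ᵥ (s • y)) = 1 := by
    refine IsCompact.eventually_forall_of_forall_eventually (isCompact_closedBall _ _) fun y _ => ?_
    have hc : Continuous fun z : ℚ_[p] × (Fin d → ℚ_[p]) =>
        (1 / 2) * ((z.1 • (w ∘ Sum.inl)) ⬝ᵥ (z.1 • (w ∘ Sum.inr))) +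
        (z.1 • (w ∘ Sum.inr)) ⬝ᵥ (z.1 • z.2) := by
      unfold dotProduct
      simp only [Function.comp_apply, Pi.smul_apply]
      fun_prop
    refine hc.continuousAt.eventually (hψ.mem_nhds ?_)
    simp
  obtain ⟨s, hs, hs0⟩ := ((hev.filter_mono nhdsWithin_le_nhds).and
    (self_mem_nhdsWithin (s := {(0 : ℚ_[p])}ᶜ))).exists
  have hs0' : s ≠ 0 := hs0
  have hr : 0 < ‖s • (w ∘ Sum.inl)‖ := norm_pos_iff.mpr (smul_ne_zero hs0' hb)
  set r := ‖s • (w ∘ Sum.inl)‖ with hrdef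
  set f := ballS (0 : Fin d → ℚ_[p]) hr with hf
  have hfix : schrodinger ψ hψ ((character (s • b)).act g) f = f := by
    rw [hact]
    ext x
    refine (schrodinger_apply _ _ _).trans ?_
    change ψ (0 + (1 / 2) * ((s • (w ∘ Sum.inl)) ⬝ᵥ (s • (w ∘ Sum.inr))) +
      (s • (w ∘ Sum.inr)) ⬝ᵥ x) * ballInd 0 r (x + s • (w ∘ Sum.inl)) = ballInd 0 r x
    by_cases hx : ‖x‖ ≤ r
    · have h1 : ‖s⁻¹ • x‖ ≤ ‖w ∘ Sum.inl‖ := by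
        rw [hrdef, norm_smul] at hx
        rwa [norm_smul, norm_inv, inv_mul_le_iff₀ (norm_pos_iff.mpr hs0')]
      have h2 := hs (s⁻¹ • x) (mem_closedBall_zero_iff.mpr h1)
      rw [smul_smul s, mul_inv_cancel₀ hs0', one_smul] at h2
      rw [zero_add, h2, ballInd_of_mem (x := x) (by rwa [dist_zero_right]), ballInd_of_mem, one_mul]
      rw [dist_zero_right]
      exact (IsUltrametricDist.norm_add_le_max _ _).trans (max_le hx le_rfl)
    · rw [ballInd_of_notMem (x := x) (by rwa [dist_zero_right]), ballInd_of_notMem, mul_zero]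
      rw [dist_zero_right]
      intro h
      have := (IsUltrametricDist.norm_add_le_max _ (-(s • (w ∘ Sum.inl)))).trans
        (max_le h (by rw [norm_neg]))
      rw [add_neg_cancel_right] at this
      exact hx this
  -- Invariance of f under (0, s b) g translates, through T, into a condition on the support of T f.
  have hchar : ∀ x, (T f).1 x ≠ 0 → ψ ((s • b) ⬝ᵥ x) = 1 := fun x hx => by
    have h1 := hT (character (s • b)) f
    rw [hfix] at h1
    have h2 := congrFun (congrArg Subtype.val h1) x
    rw [schrodinger_character] at h2
    exact (mul_eq_right₀ hx).mp h2
  -- For 0 < j < p^m one has ‖t m j‖ > ‖s‖, so the j-th translate of the ball misses 0 and only j =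
  -- 0 contributes to v m at the origin.
  let t : ℕ → ℕ → ℚ_[p] := fun m j => j * ((p : ℚ_[p]) ^ m)⁻¹ * s
  let v : ℕ → schwartz p d := fun m =>
    ∑ j ∈ Finset.range (p ^ m), schrodinger ψ hψ ((character (t m j • b)).act g) f
  have hv0 : ∀ m, 1 ≤ supNorm (v m) := fun m => by
    have h1 : (v m).1 0 = 1 := by
      simp only [v]
      rw [AddSubmonoidClass.coe_finsetSum, Finset.sum_apply,
        Finset.sum_eq_single_of_mem 0 (Finset.mem_range.mpr (pow_pos hp.pos m))]
      · have : t m 0 = 0 := by simp [t]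
        rw [this, zero_smul, character_zero, show (1 : Heisenberg p d).act g = 1 from act_center 0 g,
          map_one]
        exact ballInd_of_mem (by rw [dist_self]; exact hr.le)
      · intro j hj hj0
        rw [hact, schrodinger_apply]
        have : ¬ dist (0 + (t m j • w) ∘ Sum.inl) 0 ≤ r := by
          change ¬ dist (0 + t m j • (w ∘ Sum.inl)) 0 ≤ ‖s • (w ∘ Sum.inl)‖
          rw [zero_add, dist_zero_right, norm_smul, norm_smul, not_le, norm_mul]
          refine mul_lt_mul_of_pos_right ?_ (norm_pos_iff.mpr hb)
          refine lt_mul_of_one_lt_left (norm_pos_iff.mpr hs0') ?_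
          rw [norm_mul, norm_inv, ← div_eq_mul_inv, one_lt_div (norm_pos_iff.mpr (pow_ne_zero m hpQ)),
            Padic.norm_p_pow]
          by_contra! hle
          have h3 := (Padic.norm_int_le_pow_iff_dvd (p := p) j m).mp (by exact_mod_cast hle)
          have h4 : p ^ m ∣ j := by exact_mod_cast h3
          exact absurd (Nat.le_of_dvd (Nat.pos_of_ne_zero hj0) h4)
            (not_le.mpr (Finset.mem_range.mp hj))
        exact mul_eq_zero_of_right _ (ballInd_of_notMem this)
    rw [← norm_one (α := ℂ_[p]), ← h1]
    exact norm_le_supNorm _ _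
  have hTv : ∀ m, supNorm (T (v m)) ≤ ((p : ℝ) ^ m)⁻¹ * supNorm (T f) := fun m => by
    refine supNorm_le fun x => ?_
    have h1 : (T (v m)).1 x = (∑ j ∈ Finset.range (p ^ m),
        ψ ((((p : ℚ_[p]) ^ m)⁻¹ * s) * (b ⬝ᵥ x)) ^ j) * (T f).1 x := by
      simp only [v, map_sum]
      rw [AddSubmonoidClass.coe_finsetSum, Finset.sum_apply, Finset.sum_mul]
      refine Finset.sum_congr rfl fun j _ => ?_
      rw [← hT, schrodinger_character, ← AddChar.map_nsmul_eq_pow, smul_dotProduct, nsmul_eq_mul,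
        smul_eq_mul]
      congr 2
      ring
    rw [h1, norm_mul]
    by_cases hx : (T f).1 x = 0
    · rw [hx, norm_zero, mul_zero]; positivity
    refine mul_le_mul ?_ (norm_le_supNorm _ _) (norm_nonneg _) (inv_pow_pos p m).le
    set ζ := ψ ((((p : ℚ_[p]) ^ m)⁻¹ * s) * (b ⬝ᵥ x)) with hζ
    -- On the support of T f the geometric sum runs over the powers of a root of unity of order
    -- dividing p^m, so it is p^m or 0, of absolute value at most p^(-m).
    have hζ1 : ζ ^ p ^ m = 1 := by
      rw [hζ, ← AddChar.map_nsmul_eq_pow, ← hchar x hx, nsmul_eq_mul, smul_dotProduct, smul_eq_mul]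
      congr 1
      push_cast
      field_simp
    by_cases h2 : ζ = 1
    · simp only [h2, one_pow, Finset.sum_const, Finset.card_range, nsmul_eq_mul, mul_one]
      rw [Nat.cast_pow, norm_pow, norm_natCast_prime, inv_pow]
    · have h3 := geom_sum_mul ζ (p ^ m)
      rw [hζ1, sub_self] at h3
      rw [(mul_eq_zero.mp h3).resolve_right (sub_ne_zero.mpr h2), norm_zero]
      exact (inv_pow_pos p m).le
  have hlim := (tendsto_inv_pow p).const_mul (|D| * supNorm (T f))
  rw [mul_zero] at hlim
  refine absurd (ge_of_tendsto hlim (b := 1) (Filter.Eventually.of_forall fun m => ?_))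
    (not_le.mpr zero_lt_one)
  calc 1 ≤ supNorm (v m) := hv0 m
    _ ≤ D * supNorm (T (v m)) := hD _
    _ ≤ |D| * supNorm (T (v m)) :=
      mul_le_mul_of_nonneg_right (le_abs_self D) (apply_nonneg _ _)
    _ ≤ |D| * (((p : ℝ) ^ m)⁻¹ * supNorm (T f)) :=
      mul_le_mul_of_nonneg_left (hTv m) (abs_nonneg D)
    _ = _ := by ring

end Intertwining

/-! ### From the sup norm to the norms indexed by the Grassmannian. -/

section Transport

variable {p : ℕ} [Fact p.Prime] {d : ℕ} {ψ : AddChar ℚ_[p] ℂ_[p]} {hψ : IsOpen {x | ψ x = 1}}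
  {g : symplecticGroup (Fin d) ℚ_[p]} {T : schwartz p d ≃ₗ[ℂ_[p]] schwartz p d}
  {N : Seminorm ℂ_[p] (schwartz p d)} {c : ℝ}

lemma supNorm_schrodinger (h : Heisenberg p d) (f : schwartz p d) :
    supNorm (schrodinger ψ hψ h f) = supNorm f := by
  have key : ∀ (h : Heisenberg p d) (f : schwartz p d),
      supNorm (schrodinger ψ hψ h f) ≤ supNorm f := fun h f => supNorm_le fun x => by
    obtain ⟨k, hk⟩ := exists_pow_mul_char_eq_one hψ
      (h.t + (1 / 2) * ((h.w ∘ Sum.inl) ⬝ᵥ (h.w ∘ Sum.inr)) + (h.w ∘ Sum.inr) ⬝ᵥ x)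
    have h1 := hk 1 (by simp)
    rw [mul_one, ← Nat.cast_pow, ← nsmul_eq_mul, AddChar.map_nsmul_eq_pow] at h1
    rw [schrodinger_apply, norm_mul, norm_eq_one_of_pow_eq_one'
      (pow_ne_zero k (Fact.out : p.Prime).ne_zero) h1, one_mul]
    exact norm_le_supNorm _ _
  refine le_antisymm (key h f) ?_
  simpa using key h⁻¹ (schrodinger ψ hψ h f)

/-- Composing q with T⁻¹ gives again an invariant seminorm, as T⁻¹ only twists the group by the
automorphism g; the constant R is unchanged. -/
lemma IsIntertwining.isRigid (hT : IsIntertwining ψ hψ g T) (hne : ∃ x, ψ x ≠ 1) (hc : 0 < c)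
    (hN : ∀ f, N f = c * supNorm (T f)) : IsRigid (schrodinger ψ hψ) N := by
  obtain ⟨R, hR, h⟩ := isRigid_supNorm (d := d) (hψ := hψ) hne
  refine ⟨R, hR, fun q hq hi ⟨D, hD, hqD⟩ v f => ?_⟩
  have h1 := h (q.comp T.symm.toLinearMap)
    (fun v w => by simpa using hq (T.symm v) (T.symm w))
    (fun k v => by
      change q (T.symm (schrodinger ψ hψ k v)) = q (T.symm v)
      rw [hT.symm_apply, hi])
    ⟨D * c, mul_pos hD hc, fun v => by
      have := hqD (T.symm v)
      rw [hN, T.apply_symm_apply, ← mul_assoc] at this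
      exact this⟩ (T v) (T f)
  change q (T.symm (T v)) * _ ≤ _ * _ * q (T.symm (T f)) at h1
  rw [T.symm_apply_apply, T.symm_apply_apply] at h1
  rw [hN, hN]
  have h2 := mul_le_mul_of_nonneg_left h1 hc.le
  linarith

lemma IsIntertwining.hasRigidVector (hT : IsIntertwining ψ hψ g T) (hne : ∃ x, ψ x ≠ 1)
    (hc : 0 < c) (hN : ∀ f, N f = c * supNorm (T f)) : HasRigidVector (schrodinger ψ hψ) N := by
  obtain ⟨e, F, C, he, hC, hF, h⟩ := hasRigidVector_supNorm (d := d) (hψ := hψ) hne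
  refine ⟨T.symm e, (fun k => k.act g) '' F, C, ?_, hC, ?_, fun v => ?_⟩
  · rwa [Ne, LinearEquiv.map_eq_zero_iff]
  · rintro _ ⟨k, hk, rfl⟩
    rw [← hT.symm_apply, hF k hk]
  · obtain ⟨z, hz⟩ := h (T v)
    refine ⟨z, fun δ hδ hv => ?_⟩
    have h1 := hz (δ / c) (by positivity) fun k hk => by
      have := hv _ ⟨k, hk, rfl⟩
      rw [hN, map_sub, ← hT] at this
      rwa [le_div_iff₀' hc]
    rw [hN, map_sub, map_smul, T.apply_symm_apply]
    have h2 := mul_le_mul_of_nonneg_left h1 hc.le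
    rwa [mul_left_comm, mul_div_cancel₀ _ hc.ne'] at h2

lemma exists_grassmannNorm_eq (ψ : AddChar ℚ_[p] ℂ_[p]) (hψ : IsOpen {x | ψ x = 1})
    (α : Grassmannian p d) : ∃ c : ℝ, 0 < c ∧
      ∀ f, grassmannNorm ψ hψ α f = c * supNorm (weilOperator ψ hψ α.out f) := by
  refine ⟨(supNorm (weilOperator ψ hψ α.out (charZp p d)))⁻¹, inv_pos.mpr ?_,
    fun f => div_eq_inv_mul _ _⟩
  exact supNorm.pos ((LinearEquiv.map_ne_zero_iff _).mpr charZp_ne_zero)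

theorem isSimpleFamily_grassmannNorm (hne : ∃ x, ψ x ≠ 1) :
    IsSimpleFamily (schrodinger (d := d) ψ hψ) (grassmannNorm ψ hψ) where
  irred := hasNoInvariantSubspace_schrodinger hne
  inv α h f := by
    obtain ⟨c, -, hN⟩ := exists_grassmannNorm_eq ψ hψ α
    rw [hN, hN, ← act_inv_act h α.out, ← isIntertwining_weilOperator hne, supNorm_schrodinger]
  rigid α := by
    obtain ⟨c, hc, hN⟩ := exists_grassmannNorm_eq ψ hψ α
    exact (isIntertwining_weilOperator hne α.out).isRigid hne hc hN
  rigidVector α := by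
    obtain ⟨c, hc, hN⟩ := exists_grassmannNorm_eq ψ hψ α
    exact (isIntertwining_weilOperator hne α.out).hasRigidVector hne hc hN
  not_dominated α β hαβ := by
    rintro ⟨D, hD, h⟩
    obtain ⟨a, ha, hNα⟩ := exists_grassmannNorm_eq ψ hψ α
    obtain ⟨b, hb, hNβ⟩ := exists_grassmannNorm_eq ψ hψ β
    -- The operator T_β T_α⁻¹ is attached to g_β g_α⁻¹, which lies in the Siegel parabolic exactly
    -- when the two cosets coincide.
    refine ((isIntertwining_weilOperator (hψ := hψ) hne α.out).symm_trans
      (isIntertwining_weilOperator hne β.out)).not_dominated (fun hmem => hαβ ?_)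
      (a⁻¹ * (D * b)) fun v => ?_
    · rw [← Quotient.out_eq α, ← Quotient.out_eq β]
      exact Quotient.sound (QuotientGroup.rightRel_apply.mpr hmem)
    · have h1 := h ((weilOperator ψ hψ α.out).symm v)
      rw [hNα, hNβ, LinearEquiv.apply_symm_apply, ← mul_assoc, ← le_inv_mul_iff₀ ha,
        ← mul_assoc] at h1
      exact h1

end Transport

end PadicSchrodinger

end

theorem mainTheorem9 (p : ℕ) [Fact p.Prime] (d : ℕ) (hd : 1 ≤ d)
    (ψ : AddChar ℚ_[p] ℂ_[p]) (hψ : IsOpen {x | ψ x = 1}) (hψ_ne : ∃ x, ψ x ≠ 1)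
    (I : Finset (PadicSchrodinger.Grassmannian p d)) :
    PadicSchrodinger.IndependentNorms I (PadicSchrodinger.grassmannNorm ψ hψ) ∧
    DenseRange (PadicSchrodinger.diagonalMap I (PadicSchrodinger.grassmannNorm ψ hψ)) ∧
    (I.Nonempty →
      ∃ (N : PadicSchrodinger.UltraNorm p (PadicSchrodinger.schwartz p d))
        (w : PadicSchrodinger.schwartz p d),
        PadicSchrodinger.Equivalent
          (PadicSchrodinger.maxNorm I (PadicSchrodinger.grassmannNorm ψ hψ)) N.toSeminorm ∧
        PadicSchrodinger.IsLocallyMaximalAt (PadicSchrodinger.schrodinger ψ hψ) N w) := by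
  have h := PadicSchrodinger.isSimpleFamily_grassmannNorm (d := d) (hψ := hψ) hψ_ne
  refine ⟨(h.separates I).independentNorms, (h.separates I).denseRange, fun hI => ?_⟩
  obtain ⟨N, hN, hw⟩ := h.exists_isLocallyMaximalAt hI PadicSchrodinger.charZp_ne_zero
  exact ⟨N, _, hN, hw⟩
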